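/- **Setting.** $G$ is a finite simple bipartite graph, with given sides $L,R$, $n\ge 3$ vertices and $m\ge 1$ edges, that has a perfect matching. For an edge-cost vector $c\in\mathbb Z^m$, min-weight perfect matching (MWPM) asks for a perfect matching of least total cost. An *optimal dual* for $c$ is an integer vector $y\in\mathbb Z^n$ that maximizes $\sum_v z_v$ over all real $z\in\mathbb R^n$ with $z_u+z_v\le c_{uv}$ for every edge $uv$. Running times count elementary operations of a random access machine with integer registers and arrays; its unit-cost operations are addition, subtraction, comparison, indirect addressing, and rounding an entry of a real input vector to the nearest integer. An algorithm is a single program, and its constants are the same for all graphs. **Theorem.** 1. There are an algorithm and constants $K,k$ such that, for every such graph, every $c\in\mathbb Z_{\ge0}^m$ and every prediction $x\in\mathbb R^n$, the algorithm solves MWPM on input $(G,c,x)$, and for every optimal dual $x^*(c)$ for $c$, with $U(x)=\|x-x^*(c)\|_1$, its running time is at most $$K\,m\sqrt n\,\min\{1+U(x),\sqrt n\}\,(\log n)^k\ \le\ K\,m\sqrt n\,(1+U(x))\,(\log n)^k .$$ 2. There are a learning algorithm and constants $K_1,k_1,K_2$ such that the following holds for every such graph, all $C,T\in\mathbb Z_{\ge0}$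 and every rule $c\mapsto x^*(c)$ that assigns an optimal dual to each $c\in\mathbb Z^m$. Given $G$, $C$, $T$, cost vectors $c_1,\dots,c_T\in\mathbb Z^m$ with $\|c_t\|_\infty\le C$ and their duals $x^*(c_1),\dots,x^*(c_T)$, the algorithm outputs a vector $\hat x\in\mathbb Q^n$ in time at most $K_1(n+m+T)^{k_1}$. For all $\varepsilon,\delta>0$ with $$T\ \ge\ K_2\Big(\frac{Cn}{\varepsilon}\Big)^2\Big(1+\log\frac1\delta\Big)$$ and every distribution $\mathcal D$ over integer $m$-vectors of $\ell_\infty$-norm $\le C$, if $c_1,\dots,c_T$ are drawn independently from $\mathcal D$, then with probability at least $1-\delta$ $$\mathbb E_{c\sim\mathcal D}\|\hat x-x^*(c)\|_1\ \le\ \min_{\|x\|_\infty\le C}\mathbb E_{c\sim\mathcal D}\|x-x^*(c)\|_1+\varepsilon .$$ Moreover, there are an algorithm, constants, and a choice, for each such graph, of one rule $x^*$ as above, such that the same guarantee holds for these rules when the algorithm is given only $G,C,T,c_1,\dots,c_T$ and not the duals. 3. For every such graph, every real $C\ge0$ and every $T\in\mathbb Z_{\ge0}$ there is a step size $\eta>0$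 such that, for every sequence $c_1,\dots,c_T\in\mathbb Z_{\ge0}^m$ with $\|c_t\|_\infty\le C$ and any optimal duals $x^*(c_t)$, the iterates $x_1=0,x_2,\dots,x_T$ of projected online subgradient descent over $[-C,C]^n$ with step size $\eta$ on the losses $x\mapsto\|x-x^*(c_t)\|_1$ (for any choice of subgradients) satisfy $$\max_{\|x\|_\infty\le C}\ \sum_{t=1}^T\Big(\|x_t-x^*(c_t)\|_1-\|x-x^*(c_t)\|_1\Big)\ \le\ Cn\sqrt{2T}.$$ -/

import Mathlib

open MeasureTheory

noncomputable section

/-! ### Bipartite graphs, perfect matchings, dual vectors -/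

/-- A finite simple bipartite graph with left vertices `Fin nL`, right vertices `Fin nR` and `m`
edges, given by the list of its edges. -/
structure BipGraph where
  nL : ℕ
  nR : ℕ
  m : ℕ
  left : Fin m → Fin nL
  right : Fin m → Fin nR
  simple : Function.Injective fun e => (left e, right e)

namespace BipGraph

variable (G : BipGraph)

/-- The number of vertices. -/
def n : ℕ := G.nL + G.nR

/-- The vertex set. -/
abbrev V : Type := Fin G.nL ⊕ Fin G.nR

/-- A set of edges that covers every vertex exactly once. -/
def IsPerfectMatching (M : Finset (Fin G.m)) : Prop :=
  (∀ i : Fin G.nL, ∃! e : Fin G.m, e ∈ M ∧ G.left e = i) ∧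
    (∀ j : Fin G.nR, ∃! e : Fin G.m, e ∈ M ∧ G.right e = j)

/-- A perfect matching of least total cost. -/
def IsMinWeightPerfectMatching (c : Fin G.m → ℤ) (M : Finset (Fin G.m)) : Prop :=
  G.IsPerfectMatching M ∧
    ∀ M' : Finset (Fin G.m), G.IsPerfectMatching M' → ∑ e ∈ M, c e ≤ ∑ e ∈ M', c e

/-- Feasibility in the dual linear program: `z u + z v ≤ c e` for every edge `e = uv`. -/
def IsDualFeasible (c : Fin G.m → ℤ) (z : G.V → ℝ) : Prop :=
  ∀ e : Fin G.m, z (Sum.inl (G.left e)) + z (Sum.inr (G.right e)) ≤ (c e : ℝ)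

/-- `y` is an integral optimal solution of the dual linear program, which maximizes `∑ v, z v`
over all real feasible `z`. -/
def IsOptimalDual (c : Fin G.m → ℤ) (y : G.V → ℤ) : Prop :=
  G.IsDualFeasible c (fun v => (y v : ℝ)) ∧
    ∀ z : G.V → ℝ, G.IsDualFeasible c z → ∑ v, z v ≤ ∑ v, (y v : ℝ)

end BipGraph

/-- The `ℓ₁`-distance between two real vectors. -/
def l1Dist {ι : Type*} [Fintype ι] (x y : ι → ℝ) : ℝ := ∑ i, |x i - y i|

/-- The cube `[-C, C]^ι`, i.e. the vectors of `ℓ∞`-norm at most `C`. -/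
def cube (ι : Type*) (C : ℝ) : Set (ι → ℝ) := {x | ∀ i, |x i| ≤ C}

/-! ### A random access machine with a step count

Programs act on integer registers and integer arrays (finitely many of each occur in a program).
The arithmetic operations are addition and subtraction only, so that numbers grow by at most one
bit per operation and the unit-cost measure is a realistic one.  There is also a read-only real
input vector, which a program can access only by rounding one of its entries to the nearest
integer. -/

/-- The contents of the memory: registers and arrays. -/
structure Store where
  reg : ℕ → ℤ
  arr : ℕ → ℤ → ℤ

/-- Integer expressions. -/
inductive Expr where
  | lit (k : ℤ)
  | reg (r : ℕ)
  | get (a : ℕ) (i : Expr)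
  | round (i : Expr)
  | add (e f : Expr)
  | sub (e f : Expr)

namespace Expr

/-- The value of an expression, with real input `ξ`. -/
def eval (ξ : ℤ → ℝ) (s : Store) : Expr → ℤ
  | lit k => k
  | reg r => s.reg r
  | get a i => s.arr a (i.eval ξ s)
  | round i => _root_.round (ξ (i.eval ξ s))
  | add e f => e.eval ξ s + f.eval ξ s
  | sub e f => e.eval ξ s - f.eval ξ s

/-- The number of elementary operations spent on evaluating an expression. -/
def size : Expr → ℕ
  | lit _ => 1
  | reg _ => 1
  | get _ i => i.size + 1
  | round i => i.size + 1
  | add e f => e.size + f.size + 1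
  | sub e f => e.size + f.size + 1

end Expr

/-- Programs: do nothing, assign to a register, assign to an array cell, run one program after
another, branch on `e < f`, repeat while `e < f`. -/
inductive Prog where
  | skip
  | set (r : ℕ) (e : Expr)
  | put (a : ℕ) (i e : Expr)
  | seq (p q : Prog)
  | branch (e f : Expr) (p q : Prog)
  | loop (e f : Expr) (p : Prog)

/-- `Exec ξ p s s' τ`: with real input `ξ`, the program `p` started in the store `s` halts in the
store `s'` after `τ` elementary operations. -/
inductive Exec (ξ : ℤ → ℝ) : Prog → Store → Store → ℕ → Prop where
  | skip (s : Store) : Exec ξ .skip s s 1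
  | set (r : ℕ) (e : Expr) (s : Store) :
      Exec ξ (.set r e) s ⟨Function.update s.reg r (e.eval ξ s), s.arr⟩ (e.size + 1)
  | put (a : ℕ) (i e : Expr) (s : Store) :
      Exec ξ (.put a i e) s
        ⟨s.reg, Function.update s.arr a (Function.update (s.arr a) (i.eval ξ s) (e.eval ξ s))⟩
        (i.size + e.size + 1)
  | seq {p q : Prog} {s₁ s₂ s₃ : Store} {τ₁ τ₂ : ℕ} :
      Exec ξ p s₁ s₂ τ₁ → Exec ξ q s₂ s₃ τ₂ → Exec ξ (.seq p q) s₁ s₃ (τ₁ + τ₂)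
  | branch_true {e f : Expr} {p q : Prog} {s s' : Store} {τ : ℕ} :
      e.eval ξ s < f.eval ξ s → Exec ξ p s s' τ →
        Exec ξ (.branch e f p q) s s' (e.size + f.size + 1 + τ)
  | branch_false {e f : Expr} {p q : Prog} {s s' : Store} {τ : ℕ} :
      ¬ e.eval ξ s < f.eval ξ s → Exec ξ q s s' τ →
        Exec ξ (.branch e f p q) s s' (e.size + f.size + 1 + τ)
  | loop_done {e f : Expr} {p : Prog} {s : Store} :
      ¬ e.eval ξ s < f.eval ξ s → Exec ξ (.loop e f p) s s (e.size + f.size + 1)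
  | loop_step {e f : Expr} {p : Prog} {s₁ s₂ s₃ : Store} {τ₁ τ₂ : ℕ} :
      e.eval ξ s₁ < f.eval ξ s₁ → Exec ξ p s₁ s₂ τ₁ → Exec ξ (.loop e f p) s₂ s₃ τ₂ →
        Exec ξ (.loop e f p) s₁ s₃ (e.size + f.size + 1 + τ₁ + τ₂)

/-! ### Input and output of programs -/

/-- The array that holds a list in the cells `0, 1, 2, …` and zero elsewhere. -/
def arrayOf {α : Type*} [Zero α] (l : List α) (i : ℤ) : α :=
  if 0 ≤ i then l.getD i.toNat 0 else 0

namespace BipGraph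

variable (G : BipGraph)

/-- The entries of a vector indexed by the vertices, left vertices first. -/
def vecList {α : Type*} (x : G.V → α) : List α :=
  List.ofFn (fun i => x (Sum.inl i)) ++ List.ofFn (fun j => x (Sum.inr j))

/-- The position of a vertex in this order. -/
def pos : G.V → ℤ
  | Sum.inl i => (i : ℤ)
  | Sum.inr j => (G.nL : ℤ) + (j : ℤ)

/-- The store with the numbers `nL, nR, m, C, T` in the registers `0, …, 4`, the left and the right
ends of the edges in the arrays `0, 1`, the lists `cs, ys` in the arrays `2, 3`, and zero
everywhere else. -/
def store (C T : ℕ) (cs ys : List ℤ) : Store where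
  reg := fun r => ([G.nL, G.nR, G.m, C, T] : List ℤ).getD r 0
  arr := fun a => arrayOf
    (([List.ofFn fun e => ((G.left e : ℕ) : ℤ), List.ofFn fun e => ((G.right e : ℕ) : ℤ),
      cs, ys] : List (List ℤ)).getD a [])

/-- The input of a matching algorithm: the graph and its edge costs. -/
def matchingInput (c : Fin G.m → ℤ) : Store := G.store 0 0 (List.ofFn c) []

/-- The input of a learner: the graph, the cost bound `C` and a list of `T` cost vectors. -/
def sampleInput (C : ℕ) {T : ℕ} (S : Fin T → Fin G.m → ℤ) : Store :=
  G.store C T (List.ofFn fun t => List.ofFn (S t)).flatten []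

/-- The same input, together with one vertex vector `y t` for each of the `T` cost vectors. -/
def labelledInput (C : ℕ) {T : ℕ} (S : Fin T → Fin G.m → ℤ) (y : Fin T → G.V → ℤ) : Store :=
  G.store C T (List.ofFn fun t => List.ofFn (S t)).flatten
    (List.ofFn fun t => G.vecList (y t)).flatten

/-- Array `4` holds the indicator vector of the edge set `M`. -/
def OutputsMatching (s : Store) (M : Finset (Fin G.m)) : Prop :=
  ∀ e : Fin G.m, s.arr 4 ((e : ℕ) : ℤ) = if e ∈ M then 1 else 0

/-- Array `4` holds the numerators, and register `0` the common positive denominator, of the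
vector `x`. -/
def OutputsVector (s : Store) (x : G.V → ℝ) : Prop :=
  0 < s.reg 0 ∧ ∀ v : G.V, x v = (s.arr 4 (G.pos v) : ℝ) / (s.reg 0 : ℝ)

/-- The program `L`, run on `T` independent samples that are presented to it by `input`, learns a
prediction of the dual vectors `xstar c` from costs of absolute value at most `C`.

On every list of samples it halts within `Kt * (n + m + T) ^ k` operations and outputs a vector
`xhat S`.  As soon as `T ≥ Ks * (C * n / ε) ^ 2 * (1 + log (1 / δ))`, for every distribution of the
costs, with probability at least `1 - δ` the expected `ℓ₁`-error of this vector exceeds that of no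
vector of `[-C, C]^n` by more than `ε`.  (The expectations are over finitely many cost vectors.) -/
def LearnsDuals (L : Prog) (Kt : ℝ) (k : ℕ) (Ks : ℝ) (xstar : (Fin G.m → ℤ) → G.V → ℤ)
    (C T : ℕ) (input : (Fin T → Fin G.m → ℤ) → Store) : Prop :=
  ∃ xhat : (Fin T → Fin G.m → ℤ) → G.V → ℝ,
    (∀ S : Fin T → Fin G.m → ℤ, (∀ t e, |S t e| ≤ (C : ℤ)) →
      ∃ (s' : Store) (τ : ℕ), Exec (fun _ => 0) L (input S) s' τ ∧ G.OutputsVector s' (xhat S) ∧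
        (τ : ℝ) ≤ Kt * ((G.n : ℝ) + G.m + T) ^ k) ∧
    ∀ ε δ : ℝ, 0 < ε → 0 < δ →
      Ks * ((C : ℝ) * G.n / ε) ^ 2 * (1 + Real.log (1 / δ)) ≤ (T : ℝ) →
      ∀ D : Measure (Fin G.m → ℤ), IsProbabilityMeasure D →
        (∀ᵐ c ∂D, ∀ e, |c e| ≤ (C : ℤ)) →
        1 - δ ≤ (Measure.pi fun _ : Fin T => D).real
          {S | ∀ x ∈ cube G.V (C : ℝ),
            ∫ c, l1Dist (xhat S) (fun v => (xstar c v : ℝ)) ∂D ≤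
              ∫ c, l1Dist x (fun v => (xstar c v : ℝ)) ∂D + ε}

end BipGraph

/-! ### Projected online (sub)gradient descent -/

/-- `g` is a subgradient of `f` at `x`. -/
def IsSubgradient {ι : Type*} [Fintype ι] (f : (ι → ℝ) → ℝ) (x g : ι → ℝ) : Prop :=
  ∀ z, f x + ∑ i, g i * (z i - x i) ≤ f z

/-- `x 0, x 1, …` are iterates of projected online subgradient descent over the domain `X` with
step size `η`, started at the origin, on the losses `loss 0, loss 1, …`: the next iterate minimizes
`η * ⟪g, z⟫ + ‖z - x t‖₂ ^ 2 / 2` over `z ∈ X` for a subgradient `g` of `loss t` at `x t`, i.e. it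
is the Euclidean projection of `x t - η • g` to `X`. -/
def IsOGD {ι : Type*} [Fintype ι] (X : Set (ι → ℝ)) (η : ℝ) (loss : ℕ → (ι → ℝ) → ℝ)
    (x : ℕ → ι → ℝ) : Prop :=
  x 0 = 0 ∧ ∀ t, ∃ g : ι → ℝ, IsSubgradient (loss t) (x t) g ∧ x (t + 1) ∈ X ∧
    IsMinOn (fun z => η * ∑ i, g i * z i + (∑ i, (z i - x t i) ^ 2) / 2) X (x (t + 1))

end

/-!
The proof exhibits programs for the random access machine and verifies them with a program logic
for total correctness in which assertions also speak about a clock (`wp`).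

**Matching.** The prediction is rounded to integers and made feasible by lowering both ends of each
violated edge.  Neither step loses more than a constant factor of the `ℓ₁`-distance `U` to an optimal
dual (`abs_round_sub_le`, `EdgeList.dist_repair`).  By duality, a minimum-weight perfect matching has
at most `O(U)` edges that are not tight for the repaired vector
(`EdgeList.PerfectEdges.card_not_tight`).  An auction on the tight edges with prices capped at
`P ≈ √n` takes time `O(m √n)` and leaves `f` vertices free; comparing its price levels with a perfect
matching that has only `O(U)` edges outside the tight ones gives `P * f ≤ n + P * O(U)`, that is,
`f = O(√n + U)` (`EdgeList.AuctionInv.card_free`).  Each free vertex is then matched along a shortest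
augmenting path for the reduced costs, found by a search with a tournament tree as its priority queue
in time `O(m log n)`, after which the duals are shifted such that the path becomes tight
(`EdgeList.SearchInv`, `EdgeList.wp_matchVertex`).  Since `f ≤ n`, the total is
`O(m log n (√n + min U n))`, which is the bound claimed (`work_le`, `BipGraph.exec_matcher`).
Optimality is complementary slackness: the final duals are feasible, and all matching edges are
tight.

**Learning.** The learner runs online subgradient descent with step size about `C / √T` on the losses
`‖x - x*(c_t)‖₁`, in integer arithmetic, and returns the average of the iterates.  The regret bound
(`descent_regret`) controls its excess loss on the sample, and the difference between the conditional
expectations and the sampled losses is a sum of bounded martingale differences, for which Azuma's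
inequality holds (`measure_runSum_gt_le`); convexity passes to the average (`descent_learns`).
The argument applies to any labels, hence to every rule `x*`.  When the labels
are not given, the learner computes them by running the matching algorithm with the prediction zero.
For the labels to be a function of the cost vector, each run has to start from the same memory: the
program records the cells to which it writes (`Prog.logged`) and resets them afterwards.

**Regret.** The bound for projected subgradient descent follows from the variational inequality of the
projection with the step size `C / √T`; subgradients of the loss have entries in `[-1, 1]`
(`exists_step_size`).
-/


/-! ### A program logic with a clock -/

instance : Add Expr := ⟨Expr.add⟩
instance : Sub Expr := ⟨Expr.sub⟩

/-- Sequential composition. -/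
infixr:60 " ;; " => Prog.seq

namespace Expr

@[simp] lemma eval_lit (ξ : ℤ → ℝ) (s : Store) (k : ℤ) : (lit k).eval ξ s = k := rfl
@[simp] lemma eval_reg (ξ : ℤ → ℝ) (s : Store) (r : ℕ) : (reg r).eval ξ s = s.reg r := rfl
@[simp] lemma eval_get (ξ : ℤ → ℝ) (s : Store) (a : ℕ) (i : Expr) :
    (get a i).eval ξ s = s.arr a (i.eval ξ s) := rfl
@[simp] lemma eval_round (ξ : ℤ → ℝ) (s : Store) (i : Expr) :
    (Expr.round i).eval ξ s = _root_.round (ξ (i.eval ξ s)) := rfl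
@[simp] lemma eval_add (ξ : ℤ → ℝ) (s : Store) (e f : Expr) :
    (e + f).eval ξ s = e.eval ξ s + f.eval ξ s := rfl
@[simp] lemma eval_sub (ξ : ℤ → ℝ) (s : Store) (e f : Expr) :
    (e - f).eval ξ s = e.eval ξ s - f.eval ξ s := rfl

@[simp] lemma size_lit (k : ℤ) : (lit k).size = 1 := rfl
@[simp] lemma size_reg (r : ℕ) : (reg r).size = 1 := rfl
@[simp] lemma size_get (a : ℕ) (i : Expr) : (get a i).size = i.size + 1 := rfl
@[simp] lemma size_round (i : Expr) : (Expr.round i).size = i.size + 1 := rfl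
@[simp] lemma size_add (e f : Expr) : (e + f).size = e.size + f.size + 1 := rfl
@[simp] lemma size_sub (e f : Expr) : (e - f).size = e.size + f.size + 1 := rfl

end Expr

namespace Store

/-- The store after an assignment to the register `r`. -/
def setReg (s : Store) (r : ℕ) (v : ℤ) : Store := ⟨Function.update s.reg r v, s.arr⟩

/-- The store after an assignment to the cell `i` of the array `a`. -/
def putArr (s : Store) (a : ℕ) (i v : ℤ) : Store :=
  ⟨s.reg, Function.update s.arr a (Function.update (s.arr a) i v)⟩

@[simp] lemma reg_setReg (s : Store) (r r' : ℕ) (v : ℤ) :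
    (s.setReg r v).reg r' = if r' = r then v else s.reg r' := by
  simp [setReg, Function.update_apply]

@[simp] lemma arr_setReg (s : Store) (r : ℕ) (v : ℤ) : (s.setReg r v).arr = s.arr := rfl

@[simp] lemma reg_putArr (s : Store) (a : ℕ) (i v : ℤ) : (s.putArr a i v).reg = s.reg := rfl

@[simp] lemma arr_putArr (s : Store) (a a' : ℕ) (i v : ℤ) :
    (s.putArr a i v).arr a' = if a' = a then Function.update (s.arr a) i v else s.arr a' := by
  simp [putArr, Function.update_apply]

end Store

namespace Prog

/-- Whether the program contains an assignment to the register `r`. -/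
def writesReg : Prog → ℕ → Bool
  | skip, _ => false
  | set r' _, r => r == r'
  | put _ _ _, _ => false
  | seq p q, r => p.writesReg r || q.writesReg r
  | branch _ _ p q, r => p.writesReg r || q.writesReg r
  | loop _ _ p, r => p.writesReg r

/-- Whether the program contains an assignment to a cell of the array `a`. -/
def writesArr : Prog → ℕ → Bool
  | skip, _ => false
  | set _ _, _ => false
  | put a' _ _, a => a == a'
  | seq p q, a => p.writesArr a || q.writesArr a
  | branch _ _ p q, a => p.writesArr a || q.writesArr a
  | loop _ _ p, a => p.writesArr a

/-- The stores agree on all registers and arrays to which `p` does not assign. -/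
structure Same (p : Prog) (s s' : Store) : Prop where
  reg : ∀ r, p.writesReg r = false → s'.reg r = s.reg r
  arr : ∀ a, p.writesArr a = false → s'.arr a = s.arr a

lemma Same.refl (p : Prog) (s : Store) : p.Same s s := ⟨fun _ _ => rfl, fun _ _ => rfl⟩

lemma Same.trans {p : Prog} {s₁ s₂ s₃ : Store} (h : p.Same s₁ s₂) (h' : p.Same s₂ s₃) :
    p.Same s₁ s₃ :=
  ⟨fun r hr => (h'.reg r hr).trans (h.reg r hr), fun a ha => (h'.arr a ha).trans (h.arr a ha)⟩

end Prog

lemma Exec.same {ξ : ℤ → ℝ} {p : Prog} {s s' : Store} {τ : ℕ} (h : Exec ξ p s s' τ) :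
    p.Same s s' := by
  induction h with
  | skip s => exact .refl _ _
  | set r e s =>
    refine ⟨fun r' hr => ?_, fun a _ => rfl⟩
    simp [Prog.writesReg] at hr
    simp [hr]
  | put a i e s =>
    refine ⟨fun r _ => rfl, fun a' ha => ?_⟩
    simp [Prog.writesArr] at ha
    simp [ha]
  | seq _ _ ih₁ ih₂ =>
    refine ⟨fun r hr => ?_, fun a ha => ?_⟩
    · simp [Prog.writesReg] at hr
      rw [ih₂.reg r hr.2, ih₁.reg r hr.1]
    · simp [Prog.writesArr] at ha
      rw [ih₂.arr a ha.2, ih₁.arr a ha.1]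
  | branch_true _ _ ih =>
    refine ⟨fun r hr => ih.reg r ?_, fun a ha => ih.arr a ?_⟩
    · simp [Prog.writesReg] at hr; exact hr.1
    · simp [Prog.writesArr] at ha; exact ha.1
  | branch_false _ _ ih =>
    refine ⟨fun r hr => ih.reg r ?_, fun a ha => ih.arr a ?_⟩
    · simp [Prog.writesReg] at hr; exact hr.2
    · simp [Prog.writesArr] at ha; exact ha.2
  | loop_done _ => exact .refl _ _
  | loop_step _ _ _ ih₁ ih₂ =>
    exact ⟨fun r hr => (ih₂.reg r hr).trans (ih₁.reg r hr),
      fun a ha => (ih₂.arr a ha).trans (ih₁.arr a ha)⟩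

/-- Total correctness with a clock: started in the store `s` at time `t`, the program halts, in a
store and at a time that satisfy `Q`. -/
def wp (ξ : ℤ → ℝ) (p : Prog) (Q : Store → ℤ → Prop) (s : Store) (t : ℤ) : Prop :=
  ∃ (s' : Store) (τ : ℕ), Exec ξ p s s' τ ∧ Q s' (t + τ)

section wp

variable {ξ : ℤ → ℝ} {p q : Prog} {Q Q' : Store → ℤ → Prop} {s : Store} {t : ℤ}

lemma wp.mono (h : wp ξ p Q s t) (hQ : ∀ s' t', Q s' t' → Q' s' t') : wp ξ p Q' s t := by
  obtain ⟨s', τ, h, h'⟩ := h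
  exact ⟨s', τ, h, hQ _ _ h'⟩

/-- What a program does not assign to is left unchanged. -/
lemma wp.frame (h : wp ξ p Q s t) : wp ξ p (fun s' t' => Q s' t' ∧ p.Same s s') s t := by
  obtain ⟨s', τ, h, h'⟩ := h
  exact ⟨s', τ, h, h', h.same⟩

@[simp] lemma wp_skip : wp ξ .skip Q s t ↔ Q s (t + 1) := by
  constructor
  · rintro ⟨_, _, h, h'⟩; cases h; simpa using h'
  · intro h; exact ⟨_, _, .skip s, by simpa using h⟩

@[simp] lemma wp_set {r : ℕ} {e : Expr} :
    wp ξ (.set r e) Q s t ↔ Q (s.setReg r (e.eval ξ s)) (t + (e.size + 1 : ℕ)) := by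
  constructor
  · rintro ⟨_, _, h, h'⟩; cases h; exact h'
  · intro h; exact ⟨_, _, .set r e s, h⟩

@[simp] lemma wp_put {a : ℕ} {i e : Expr} :
    wp ξ (.put a i e) Q s t ↔
      Q (s.putArr a (i.eval ξ s) (e.eval ξ s)) (t + (i.size + e.size + 1 : ℕ)) := by
  constructor
  · rintro ⟨_, _, h, h'⟩; cases h; exact h'
  · intro h; exact ⟨_, _, .put a i e s, h⟩

@[simp] lemma wp_seq : wp ξ (p ;; q) Q s t ↔ wp ξ p (fun s' t' => wp ξ q Q s' t') s t := by
  constructor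
  · rintro ⟨s', _, h, h'⟩
    cases h with
    | seq h₁ h₂ => exact ⟨_, _, h₁, _, _, h₂, by simpa [add_assoc] using h'⟩
  · rintro ⟨s₁, τ₁, h₁, s₂, τ₂, h₂, h'⟩
    exact ⟨_, _, .seq h₁ h₂, by simpa [add_assoc] using h'⟩

@[simp] lemma wp_branch {e f : Expr} : wp ξ (.branch e f p q) Q s t ↔
    (e.eval ξ s < f.eval ξ s → wp ξ p Q s (t + (e.size + f.size + 1 : ℕ))) ∧
      (¬ e.eval ξ s < f.eval ξ s → wp ξ q Q s (t + (e.size + f.size + 1 : ℕ))) := by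
  constructor
  · rintro ⟨s', _, h, h'⟩
    cases h with
    | branch_true hc h =>
      exact ⟨fun _ => ⟨_, _, h, by simpa [add_assoc] using h'⟩, fun hc' => absurd hc hc'⟩
    | branch_false hc h =>
      exact ⟨fun hc' => absurd hc' hc, fun _ => ⟨_, _, h, by simpa [add_assoc] using h'⟩⟩
  · rintro ⟨h₁, h₂⟩
    by_cases hc : e.eval ξ s < f.eval ξ s
    · obtain ⟨s', τ, h, h'⟩ := h₁ hc
      exact ⟨s', _, .branch_true hc h, by simpa [add_assoc] using h'⟩
    · obtain ⟨s', τ, h, h'⟩ := h₂ hc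
      exact ⟨s', _, .branch_false hc h, by simpa [add_assoc] using h'⟩

/-- The rule for loops.  The invariant bounds the clock, which is the reason for termination. -/
lemma wp_loop {e f : Expr} (I : Store → ℤ → Prop) (B : ℤ) (hB : ∀ s t, I s t → t ≤ B)
    (h₀ : I s t)
    (hstep : ∀ s' t', I s' t' → p.Same s s' → e.eval ξ s' < f.eval ξ s' →
      wp ξ p I s' (t' + (e.size + f.size + 1 : ℕ)))
    (hdone : ∀ s' t', I s' t' → p.Same s s' → ¬ e.eval ξ s' < f.eval ξ s' →
      Q s' (t' + (e.size + f.size + 1 : ℕ))) :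
    wp ξ (.loop e f p) Q s t := by
  suffices H : ∀ (n : ℕ) s' t', I s' t' → p.Same s s' → B - t' < n →
      wp ξ (.loop e f p) Q s' t' by
    exact H ((B - t).toNat + 1) s t h₀ (.refl _ _) (by omega)
  intro n
  induction n with
  | zero =>
    intro s' t' hI _ hn
    have := hB _ _ hI
    omega
  | succ n ih =>
    intro s' t' hI hs hn
    by_cases hc : e.eval ξ s' < f.eval ξ s'
    · obtain ⟨s₁, τ, h, h'⟩ := hstep s' t' hI hs hc
      obtain ⟨s₂, τ', h₂, h₂'⟩ := ih s₁ _ h' (hs.trans h.same) (by push_cast; omega)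
      refine ⟨s₂, _, .loop_step hc h h₂, ?_⟩
      simpa [add_assoc] using h₂'
    · exact ⟨s', _, .loop_done hc, hdone s' t' hI hs hc⟩

/-- `for i = 0, …, hi - 1 do p` -/
def forLoop (i : ℕ) (hi : Expr) (p : Prog) : Prog :=
  .set i (.lit 0) ;; .loop (.reg i) hi (p ;; .set i (.reg i + .lit 1))

/-- The rule for `for` loops whose invariant depends on the loop counter and on the clock. -/
lemma wp_for_clock {i : ℕ} {hi : Expr} (n B : ℤ) (J : ℤ → Store → ℤ → Prop) (hn : 0 ≤ n)
    (hB : ∀ k s' t', J k s' t' → t' ≤ B)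
    (h₀ : J 0 (s.setReg i 0) (t + 2))
    (hhi : ∀ s', (forLoop i hi p).Same s s' → hi.eval ξ s' = n)
    (hi' : p.writesReg i = false)
    (hbody : ∀ k s' t', 0 ≤ k → k < n → J k s' t' → s'.reg i = k → (forLoop i hi p).Same s s' →
      wp ξ p (fun s₂ t₂ => J (k + 1) (s₂.setReg i (k + 1)) (t₂ + 4)) s' (t' + (hi.size + 2)))
    (hQ : ∀ s' t', J n s' t' → s'.reg i = n → (forLoop i hi p).Same s s' →
      Q s' (t' + (hi.size + 2))) :
    wp ξ (forLoop i hi p) Q s t := by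
  have hsame : ∀ s', (p ;; Prog.set i (.reg i + .lit 1)).Same (s.setReg i 0) s' →
      (forLoop i hi p).Same s s' := by
    intro s' hs
    refine ⟨fun r hr => ?_, fun a ha => ?_⟩
    · simp [forLoop, Prog.writesReg] at hr
      rw [hs.reg r (by simp [Prog.writesReg, hr])]
      simp [hr]
    · simp [forLoop, Prog.writesArr] at ha
      rw [hs.arr a (by simp [Prog.writesArr, ha])]
      simp
  have hcast : ((Expr.reg i).size + hi.size + 1 : ℕ) = (hi.size + 2 : ℤ) := by simp; ring
  rw [forLoop, wp_seq, wp_set]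
  refine wp_loop (fun s' t' => ∃ k, 0 ≤ k ∧ k ≤ n ∧ s'.reg i = k ∧ J k s' t') B ?_ ?_ ?_ ?_
  · rintro s' t' ⟨k, -, -, -, hJ⟩
    exact hB _ _ _ hJ
  · exact ⟨0, le_rfl, hn, by simp, by simpa using h₀⟩
  · rintro s' t' ⟨k, hk, hkn, hik, hJ⟩ hs hlt
    have hs' := hsame _ hs
    rw [hhi s' hs', Expr.eval_reg, hik] at hlt
    rw [wp_seq, hcast]
    refine (hbody k s' _ hk hlt hJ hik hs').frame.mono ?_
    rintro s₂ t₂ ⟨hJ₂, hs₂⟩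
    have h2 : s₂.reg i = k := by rw [hs₂.reg i hi', hik]
    simp only [wp_set, Expr.eval_add, Expr.eval_reg, Expr.eval_lit, Expr.size_add,
      Expr.size_reg, Expr.size_lit, h2]
    exact ⟨k + 1, by omega, by omega, by simp, by simpa using hJ₂⟩
  · rintro s' t' ⟨k, hk, hkn, hik, hJ⟩ hs hlt
    have hs' := hsame _ hs
    rw [hhi s' hs', Expr.eval_reg, hik] at hlt
    obtain rfl : k = n := by omega
    rw [hcast]
    exact hQ _ _ hJ hik hs'

/-- The rule for `for` loops whose iterations take at most `κ` operations each. -/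
lemma wp_for {i : ℕ} {hi : Expr} (n κ : ℤ) (J : ℤ → Store → Prop) (hn : 0 ≤ n) (hκ : 0 ≤ κ)
    (h₀ : J 0 (s.setReg i 0))
    (hhi : ∀ s', (forLoop i hi p).Same s s' → hi.eval ξ s' = n)
    (hi' : p.writesReg i = false)
    (hbody : ∀ k s' t', 0 ≤ k → k < n → J k s' → s'.reg i = k → (forLoop i hi p).Same s s' →
      wp ξ p (fun s₂ t₂ => J (k + 1) (s₂.setReg i (k + 1)) ∧ t₂ ≤ t' + κ) s' t')
    (hQ : ∀ s' t', J n s' → s'.reg i = n → (forLoop i hi p).Same s s' →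
      t' ≤ t + n * (κ + hi.size + 6) + (hi.size + 4) → Q s' t') :
    wp ξ (forLoop i hi p) Q s t := by
  refine wp_for_clock n (t + 2 + n * (κ + hi.size + 6))
    (fun k s' t' => J k s' ∧ k ≤ n ∧ t' ≤ t + 2 + k * (κ + hi.size + 6)) hn ?_ ⟨h₀, hn, by simp⟩
    hhi hi' ?_ ?_
  · rintro k s' t' ⟨-, hk, ht⟩
    have := mul_le_mul_of_nonneg_right hk (show 0 ≤ κ + hi.size + 6 by positivity)
    omega
  · rintro k s' t' hk hkn ⟨hJ, -, ht⟩ hik hs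
    refine (hbody k s' _ hk hkn hJ hik hs).mono ?_
    rintro s₂ t₂ ⟨hJ₂, ht₂⟩
    exact ⟨hJ₂, by omega, by linarith⟩
  · rintro s' t' ⟨hJ, -, ht⟩ hik hs
    exact hQ _ _ hJ hik hs (by linarith)

end wp

/-! ### A priority queue: the tournament tree -/

/-- The integer binary logarithm. -/
def lg (k : ℤ) : ℤ := Nat.log 2 k.toNat

lemma lg_nonneg (k : ℤ) : 0 ≤ lg k := by simp [lg]

lemma lg_one : lg 1 = 0 := by simp [lg]

lemma lg_mono {k k' : ℤ} (h : k ≤ k') : lg k ≤ lg k' := by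
  unfold lg
  exact_mod_cast Nat.log_mono_right (Int.toNat_le_toNat h)

lemma lg_double {k : ℤ} (hk : 1 ≤ k) : lg (k + k) = lg k + 1 := by
  unfold lg
  rw [Nat.log_of_one_lt_of_le one_lt_two (by omega)]
  rw [show (k + k).toNat / 2 = k.toNat by omega]
  push_cast; ring

lemma lg_double_add_one {k : ℤ} (hk : 1 ≤ k) : lg (k + k + 1) = lg k + 1 := by
  unfold lg
  rw [Nat.log_of_one_lt_of_le one_lt_two (by omega)]
  rw [show (k + k + 1).toNat / 2 = k.toNat by omega]
  push_cast; ring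

/-- `h` halves the indices of the nodes of a tree with `m` leaves. -/
def IsHalfTable (m : ℤ) (h : ℤ → ℤ) : Prop :=
  ∀ k, 1 ≤ k → k < m → h (k + k) = k ∧ h (k + k + 1) = k

/-- The children of the inner node `k` are `2 k` and `2 k + 1`, and its value is the lesser of
theirs. -/
def NodeOK (v : ℤ → ℤ) (k : ℤ) : Prop := v k = min (v (k + k)) (v (k + k + 1))

/-- `v` is a tournament tree with the inner nodes `1, …, m - 1` and the leaves
`m, …, 2 m - 1`. -/
def IsTournament (m : ℤ) (v : ℤ → ℤ) : Prop := ∀ k, 1 ≤ k → k < m → NodeOK v k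

lemma IsTournament.root_le {m : ℤ} {v : ℤ → ℤ} (h : IsTournament m v) {k : ℤ} (hk : 1 ≤ k)
    (hk' : k < 2 * m) : v 1 ≤ v k := by
  suffices H : ∀ n : ℕ, ∀ k : ℤ, k.toNat ≤ n → 1 ≤ k → k < 2 * m → v 1 ≤ v k from
    H k.toNat k le_rfl hk hk'
  intro n
  induction n with
  | zero => intro k h1 h2; omega
  | succ n ih =>
    intro k h1 h2 h3
    rcases eq_or_lt_of_le h2 with rfl | h2'
    · exact le_rfl
    obtain ⟨q, hq⟩ : ∃ q, k = q + q ∨ k = q + q + 1 := ⟨k / 2, by omega⟩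
    have hn := h q (by omega) (by omega)
    refine (ih q (by omega) (by omega) (by omega)).trans ?_
    rw [hn]
    rcases hq with rfl | rfl
    · exact min_le_left _ _
    · exact min_le_right _ _

/-- Restores the tournament tree in array `14` after a change of the node in register `15`;
array `9` holds the halves of the indices. -/
def climb : Prog :=
  .loop (.lit 1) (.reg 15) (
    .set 15 (.get 9 (.reg 15)) ;;
    .branch (.get 14 (.reg 15 + .reg 15 + .lit 1)) (.get 14 (.reg 15 + .reg 15))
      (.put 14 (.reg 15) (.get 14 (.reg 15 + .reg 15 + .lit 1)))
      (.put 14 (.reg 15) (.get 14 (.reg 15 + .reg 15))))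

lemma nodeOK_update {m x : ℤ} {v : ℤ → ℤ} {b : ℤ} (hx : 1 ≤ x)
    (hv : ∀ k, 1 ≤ k → k < m → k ≠ x → NodeOK v k)
    (hb : b = min (v (x + x)) (v (x + x + 1))) :
    (∀ k, 1 ≤ k → k < m → k + k ≠ x → k + k + 1 ≠ x → NodeOK (Function.update v x b) k) := by
  intro k hk hkm h1 h2
  unfold NodeOK
  by_cases hkx : k = x
  · subst hkx
    rw [Function.update_self, Function.update_of_ne (by omega), Function.update_of_ne (by omega),
      hb]
  · rw [Function.update_of_ne hkx, Function.update_of_ne h1, Function.update_of_ne h2]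
    exact hv k hk hkm hkx

lemma wp_climb {ξ : ℤ → ℝ} {s : Store} {t m : ℤ} (hh : IsHalfTable m (s.arr 9))
    (hx : 1 ≤ s.reg 15) (hxm : s.reg 15 < 2 * m)
    (hv : ∀ k, 1 ≤ k → k < m → k + k ≠ s.reg 15 → k + k + 1 ≠ s.reg 15 → NodeOK (s.arr 14) k) :
    wp ξ climb (fun s' t' => IsTournament m (s'.arr 14) ∧ (∀ k, m ≤ k → s'.arr 14 k = s.arr 14 k) ∧
      t' ≤ t + 40 * lg (2 * m) + 3) s t := by
  have hlg := lg_mono hxm.le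
  -- only the parent of the current node may violate the tournament property, and the logarithm of
  -- the current index drops by one with each iteration
  refine wp_loop (fun s' t' => 1 ≤ s'.reg 15 ∧ s'.reg 15 < 2 * m ∧
    (∀ k, 1 ≤ k → k < m → k + k ≠ s'.reg 15 → k + k + 1 ≠ s'.reg 15 → NodeOK (s'.arr 14) k) ∧
    (∀ k, m ≤ k → s'.arr 14 k = s.arr 14 k) ∧ t' + 40 * lg (s'.reg 15) ≤ t + 40 * lg (2 * m))
    (t + 40 * lg (2 * m)) ?_ ?_ ?_ ?_
  · rintro s' t' ⟨-, -, -, -, h⟩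
    have := lg_nonneg (s'.reg 15)
    omega
  · exact ⟨hx, hxm, hv, fun _ _ => rfl, by omega⟩
  · rintro s' t' ⟨h1, h2, h3, h4, h5⟩ hs hlt
    simp only [Expr.eval_lit, Expr.eval_reg] at hlt
    obtain ⟨q, hq⟩ : ∃ q, s'.reg 15 = q + q ∨ s'.reg 15 = q + q + 1 := ⟨s'.reg 15 / 2, by omega⟩
    have hq1 : 1 ≤ q := by omega
    have hhalf : s'.arr 9 (s'.reg 15) = q := by
      rw [hs.arr 9 rfl]
      obtain ⟨e1, e2⟩ := hh q hq1 (by omega)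
      rcases hq with hq | hq <;> rw [hq] <;> assumption
    have hlgq : lg (s'.reg 15) = lg q + 1 := by
      rcases hq with hq | hq <;> rw [hq]
      · exact lg_double hq1
      · exact lg_double_add_one hq1
    have hv' : ∀ k, 1 ≤ k → k < m → k ≠ q → NodeOK (s'.arr 14) k := by
      intro k hk hkm hkq
      exact h3 k hk hkm (by omega) (by omega)
    simp [hhalf]
    refine ⟨fun hlt => ?_, fun hlt => ?_⟩ <;>
    · refine ⟨hq1, by omega, nodeOK_update hq1 hv' (by omega), ?_, by omega⟩
      intro k hk
      rw [Function.update_of_ne (by omega), h4 k hk]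
  · rintro s' t' ⟨h1, h2, h3, h4, h5⟩ hs hlt
    simp only [Expr.eval_lit, Expr.eval_reg] at hlt
    have := lg_nonneg (s'.reg 15)
    refine ⟨fun k hk hkm => h3 k hk hkm (by omega) (by omega), h4, ?_⟩
    simp
    omega

/-- Writes the value in register `8`, which exceeds all keys, to the leaf in register `15`: this takes
the leaf out of the queue. -/
def clearLeaf : Prog := .put 14 (.reg 15) (.reg 8) ;; climb

/-- Puts the index of a leaf of least value into register `12`. -/
def findLeaf : Prog :=
  .set 12 (.lit 1) ;;
  .loop (.reg 12) (.reg 2) (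
    .branch (.get 14 (.reg 12 + .reg 12 + .lit 1)) (.get 14 (.reg 12 + .reg 12))
      (.set 12 (.reg 12 + .reg 12 + .lit 1)) (.set 12 (.reg 12 + .reg 12)))

lemma wp_findLeaf {ξ : ℤ → ℝ} {s : Store} {t m : ℤ} (hm : 1 ≤ m) (hreg : s.reg 2 = m)
    (hv : IsTournament m (s.arr 14)) :
    wp ξ findLeaf (fun s' t' => m ≤ s'.reg 12 ∧ s'.reg 12 < 2 * m ∧
      s.arr 14 (s'.reg 12) = s.arr 14 1 ∧ t' ≤ t + 40 * lg (2 * m) + 5) s t := by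
  have hlg := lg_nonneg (2 * m)
  rw [findLeaf, wp_seq, wp_set]
  refine wp_loop (fun s' t' => 1 ≤ s'.reg 12 ∧ s'.reg 12 < 2 * m ∧
    s.arr 14 (s'.reg 12) = s.arr 14 1 ∧ t' ≤ t + 2 + 40 * lg (s'.reg 12))
    (t + 40 * lg (2 * m) + 2) ?_ ?_ ?_ ?_
  · rintro s' t' ⟨-, h2, -, h⟩
    have := lg_mono h2.le
    omega
  · simp [lg_one]; omega
  · rintro s' t' ⟨h1, h2, h3, h5⟩ hs hlt
    have e2 : s'.reg 2 = m := by rw [hs.reg 2 rfl]; simpa using hreg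
    have e14 : s'.arr 14 = s.arr 14 := hs.arr 14 rfl
    simp only [Expr.eval_reg, e2] at hlt
    have hn := hv _ h1 hlt
    unfold NodeOK at hn
    simp [e14, lg_double h1, lg_double_add_one h1]
    refine ⟨fun hlt => ⟨by omega, by omega, by omega, by omega⟩,
      fun hlt => ⟨by omega, by omega, by omega, by omega⟩⟩
  · rintro s' t' ⟨h1, h2, h3, h5⟩ hs hlt
    have e2 : s'.reg 2 = m := by rw [hs.reg 2 rfl]; simpa using hreg
    simp only [Expr.eval_reg, e2] at hlt
    have := lg_mono h2.le
    refine ⟨by omega, h2, h3, ?_⟩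
    simp
    omega

/-! ### Edge lists over the integers, feasible duals, adjacency lists -/

/-- A bipartite graph with sides `{0, …, N - 1}`, given by the list of its edges `0, …, m - 1`, with
edge costs `c` and a perfect matching: `pm i` is the edge that covers the left vertex `i`.  The data
are functions on `ℤ`, as the arrays of a store are. -/
structure EdgeList where
  N : ℤ
  m : ℤ
  l : ℤ → ℤ
  r : ℤ → ℤ
  c : ℤ → ℤ
  N_pos : 1 ≤ N
  l_nonneg : ∀ e, 0 ≤ e → e < m → 0 ≤ l e
  l_lt : ∀ e, 0 ≤ e → e < m → l e < N
  r_nonneg : ∀ e, 0 ≤ e → e < m → 0 ≤ r e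
  r_lt : ∀ e, 0 ≤ e → e < m → r e < N
  pm : ℤ → ℤ
  pm_nonneg : ∀ i, 0 ≤ i → i < N → 0 ≤ pm i
  pm_lt : ∀ i, 0 ≤ i → i < N → pm i < m
  l_pm : ∀ i, 0 ≤ i → i < N → l (pm i) = i
  r_pm_inj : ∀ i i', 0 ≤ i → i < N → 0 ≤ i' → i' < N → r (pm i) = r (pm i') → i = i'

/-- The program does not change the input of a matching algorithm. -/
def Prog.keepsInput (p : Prog) : Bool :=
  !(p.writesReg 0 || p.writesReg 1 || p.writesReg 2 || p.writesArr 0 || p.writesArr 1 ||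
    p.writesArr 2)

namespace EdgeList

variable (D : EdgeList)

/-- The store holds the edge list in the registers `0, 1, 2` and the arrays `0, 1, 2`. -/
structure Holds (s : Store) : Prop where
  reg0 : s.reg 0 = D.N
  reg1 : s.reg 1 = D.N
  reg2 : s.reg 2 = D.m
  arr0 : s.arr 0 = D.l
  arr1 : s.arr 1 = D.r
  arr2 : s.arr 2 = D.c

variable {D}

lemma Holds.same {p : Prog} {s s' : Store} (h : D.Holds s) (hs : p.Same s s')
    (hp : p.keepsInput = true) : D.Holds s' := by
  simp only [Prog.keepsInput, Bool.not_eq_true', Bool.or_eq_false_iff] at hp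
  obtain ⟨⟨⟨⟨⟨h0, h1⟩, h2⟩, h3⟩, h4⟩, h5⟩ := hp
  exact ⟨(hs.reg 0 h0).trans h.reg0, (hs.reg 1 h1).trans h.reg1, (hs.reg 2 h2).trans h.reg2,
    (hs.arr 0 h3).trans h.arr0, (hs.arr 1 h4).trans h.arr1, (hs.arr 2 h5).trans h.arr2⟩

variable (D)

lemma N_le_m : D.N ≤ D.m := by
  have h : (Finset.Ico 0 D.N).card ≤ (Finset.Ico 0 D.m).card := by
    refine Finset.card_le_card_of_injOn D.pm ?_ ?_
    · intro i hi
      simp only [Finset.coe_Ico, Set.mem_Ico] at hi ⊢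
      exact ⟨D.pm_nonneg i hi.1 hi.2, D.pm_lt i hi.1 hi.2⟩
    · intro i hi i' hi' h
      simp only [Finset.coe_Ico, Set.mem_Ico] at hi hi'
      rw [← D.l_pm i hi.1 hi.2, h, D.l_pm i' hi'.1 hi'.2]
  have := D.N_pos
  simp at h
  omega

/-- `u, v` is feasible in the dual linear program. -/
def Feasible (u v : ℤ → ℤ) : Prop := ∀ e, 0 ≤ e → e < D.m → u (D.l e) + v (D.r e) ≤ D.c e

/-- The `ℓ₁`-distance of two dual vectors. -/
noncomputable def dist (u v u' v' : ℤ → ℤ) : ℤ :=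
  ∑ i ∈ Finset.Ico 0 D.N, |u i - u' i| + ∑ j ∈ Finset.Ico 0 D.N, |v j - v' j|

end EdgeList

lemma sum_Ico_update {N k : ℤ} (hk : 0 ≤ k) (hkN : k < N) (f g : ℤ → ℤ)
    (h : ∀ i, i ≠ k → g i = f i) :
    ∑ i ∈ Finset.Ico 0 N, g i = ∑ i ∈ Finset.Ico 0 N, f i + g k - f k := by
  have hmem : k ∈ Finset.Ico 0 N := by simp [hk, hkN]
  rw [← Finset.add_sum_erase _ _ hmem, ← Finset.add_sum_erase _ f hmem]
  rw [Finset.sum_congr rfl (fun i hi => h i (Finset.ne_of_mem_erase hi))]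
  ring

/-- Rounds the prediction: the arrays `5` and `6` receive the left and the right dual vector. -/
def roundDuals : Prog :=
  forLoop 5 (.reg 0) (.put 5 (.reg 5) (.round (.reg 5))) ;;
  forLoop 5 (.reg 1) (.put 6 (.reg 5) (.round (.reg 0 + .reg 5)))

/-- Makes the dual vector feasible: for each edge in turn, a violation of its constraint is
subtracted at both ends. -/
def repairDuals : Prog :=
  forLoop 5 (.reg 2) (
    .set 6 (.get 5 (.get 0 (.reg 5)) + .get 6 (.get 1 (.reg 5)) - .get 2 (.reg 5)) ;;
    .branch (.lit 0) (.reg 6)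
      (.put 5 (.get 0 (.reg 5)) (.get 5 (.get 0 (.reg 5)) - .reg 6) ;;
        .put 6 (.get 1 (.reg 5)) (.get 6 (.get 1 (.reg 5)) - .reg 6))
      .skip)

/-- Builds the adjacency lists: array `7` holds the head of the list of each left vertex and array
`8` the successor of each edge, where the edge `e` is represented by `e + 1` and the end of a list
by `0`. -/
def buildAdjacency : Prog :=
  forLoop 5 (.reg 2) (
    .put 8 (.reg 5) (.get 7 (.get 0 (.reg 5))) ;;
    .put 7 (.get 0 (.reg 5)) (.reg 5 + .lit 1))

/-- Fills array `9` with the halves of the indices, since the machine cannot divide. -/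
def buildHalves : Prog :=
  forLoop 5 (.reg 2) (
    .put 9 (.reg 5 + .reg 5) (.reg 5) ;;
    .put 9 (.reg 5 + .reg 5 + .lit 1) (.reg 5))

/-- Computes the least `P` with `N ≤ P ^ 2` in register `7`; register `8` holds the square of the
current candidate, which is updated by additions. -/
def computeCap : Prog :=
  .set 7 (.lit 0) ;; .set 8 (.lit 0) ;;
  .loop (.reg 8) (.reg 0) (
    .set 8 (.reg 8 + .reg 7 + .reg 7 + .lit 1) ;;
    .set 7 (.reg 7 + .lit 1))

/-- `h` represents the last of the edges `0, …, k - 1` at the left vertex `i`: it is the index of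
that edge plus one, or zero if there is no such edge. -/
structure IsLast (l : ℤ → ℤ) (i k h : ℤ) : Prop where
  nonneg : 0 ≤ h
  le : h ≤ k
  left : 0 < h → l (h - 1) = i
  ne : ∀ e, h ≤ e → e < k → l e ≠ i

/-- The number of edges at `i` among `0, …, k - 1`; for a position `k` in the adjacency list of `i`,
this is the number of edges that are still to be scanned. -/
noncomputable def cnt (l : ℤ → ℤ) (i k : ℤ) : ℤ := ((Finset.Ico 0 k).filter (fun e => l e = i)).card

lemma cnt_nonneg (l : ℤ → ℤ) (i k : ℤ) : 0 ≤ cnt l i k := by simp [cnt]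

lemma cnt_zero (l : ℤ → ℤ) (i : ℤ) : cnt l i 0 = 0 := by simp [cnt]

lemma cnt_pred {l : ℤ → ℤ} {h : ℤ} (h0 : 0 < h) :
    cnt l (l (h - 1)) h = cnt l (l (h - 1)) (h - 1) + 1 := by
  unfold cnt
  rw [show (Finset.Ico 0 h).filter (fun e => l e = l (h - 1)) =
    insert (h - 1) ((Finset.Ico 0 (h - 1)).filter (fun e => l e = l (h - 1))) from ?_]
  · rw [Finset.card_insert_of_notMem (by simp)]
    push_cast; rfl
  · ext e
    simp only [Finset.mem_filter, Finset.mem_Ico, Finset.mem_insert]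
    constructor
    · rintro ⟨⟨h1, h2⟩, h3⟩
      by_cases he : e = h - 1
      · exact Or.inl he
      · exact Or.inr ⟨⟨h1, by omega⟩, h3⟩
    · rintro (rfl | ⟨⟨h1, h2⟩, h3⟩)
      · exact ⟨⟨by omega, by omega⟩, rfl⟩
      · exact ⟨⟨h1, by omega⟩, h3⟩

lemma IsLast.cnt_eq {l : ℤ → ℤ} {i k h : ℤ} (hl : IsLast l i k h) : cnt l i k = cnt l i h := by
  unfold cnt
  congr 2
  ext e
  simp only [Finset.mem_filter, Finset.mem_Ico]
  have := hl.le
  constructor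
  · rintro ⟨⟨h1, h2⟩, h3⟩
    refine ⟨⟨h1, ?_⟩, h3⟩
    by_contra hc
    exact hl.ne e (by omega) h2 h3
  · rintro ⟨⟨h1, h2⟩, h3⟩
    exact ⟨⟨h1, by omega⟩, h3⟩

lemma EdgeList.sum_cnt (D : EdgeList) : ∑ i ∈ Finset.Ico 0 D.N, cnt D.l i D.m = D.m := by
  unfold cnt
  have h := Finset.card_eq_sum_card_fiberwise (s := Finset.Ico 0 D.m) (t := Finset.Ico 0 D.N)
    (f := D.l) ?_
  · rw [← Nat.cast_sum, ← h]
    have := D.N_le_m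
    have := D.N_pos
    simp; omega
  · intro e he
    simp only [Finset.coe_Ico, Set.mem_Ico] at he ⊢
    exact ⟨D.l_nonneg e he.1 he.2, D.l_lt e he.1 he.2⟩

namespace EdgeList

variable {D : EdgeList} {ξ : ℤ → ℝ} {s : Store} {t : ℤ}

/-- The arrays `7` and `8` hold the adjacency lists. -/
structure Adjacency (D : EdgeList) (head next : ℤ → ℤ) : Prop where
  head : ∀ i, 0 ≤ i → i < D.N → IsLast D.l i D.m (head i)
  next : ∀ e, 0 ≤ e → e < D.m → IsLast D.l (D.l e) e (next e)

lemma wp_roundDuals (hD : D.Holds s) :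
    wp ξ roundDuals (fun s' t' => (∀ i, 0 ≤ i → i < D.N → s'.arr 5 i = round (ξ i)) ∧
      (∀ j, 0 ≤ j → j < D.N → s'.arr 6 j = round (ξ (D.N + j))) ∧ t' ≤ t + 40 * D.N + 20) s t := by
  rw [roundDuals, wp_seq]
  refine wp_for D.N 10 (fun k s => ∀ i, 0 ≤ i → i < k → s.arr 5 i = round (ξ i))
    (by linarith [D.N_pos]) (by norm_num) (by intros; omega) ?_ rfl ?_ ?_
  · intro s' hs
    simp [hs.reg 0 rfl, hD.reg0]
  · intro k s' t' hk hkn hJ hik hs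
    simp [hik]
    intro i hi hik
    rw [Function.update_apply]
    split_ifs with h
    · rw [h]
    · exact hJ i hi (by omega)
  intro s₁ t₁ h₁ _ hs₁ ht₁
  refine wp_for D.N 10 (fun k s => ∀ i, 0 ≤ i → i < k → s.arr 6 i = round (ξ (D.N + i)))
    (by linarith [D.N_pos]) (by norm_num) (by intros; omega) ?_ rfl ?_ ?_
  · intro s' hs
    simp [hs.reg 1 rfl, hs₁.reg 1 rfl, hD.reg1]
  · intro k s' t' hk hkn hJ hik hs
    simp [hik, hs.reg 0 rfl, hs₁.reg 0 rfl, hD.reg0]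
    intro i hi hik
    rw [Function.update_apply]
    split_ifs with h
    · rw [h]
    · exact hJ i hi (by omega)
  intro s₂ t₂ h₂ _ hs₂ ht₂
  refine ⟨?_, h₂, ?_⟩
  · rw [hs₂.arr 5 rfl]; exact h₁
  · simp at ht₁ ht₂; linarith [D.N_pos]

/-- Lowering two numbers by `x > 0`, where `x ≤ a + b`, does not increase the sum of their absolute
values. -/
lemma repair_dist {a b x : ℤ} (hx : 0 < x) (h : x ≤ a + b) :
    |a - x| + |b - x| ≤ |a| + |b| := by
  rcases abs_cases a with ⟨h1, _⟩ | ⟨h1, _⟩ <;> rcases abs_cases b with ⟨h2, _⟩ | ⟨h2, _⟩ <;>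
  rcases abs_cases (a - x) with ⟨h3, _⟩ | ⟨h3, _⟩ <;>
  rcases abs_cases (b - x) with ⟨h4, _⟩ | ⟨h4, _⟩ <;> omega

/-- A repair step moves the dual vector no farther away from any feasible vector. -/
lemma dist_repair {e : ℤ} (he : 0 ≤ e) (hem : e < D.m) {u v u' v' : ℤ → ℤ}
    (hf : D.Feasible u' v') (hx : 0 < u (D.l e) + v (D.r e) - D.c e) :
    D.dist (Function.update u (D.l e) (u (D.l e) - (u (D.l e) + v (D.r e) - D.c e)))
      (Function.update v (D.r e) (v (D.r e) - (u (D.l e) + v (D.r e) - D.c e))) u' v' ≤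
      D.dist u v u' v' := by
  unfold dist
  rw [sum_Ico_update (D.l_nonneg e he hem) (D.l_lt e he hem) (fun i => |u i - u' i|)
      (fun i => |Function.update u (D.l e) (u (D.l e) - (u (D.l e) + v (D.r e) - D.c e)) i - u' i|)
      (fun i hi => by simp only [Function.update_of_ne hi]),
    sum_Ico_update (D.r_nonneg e he hem) (D.r_lt e he hem) (fun i => |v i - v' i|)
      (fun i => |Function.update v (D.r e) (v (D.r e) - (u (D.l e) + v (D.r e) - D.c e)) i - v' i|)
      (fun i hi => by simp only [Function.update_of_ne hi])]
  simp only [Function.update_self]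
  have h := repair_dist (a := u (D.l e) - u' (D.l e)) (b := v (D.r e) - v' (D.r e)) hx
    (by have := hf e he hem; omega)
  rw [sub_right_comm, sub_right_comm (v (D.r e))]
  omega

lemma wp_repairDuals (hD : D.Holds s) :
    wp ξ repairDuals (fun s' t' => D.Feasible (s'.arr 5) (s'.arr 6) ∧
      (∀ u' v', D.Feasible u' v' →
        D.dist (s'.arr 5) (s'.arr 6) u' v' ≤ D.dist (s.arr 5) (s.arr 6) u' v') ∧
      t' ≤ t + 60 * D.m + 20) s t := by
  have hN := D.N_pos
  have hm := D.N_le_m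
  refine wp_for D.m 40 (fun k s' =>
    (∀ e, 0 ≤ e → e < k → s'.arr 5 (D.l e) + s'.arr 6 (D.r e) ≤ D.c e) ∧
    (∀ u' v', D.Feasible u' v' →
        D.dist (s'.arr 5) (s'.arr 6) u' v' ≤ D.dist (s.arr 5) (s.arr 6) u' v'))
    (by omega) (by norm_num) ⟨by intros; omega, fun _ _ _ => le_rfl⟩ ?_ rfl ?_ ?_
  · intro s' hs
    simp [hs.reg 2 rfl, hD.reg2]
  · intro k s' t' hk hkn hJ hik hs
    have hD' := hD.same hs rfl
    simp [hik, hD'.arr0, hD'.arr1, hD'.arr2]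
    constructor
    · intro hlt
      refine ⟨⟨?_, ?_⟩, by omega⟩
      · intro e he hek
        rcases eq_or_ne e k with rfl | hne
        · simp; omega
        · have := hJ.1 e he (by omega)
          simp only [Function.update_apply]
          split_ifs with h1 h2 h2
          · rw [h1, h2] at this; omega
          · rw [h1] at this; omega
          · rw [h2] at this; omega
          · exact this
      · intro u' v' hf
        exact (dist_repair hk hkn hf (by omega)).trans (hJ.2 u' v' hf)
    · intro hlt
      refine ⟨⟨?_, hJ.2⟩, by omega⟩
      intro e he hek
      rcases eq_or_ne e k with rfl | hne
      · omega
      · exact hJ.1 e he (by omega)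
  · intro s₁ t₁ h₁ _ hs₁ ht₁
    exact ⟨h₁.1, h₁.2, by simp at ht₁; linarith⟩

lemma wp_buildAdjacency (hD : D.Holds s) (h7 : s.arr 7 = 0) :
    wp ξ buildAdjacency (fun s' t' => D.Adjacency (s'.arr 7) (s'.arr 8) ∧
      t' ≤ t + 40 * D.m + 20) s t := by
  have hN := D.N_pos
  have hm := D.N_le_m
  refine wp_for D.m 20 (fun k s' =>
    (∀ i, IsLast D.l i k (s'.arr 7 i)) ∧
    (∀ e, 0 ≤ e → e < k → IsLast D.l (D.l e) e (s'.arr 8 e)))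
    (by omega) (by norm_num) ⟨?_, by intros; omega⟩ ?_ rfl ?_ ?_
  · intro i
    simp only [Store.arr_setReg, h7, Pi.zero_apply]
    exact ⟨le_rfl, le_rfl, by simp, by intros; omega⟩
  · intro s' hs
    simp [hs.reg 2 rfl, hD.reg2]
  · intro k s' t' hk hkn hJ hik hs
    have hD' := hD.same hs rfl
    simp [hik, hD'.arr0]
    refine ⟨⟨?_, ?_⟩, by omega⟩
    · intro i
      have := hJ.1 i
      rcases eq_or_ne i (D.l k) with rfl | hne
      · rw [Function.update_self]
        exact ⟨by omega, by omega, by simp, by intros; omega⟩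
      · rw [Function.update_of_ne hne]
        refine ⟨this.nonneg, by linarith [this.le], this.left, ?_⟩
        intro e h1 h2
        rcases eq_or_ne e k with rfl | hne'
        · exact hne.symm
        · exact this.ne e h1 (by omega)
    · intro e he hek
      rcases eq_or_ne e k with rfl | hne
      · rw [Function.update_self]
        exact hJ.1 _
      · rw [Function.update_of_ne hne]
        exact hJ.2 e he (by omega)
  · intro s₁ t₁ h₁ _ hs₁ ht₁
    exact ⟨⟨fun i _ _ => h₁.1 i, h₁.2⟩, by simp at ht₁; linarith⟩

lemma wp_buildHalves (hD : D.Holds s) :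
    wp ξ buildHalves (fun s' t' => IsHalfTable D.m (s'.arr 9) ∧
      t' ≤ t + 40 * D.m + 20) s t := by
  have hN := D.N_pos
  have hm := D.N_le_m
  refine wp_for D.m 20 (fun k s' =>
    (∀ q, 1 ≤ q → q < k → s'.arr 9 (q + q) = q ∧ s'.arr 9 (q + q + 1) = q))
    (by omega) (by norm_num) (by intros; omega) ?_ rfl ?_ ?_
  · intro s' hs
    simp [hs.reg 2 rfl, hD.reg2]
  · intro k s' t' hk hkn hJ hik hs
    simp [hik]
    refine ⟨?_, by omega⟩
    intro q hq hqk
    rcases eq_or_ne q k with rfl | hne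
    · rw [Function.update_of_ne (by omega)]
      simp
    · rw [Function.update_of_ne (by omega), Function.update_of_ne (by omega),
        Function.update_of_ne (by omega), Function.update_of_ne (by omega)]
      exact hJ q hq (by omega)
  · intro s₁ t₁ h₁ _ hs₁ ht₁
    exact ⟨h₁, by simp at ht₁; linarith⟩

lemma wp_computeCap (hD : D.Holds s) :
    wp ξ computeCap (fun s' t' => D.N ≤ s'.reg 7 ^ 2 ∧ (s'.reg 7 - 1) ^ 2 < D.N ∧ 1 ≤ s'.reg 7 ∧
      t' ≤ t + 20 * s'.reg 7 + 20) s t := by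
  have hN := D.N_pos
  rw [computeCap, wp_seq, wp_set, wp_seq, wp_set]
  refine wp_loop (fun s' t' => 0 ≤ s'.reg 7 ∧ s'.reg 8 = s'.reg 7 ^ 2 ∧
    (1 ≤ s'.reg 7 → (s'.reg 7 - 1) ^ 2 < D.N) ∧
    t' ≤ t + 4 + 20 * s'.reg 7) (t + 4 + 20 * (D.N + 1)) ?_ ?_ ?_ ?_
  · rintro s' t' ⟨h1, h2, h3, h4⟩
    have : s'.reg 7 ≤ D.N + 1 := by
      by_contra hc
      have := h3 (by omega)
      nlinarith
    omega
  · simp; omega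
  · rintro s' t' ⟨h1, h2, h3, h4⟩ hs hlt
    have e0 : s'.reg 0 = D.N := by rw [hs.reg 0 rfl]; simpa using hD.reg0
    simp [e0] at hlt
    simp
    exact ⟨by omega, by rw [h2]; ring, fun _ => by omega, by omega⟩
  · rintro s' t' ⟨h1, h2, h3, h4⟩ hs hlt
    have e0 : s'.reg 0 = D.N := by rw [hs.reg 0 rfl]; simpa using hD.reg0
    simp [e0] at hlt
    have : 1 ≤ s'.reg 7 := by
      by_contra hc
      have : s'.reg 7 = 0 := by omega
      rw [this] at h2; omega
    refine ⟨by omega, h3 this, this, by simp; omega⟩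

end EdgeList

/-! ### The auction on the tight edges -/

/-- One step of the auction: the free left vertex in register `8` inspects the next edge of its
adjacency list.  If that edge is tight and its right end is not dearer than the level of the vertex,
then the vertex takes over the right end, and the former owner, if any, becomes the current free
vertex; otherwise the edge is passed.  At the end of the list the level is raised.  Register `9` is
cleared when there is no current vertex left. -/
def auctionStep : Prog :=
  .set 10 (.get 11 (.reg 8)) ;;
  .branch (.lit 0) (.reg 10)
    (.set 11 (.reg 10 - .lit 1) ;;
      .set 12 (.get 1 (.reg 11)) ;;
      .set 15 (.lit 0) ;;
      .branch (.get 2 (.reg 11) - .get 5 (.reg 8) - .get 6 (.reg 12)) (.lit 1)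
        (.branch (.get 12 (.reg 12)) (.get 10 (.reg 8) + .lit 1) (.set 15 (.lit 1)) .skip)
        .skip ;;
      .branch (.lit 0) (.reg 15)
        (.set 14 (.get 13 (.reg 12)) ;;
          .put 13 (.reg 12) (.reg 10) ;;
          .put 12 (.reg 12) (.get 10 (.reg 8) + .lit 1) ;;
          .branch (.lit 0) (.reg 14)
            (.set 8 (.get 0 (.reg 14 - .lit 1)))
            (.set 9 (.lit 0)))
        (.put 11 (.reg 8) (.get 8 (.reg 11))))
    (.put 10 (.reg 8) (.get 10 (.reg 8) + .lit 1) ;;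
      .put 11 (.reg 8) (.get 7 (.reg 8)) ;;
      .branch (.get 10 (.reg 8)) (.reg 7) .skip (.set 9 (.lit 0)))

/-- The auction.  Register `7` holds the cap on the prices, the arrays `10, 11, 12, 13` hold the
levels of the left vertices, their positions in the adjacency lists, the prices of the right
vertices, and the edges (plus one) by which these are matched. -/
def auction : Prog :=
  forLoop 5 (.reg 0) (.put 11 (.reg 5) (.get 7 (.reg 5))) ;;
  forLoop 5 (.reg 0)
    (.set 8 (.reg 5) ;; .set 9 (.lit 1) ;; .loop (.lit 0) (.reg 9) auctionStep)

namespace EdgeList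

variable (D : EdgeList)

/-- `mr` encodes a matching of tight edges that covers exactly the left vertices in `S`: the right
vertex `j` is free if `mr j = 0`, and otherwise it is covered by the edge `mr j - 1`. -/
structure Matching (u v mr : ℤ → ℤ) (S : ℤ → Prop) : Prop where
  nonneg : ∀ j, 0 ≤ j → j < D.N → 0 ≤ mr j
  le : ∀ j, 0 ≤ j → j < D.N → mr j ≤ D.m
  right : ∀ j, 0 ≤ j → j < D.N → 0 < mr j → D.r (mr j - 1) = j
  tight : ∀ j, 0 ≤ j → j < D.N → 0 < mr j → u (D.l (mr j - 1)) + v j = D.c (mr j - 1)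
  inj : ∀ j j', 0 ≤ j → j < D.N → 0 ≤ j' → j' < D.N → 0 < mr j → 0 < mr j' →
    D.l (mr j - 1) = D.l (mr j' - 1) → j = j'
  cover : ∀ i, 0 ≤ i → i < D.N → (S i ↔ ∃ j, 0 ≤ j ∧ j < D.N ∧ 0 < mr j ∧ D.l (mr j - 1) = i)

/-- `e` is an edge without slack. -/
structure Tight (u v : ℤ → ℤ) (e : ℤ) : Prop where
  nonneg : 0 ≤ e
  lt : e < D.m
  eq : u (D.l e) + v (D.r e) = D.c e

/-- The invariant of the auction.  A matched right vertex costs one more than the level of its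
owner; no tight neighbour of a left vertex is cheaper than the level of that vertex, and those
neighbours that it has passed in its adjacency list are dearer. -/
structure AuctionInv (u v : ℤ → ℤ) (P : ℤ) (lev cur price mr : ℤ → ℤ) (S : ℤ → Prop) : Prop where
  matching : D.Matching u v mr S
  lev_nonneg : ∀ i, 0 ≤ i → i < D.N → 0 ≤ lev i
  lev_le : ∀ i, 0 ≤ i → i < D.N → lev i ≤ P
  lev_lt : ∀ i, 0 ≤ i → i < D.N → S i → lev i < P
  level : ∀ e, D.Tight u v e → lev (D.l e) ≤ price (D.r e)
  cur_nonneg : ∀ i, 0 ≤ i → i < D.N → 0 ≤ cur i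
  cur_le : ∀ i, 0 ≤ i → i < D.N → cur i ≤ D.m
  cur_left : ∀ i, 0 ≤ i → i < D.N → 0 < cur i → D.l (cur i - 1) = i
  passed : ∀ e, D.Tight u v e → cur (D.l e) ≤ e → lev (D.l e) + 1 ≤ price (D.r e)
  price_free : ∀ j, 0 ≤ j → j < D.N → mr j = 0 → price j = 0
  price_mr : ∀ j, 0 ≤ j → j < D.N → 0 < mr j → price j = lev (D.l (mr j - 1)) + 1

/-- The potential that pays for the auction: each step lowers it.  A left vertex scans its adjacency
list, whose remaining length is `cnt D.l i (cur i)`, once on each level, and a price can rise `P`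
times. -/
noncomputable def auctionPot (P : ℤ) (lev cur price : ℤ → ℤ) : ℤ :=
  ∑ i ∈ Finset.Ico 0 D.N, ((P - lev i) * (cnt D.l i D.m + 1) + cnt D.l i (cur i)) +
    ∑ j ∈ Finset.Ico 0 D.N, (P - price j)

variable {D} {u v head next lev cur price mr : ℤ → ℤ} {P : ℤ} {S S' : ℤ → Prop}

lemma Matching.congr (h : D.Matching u v mr S) (hS : ∀ i, 0 ≤ i → i < D.N → (S' i ↔ S i)) :
    D.Matching u v mr S' :=
  { h with cover := fun i hi hiN => (hS i hi hiN).trans (h.cover i hi hiN) }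

lemma Matching.left_bounds (h : D.Matching u v mr S) {j : ℤ} (hj : 0 ≤ j) (hjN : j < D.N)
    (hmr : 0 < mr j) : 0 ≤ D.l (mr j - 1) ∧ D.l (mr j - 1) < D.N := by
  have := h.le j hj hjN
  exact ⟨D.l_nonneg _ (by omega) (by omega), D.l_lt _ (by omega) (by omega)⟩

lemma Matching.covers (h : D.Matching u v mr S) {j : ℤ} (hj : 0 ≤ j) (hjN : j < D.N)
    (hmr : 0 < mr j) : S (D.l (mr j - 1)) :=
  (h.cover _ (h.left_bounds hj hjN hmr).1 (h.left_bounds hj hjN hmr).2).2 ⟨j, hj, hjN, hmr, rfl⟩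

/-- A tight edge whose left end is free enters the matching; the former mate of its right end, if
any, becomes free. -/
lemma Matching.insert (h : D.Matching u v mr S) {e : ℤ} (he : D.Tight u v e) (hS : ¬ S (D.l e)) :
    D.Matching u v (Function.update mr (D.r e) (e + 1)) (fun i => i = D.l e ∨
      (S i ∧ ¬ (0 < mr (D.r e) ∧ i = D.l (mr (D.r e) - 1)))) := by
  have hr0 := D.r_nonneg e he.nonneg he.lt
  have hrN := D.r_lt e he.nonneg he.lt
  have h0 := he.nonneg
  have hm := he.lt
  refine ⟨?_, ?_, ?_, ?_, ?_, ?_⟩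
  · intro j' h1 h2
    have := h.nonneg j' h1 h2
    rw [Function.update_apply]; split_ifs <;> omega
  · intro j' h1 h2
    have := h.le j' h1 h2
    rw [Function.update_apply]; split_ifs <;> omega
  · intro j' h1 h2
    rw [Function.update_apply]
    split_ifs with h3
    · intro _; rw [h3, add_sub_cancel_right]
    · exact h.right j' h1 h2
  · intro j' h1 h2
    rw [Function.update_apply]
    split_ifs with h3
    · intro _; rw [h3, add_sub_cancel_right]; exact he.eq
    · exact h.tight j' h1 h2
  · intro j₁ j₂ h1 h2 h3 h4
    rw [Function.update_apply, Function.update_apply]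
    split_ifs with h5 h6 h6
    · intros; rw [h5, h6]
    · intro _ h7 h8
      rw [add_sub_cancel_right] at h8
      exact absurd (h8 ▸ h.covers h3 h4 h7) hS
    · intro h7 _ h8
      rw [add_sub_cancel_right] at h8
      exact absurd (h8 ▸ h.covers h1 h2 h7) hS
    · exact h.inj j₁ j₂ h1 h2 h3 h4
  · intro i' h1 h2
    constructor
    · rintro (rfl | ⟨h3, h4⟩)
      · exact ⟨D.r e, hr0, hrN, by rw [Function.update_self]; omega,
          by rw [Function.update_self, add_sub_cancel_right]⟩
      · obtain ⟨j', h5, h6, h7, h8⟩ := (h.cover i' h1 h2).1 h3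
        have : j' ≠ D.r e := by
          rintro rfl
          exact h4 ⟨h7, h8.symm⟩
        exact ⟨j', h5, h6, by rwa [Function.update_of_ne this],
          by rwa [Function.update_of_ne this]⟩
    · rintro ⟨j', h5, h6, h7, h8⟩
      rcases eq_or_ne j' (D.r e) with rfl | hne
      · rw [Function.update_self, add_sub_cancel_right] at h8
        exact Or.inl h8.symm
      · rw [Function.update_of_ne hne] at h7 h8
        refine Or.inr ⟨(h.cover i' h1 h2).2 ⟨j', h5, h6, h7, h8⟩, ?_⟩
        rintro ⟨h9, h10⟩
        exact hne (h.inj j' _ h5 h6 hr0 hrN h7 h9 (h8.trans h10))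

lemma AuctionInv.congr (h : D.AuctionInv u v P lev cur price mr S)
    (hS : ∀ i, 0 ≤ i → i < D.N → (S' i ↔ S i)) : D.AuctionInv u v P lev cur price mr S' :=
  { h with
    matching := h.matching.congr hS
    lev_lt := fun i hi hiN h' => h.lev_lt i hi hiN ((hS i hi hiN).1 h') }

lemma AuctionInv.price_bounds (h : D.AuctionInv u v P lev cur price mr S) (hP : 0 ≤ P) {j : ℤ}
    (hj : 0 ≤ j) (hjN : j < D.N) : 0 ≤ price j ∧ price j ≤ P := by
  rcases (h.matching.nonneg j hj hjN).eq_or_lt with h0 | h0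
  · rw [h.price_free j hj hjN h0.symm]; omega
  · obtain ⟨h1, h2⟩ := h.matching.left_bounds hj hjN h0
    rw [h.price_mr j hj hjN h0]
    have := h.lev_lt _ h1 h2 (h.matching.covers hj hjN h0)
    have := h.lev_nonneg _ h1 h2
    omega

lemma AuctionInv.pot_nonneg (h : D.AuctionInv u v P lev cur price mr S) (hP : 0 ≤ P) :
    0 ≤ D.auctionPot P lev cur price := by
  refine add_nonneg (Finset.sum_nonneg fun i hi => ?_) (Finset.sum_nonneg fun j hj => ?_)
  · simp only [Finset.mem_Ico] at hi
    have := h.lev_le i hi.1 hi.2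
    have h1 := cnt_nonneg D.l i D.m
    have h2 := cnt_nonneg D.l i (cur i)
    have := mul_nonneg (show 0 ≤ P - lev i by omega) (show 0 ≤ cnt D.l i D.m + 1 by omega)
    omega
  · simp only [Finset.mem_Ico] at hj
    have := h.price_bounds hP hj.1 hj.2
    omega

/-- At the end of its list, a free left vertex rises by one level and starts afresh. -/
lemma AuctionInv.rise (h : D.AuctionInv u v P lev cur price mr S) (hadj : D.Adjacency head next)
    {i : ℤ} (hi : 0 ≤ i) (hiN : i < D.N) (hS : ¬ S i) (hlev : lev i < P) (hcur : cur i = 0) :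
    D.AuctionInv u v P (Function.update lev i (lev i + 1)) (Function.update cur i (head i)) price mr
      S := by
  have hh := hadj.head i hi hiN
  refine ⟨h.matching, ?_, ?_, ?_, ?_, ?_, ?_, ?_, ?_, h.price_free, ?_⟩
  · intro i' h1 h2
    have := h.lev_nonneg i' h1 h2
    have := h.lev_nonneg i hi hiN
    rw [Function.update_apply]; split_ifs <;> omega
  · intro i' h1 h2
    have := h.lev_le i' h1 h2
    rw [Function.update_apply]; split_ifs <;> omega
  · intro i' h1 h2 h3
    rw [Function.update_of_ne (by rintro rfl; exact hS h3)]
    exact h.lev_lt i' h1 h2 h3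
  · intro e he
    have h1 := h.level e he
    have h2 := h.passed e he
    rw [Function.update_apply]
    split_ifs with h3
    · rw [h3, hcur] at h2
      exact h2 he.nonneg
    · exact h1
  · intro i' h1 h2
    have := h.cur_nonneg i' h1 h2
    have := hh.nonneg
    rw [Function.update_apply]; split_ifs <;> omega
  · intro i' h1 h2
    have := h.cur_le i' h1 h2
    have := hh.le
    rw [Function.update_apply]; split_ifs <;> omega
  · intro i' h1 h2
    rw [Function.update_apply]
    split_ifs with h3
    · rw [h3]; exact hh.left
    · exact h.cur_left i' h1 h2
  · intro e he
    have h2 := h.passed e he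
    rw [Function.update_apply, Function.update_apply]
    split_ifs with h3
    · intro h4
      exact absurd h3 (hh.ne e h4 he.lt)
    · exact h2
  · intro j hj hjN hmr
    have hne : D.l (mr j - 1) ≠ i := by
      intro hc
      rw [← hc] at hS
      exact hS (h.matching.covers hj hjN hmr)
    rw [Function.update_of_ne hne]
    exact h.price_mr j hj hjN hmr

lemma auctionPot_rise (hadj : D.Adjacency head next) {i : ℤ} (hi : 0 ≤ i) (hiN : i < D.N)
    (hcur : cur i = 0) :
    D.auctionPot P (Function.update lev i (lev i + 1)) (Function.update cur i (head i)) price + 1 =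
      D.auctionPot P lev cur price := by
  unfold auctionPot
  rw [sum_Ico_update hi hiN (fun i => (P - lev i) * (cnt D.l i D.m + 1) + cnt D.l i (cur i))]
  · simp only [Function.update_self]
    rw [hcur, cnt_zero, ← (hadj.head i hi hiN).cnt_eq]
    ring
  · intro i' hi'
    simp only [Function.update_of_ne hi']

/-- A free left vertex passes an edge that is not tight, or whose right end is too dear. -/
lemma AuctionInv.pass (h : D.AuctionInv u v P lev cur price mr S) (hadj : D.Adjacency head next)
    {i : ℤ} (hi : 0 ≤ i) (hiN : i < D.N) (hcur : 0 < cur i)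
    (hp : D.Tight u v (cur i - 1) → lev i < price (D.r (cur i - 1))) :
    D.AuctionInv u v P lev (Function.update cur i (next (cur i - 1))) price mr S := by
  have hc := h.cur_left i hi hiN hcur
  have hle := h.cur_le i hi hiN
  have hn := hadj.next (cur i - 1) (by omega) (by omega)
  rw [hc] at hn
  refine ⟨h.matching, h.lev_nonneg, h.lev_le, h.lev_lt, h.level, ?_, ?_, ?_, ?_, h.price_free,
    h.price_mr⟩
  · intro i' h1 h2
    have := h.cur_nonneg i' h1 h2
    have := hn.nonneg
    rw [Function.update_apply]; split_ifs <;> omega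
  · intro i' h1 h2
    have := h.cur_le i' h1 h2
    have := hn.le
    rw [Function.update_apply]; split_ifs <;> omega
  · intro i' h1 h2
    rw [Function.update_apply]
    split_ifs with h3
    · rw [h3]; exact hn.left
    · exact h.cur_left i' h1 h2
  · intro e he
    have h2 := h.passed e he
    rw [Function.update_apply]
    split_ifs with h3
    · intro h4
      rw [h3] at h2 ⊢
      by_cases h5 : cur i ≤ e
      · exact h2 h5
      · by_cases h6 : e = cur i - 1
        · rw [h6]; rw [h6] at he; linarith [hp he]
        · exact absurd h3 (hn.ne e h4 (by omega))
    · exact h2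

lemma auctionPot_pass (hadj : D.Adjacency head next) {i : ℤ} (hi : 0 ≤ i) (hiN : i < D.N)
    (hcur : 0 < cur i) (hcm : cur i ≤ D.m) (hl : D.l (cur i - 1) = i) :
    D.auctionPot P lev (Function.update cur i (next (cur i - 1))) price + 1 =
      D.auctionPot P lev cur price := by
  unfold auctionPot
  rw [sum_Ico_update hi hiN (fun i => (P - lev i) * (cnt D.l i D.m + 1) + cnt D.l i (cur i))]
  · simp only [Function.update_self]
    have h1 := (hadj.next (cur i - 1) (by omega) (by omega)).cnt_eq
    have h2 := cnt_pred (l := D.l) hcur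
    rw [hl] at h1 h2
    rw [← h1, h2]
    ring
  · intro i' hi'
    simp only [Function.update_of_ne hi']

/-- A free left vertex takes over the right end of a tight edge whose price is its level. -/
lemma AuctionInv.take (h : D.AuctionInv u v P lev cur price mr S)
    {i : ℤ} (hi : 0 ≤ i) (hiN : i < D.N) (hS : ¬ S i) (hlev : lev i < P) (hcur : 0 < cur i)
    (ht : D.Tight u v (cur i - 1)) (hp : price (D.r (cur i - 1)) ≤ lev i) :
    D.AuctionInv u v P lev cur (Function.update price (D.r (cur i - 1)) (lev i + 1))
      (Function.update mr (D.r (cur i - 1)) (cur i))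
      (fun i' => i' = i ∨ (S i' ∧
        ¬ (0 < mr (D.r (cur i - 1)) ∧ i' = D.l (mr (D.r (cur i - 1)) - 1)))) := by
  have hc := h.cur_left i hi hiN hcur
  have hle := h.cur_le i hi hiN
  have hM := h.matching.insert ht (by rwa [hc])
  rw [hc, sub_add_cancel] at hM
  obtain ⟨j, hj⟩ : ∃ j, j = D.r (cur i - 1) := ⟨_, rfl⟩
  rw [← hj] at hp hM ⊢
  refine ⟨hM, h.lev_nonneg, h.lev_le, ?_, ?_, h.cur_nonneg, h.cur_le, h.cur_left, ?_, ?_, ?_⟩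
  · intro i' h1 h2 h3
    rcases h3 with rfl | ⟨h3, -⟩
    · exact hlev
    · exact h.lev_lt i' h1 h2 h3
  · intro e he
    have := h.level e he
    rw [Function.update_apply]; split_ifs with h3
    · rw [h3] at this; omega
    · exact this
  · intro e he h4
    have := h.passed e he h4
    rw [Function.update_apply]; split_ifs with h3
    · rw [h3] at this; omega
    · exact this
  · intro j' h1 h2
    rw [Function.update_apply, Function.update_apply]
    split_ifs with h3
    · omega
    · exact h.price_free j' h1 h2
  · intro j' h1 h2
    rw [Function.update_apply, Function.update_apply]
    split_ifs with h3
    · rw [hc]; intro; rfl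
    · exact h.price_mr j' h1 h2

lemma auctionPot_take {i j : ℤ} (hj : 0 ≤ j) (hjN : j < D.N) (hp : price j ≤ lev i) :
    D.auctionPot P lev cur (Function.update price j (lev i + 1)) + 1 ≤
      D.auctionPot P lev cur price := by
  unfold auctionPot
  rw [sum_Ico_update hj hjN (fun j => P - price j) (fun j' => P - Function.update price j (lev i + 1) j')]
  · simp only [Function.update_self]
    omega
  · intro i' hi'
    simp [Function.update_of_ne hi']

open Finset Classical in
/-- The number of free left vertices after the auction.  `σ` is a perfect matching with at most `g`
edges that are not tight.  Up to `g` exceptions it maps the left vertices of level at least `ℓ` to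
right vertices of price at least `ℓ`; but the former exceed the right vertices of price at least
`ℓ + 1` in number by the `f` free vertices.  Sum over all `ℓ` below the cap. -/
lemma AuctionInv.card_free (h : D.AuctionInv u v P lev cur price mr S) (hP : 0 ≤ P)
    {σ : ℤ → ℤ}
    (hσ : ∀ i, 0 ≤ i → i < D.N → 0 ≤ σ i ∧ σ i < D.m ∧ D.l (σ i) = i)
    (hinj : ∀ i i', 0 ≤ i → i < D.N → 0 ≤ i' → i' < D.N → D.r (σ i) = D.r (σ i') → i = i') :
    P * #{i ∈ Ico 0 D.N | P ≤ lev i} ≤ D.N + P * #{i ∈ Ico 0 D.N | ¬ D.Tight u v (σ i)} := by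
  set f := #{i ∈ Ico 0 D.N | P ≤ lev i} with hf
  set g := #{i ∈ Ico 0 D.N | ¬ D.Tight u v (σ i)} with hg
  -- the comparison of two consecutive price levels
  have key : ∀ ℓ : ℤ, 0 ≤ ℓ → ℓ < P → #{j ∈ Ico 0 D.N | ℓ + 1 ≤ price j} + f ≤
      #{j ∈ Ico 0 D.N | ℓ ≤ price j} + g := by
    intro ℓ hℓ hℓP
    have h1 : #{j ∈ Ico 0 D.N | ℓ + 1 ≤ price j} ≤ #{i ∈ Ico 0 D.N | ℓ ≤ lev i ∧ lev i < P} := by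
      refine card_le_card_of_injOn (fun j => D.l (mr j - 1)) ?_ ?_
      · intro j hj
        simp only [coe_filter, mem_Ico, Set.mem_ofPred_eq] at hj ⊢
        obtain ⟨⟨hj, hjN⟩, hp⟩ := hj
        have hmr : 0 < mr j := by
          rcases (h.matching.nonneg j hj hjN).eq_or_lt with h0 | h0
          · have := h.price_free j hj hjN h0.symm; omega
          · exact h0
        have hb := h.matching.left_bounds hj hjN hmr
        have := h.price_mr j hj hjN hmr
        exact ⟨hb, by omega, h.lev_lt _ hb.1 hb.2 (h.matching.covers hj hjN hmr)⟩
      · intro j hj j' hj'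
        simp only [coe_filter, mem_Ico, Set.mem_ofPred_eq] at hj hj'
        obtain ⟨⟨hj, hjN⟩, hp⟩ := hj
        obtain ⟨⟨hj', hjN'⟩, hp'⟩ := hj'
        refine h.matching.inj j j' hj hjN hj' hjN' ?_ ?_
        · rcases (h.matching.nonneg j hj hjN).eq_or_lt with h0 | h0
          · have := h.price_free j hj hjN h0.symm; omega
          · exact h0
        · rcases (h.matching.nonneg j' hj' hjN').eq_or_lt with h0 | h0
          · have := h.price_free j' hj' hjN' h0.symm; omega
          · exact h0
    have h2 : #{i ∈ Ico 0 D.N | ℓ ≤ lev i ∧ lev i < P} + f = #{i ∈ Ico 0 D.N | ℓ ≤ lev i} := by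
      rw [hf, ← card_union_of_disjoint]
      · congr 1
        ext i
        simp only [mem_union, mem_filter, mem_Ico]
        constructor
        · rintro (⟨h1, h2, h3⟩ | ⟨h1, h2⟩)
          · exact ⟨h1, h2⟩
          · exact ⟨h1, by omega⟩
        · rintro ⟨h1, h2⟩
          by_cases h3 : lev i < P
          · exact Or.inl ⟨h1, h2, h3⟩
          · exact Or.inr ⟨h1, by omega⟩
      · rw [disjoint_filter]
        intro i _ h1
        omega
    have h3 : #{i ∈ Ico 0 D.N | ℓ ≤ lev i} ≤
        #{i ∈ Ico 0 D.N | ℓ ≤ lev i ∧ D.Tight u v (σ i)} + g := by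
      rw [hg]
      refine (card_le_card ?_).trans (card_union_le _ _)
      intro i hi
      simp only [mem_union, mem_filter] at hi ⊢
      by_cases ht : D.Tight u v (σ i)
      · exact Or.inl ⟨hi.1, hi.2, ht⟩
      · exact Or.inr ⟨hi.1, ht⟩
    have h4 : #{i ∈ Ico 0 D.N | ℓ ≤ lev i ∧ D.Tight u v (σ i)} ≤
        #{j ∈ Ico 0 D.N | ℓ ≤ price j} := by
      refine card_le_card_of_injOn (fun i => D.r (σ i)) ?_ ?_
      · intro i hi
        simp only [coe_filter, mem_Ico, Set.mem_ofPred_eq] at hi ⊢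
        obtain ⟨⟨hi, hiN⟩, hlev, ht⟩ := hi
        have := h.level _ ht
        rw [(hσ i hi hiN).2.2] at this
        exact ⟨⟨D.r_nonneg _ ht.nonneg ht.lt, D.r_lt _ ht.nonneg ht.lt⟩, by omega⟩
      · intro i hi i' hi'
        simp only [coe_filter, mem_Ico, Set.mem_ofPred_eq] at hi hi'
        exact hinj i i' hi.1.1 hi.1.2 hi'.1.1 hi'.1.2
    omega
  -- the sum over the price levels telescopes
  have sum : ∀ n : ℕ, (n : ℤ) ≤ P →
      (#{j ∈ Ico 0 D.N | (n : ℤ) ≤ price j} : ℤ) + n * f ≤ D.N + n * g := by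
    intro n
    induction n with
    | zero =>
      intro _
      have : #{j ∈ Ico 0 D.N | ((0 : ℕ) : ℤ) ≤ price j} ≤ #(Ico 0 D.N) := card_filter_le _ _
      rw [Int.card_Ico] at this
      have := D.N_pos
      push_cast at *
      omega
    | succ n ih =>
      intro hn
      have h1 := ih (by push_cast at hn; omega)
      have h2 := key n (by omega) (by push_cast at hn; omega)
      push_cast
      have h3 : (#{j ∈ Ico 0 D.N | (n : ℤ) + 1 ≤ price j} : ℤ) + f ≤
        #{j ∈ Ico 0 D.N | (n : ℤ) ≤ price j} + g := by exact_mod_cast h2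
      nlinarith
  have := sum P.toNat (by omega)
  rw [Int.toNat_of_nonneg hP] at this
  have h0 : (0 : ℤ) ≤ #{j ∈ Ico 0 D.N | P ≤ price j} := by positivity
  omega

lemma auctionPot_init (hadj : D.Adjacency head next) (hP : 1 ≤ P)
    (hcur : ∀ i, 0 ≤ i → i < D.N → cur i = head i) :
    D.auctionPot P 0 cur 0 ≤ 4 * (D.m * P) := by
  have hN := D.N_pos
  have hm := D.N_le_m
  have h1 : ∑ i ∈ Finset.Ico 0 D.N, ((P - (0 : ℤ → ℤ) i) * (cnt D.l i D.m + 1) +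
      cnt D.l i (cur i)) = P * (D.m + D.N) + D.m := by
    rw [Finset.sum_add_distrib]
    congr 1
    · simp only [Pi.zero_apply, sub_zero]
      rw [← Finset.mul_sum, Finset.sum_add_distrib, D.sum_cnt]
      simp
      exact Or.inl (by omega)
    · rw [← D.sum_cnt]
      refine Finset.sum_congr rfl fun i hi => ?_
      simp only [Finset.mem_Ico] at hi
      rw [hcur i hi.1 hi.2, (hadj.head i hi.1 hi.2).cnt_eq]
  unfold auctionPot
  rw [h1]
  simp only [Pi.zero_apply, sub_zero, Finset.sum_const, Int.card_Ico, nsmul_eq_mul]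
  rw [Int.toNat_of_nonneg (by omega)]
  nlinarith

variable {ξ : ℤ → ℝ} {s : Store} {t : ℤ}

/-- One step of the auction, in the iteration `k` of the outer loop.  The set `S` of matched vertices
consists of the vertices up to `k` whose level is below the cap, except for the current vertex; the
vertices above `k` have not taken part yet. -/
lemma wp_auctionStep {k : ℤ} (hD : D.Holds s) (hadj : D.Adjacency (s.arr 7) (s.arr 8))
    (hf : D.Feasible (s.arr 5) (s.arr 6)) (hP : s.reg 7 = P)
    (hA : D.AuctionInv (s.arr 5) (s.arr 6) P (s.arr 10) (s.arr 11) (s.arr 12) (s.arr 13) S)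
    (hfresh : ∀ i, k < i → i < D.N → s.arr 10 i = 0) (hkN : k < D.N)
    (h9 : s.reg 9 = 1) (h8 : 0 ≤ s.reg 8) (h8k : s.reg 8 ≤ k) (hlev : s.arr 10 (s.reg 8) < P)
    (hS : ∀ i, 0 ≤ i → i < D.N → (S i ↔ s.arr 10 i < P ∧ i ≤ k ∧ i ≠ s.reg 8)) :
    wp ξ auctionStep (fun s' t' => ∃ S' : ℤ → Prop,
      D.AuctionInv (s.arr 5) (s.arr 6) P (s'.arr 10) (s'.arr 11) (s'.arr 12) (s'.arr 13) S' ∧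
      (∀ i, k < i → i < D.N → s'.arr 10 i = 0) ∧
      t' + 100 * D.auctionPot P (s'.arr 10) (s'.arr 11) (s'.arr 12) + 10 ≤
        t + 100 * D.auctionPot P (s.arr 10) (s.arr 11) (s.arr 12) ∧
      (s'.reg 9 = 1 ∧ 0 ≤ s'.reg 8 ∧ s'.reg 8 ≤ k ∧ s'.arr 10 (s'.reg 8) < P ∧
          (∀ i, 0 ≤ i → i < D.N → (S' i ↔ s'.arr 10 i < P ∧ i ≤ k ∧ i ≠ s'.reg 8)) ∨
        s'.reg 9 = 0 ∧ (∀ i, 0 ≤ i → i < D.N → (S' i ↔ s'.arr 10 i < P ∧ i ≤ k)))) s t := by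
  have hnS : ¬ S (s.reg 8) := fun h => ((hS _ h8 (by omega)).1 h).2.2 rfl
  have h8N : s.reg 8 < D.N := by omega
  have hc0 := hA.cur_nonneg _ h8 h8N
  have hcm := hA.cur_le _ h8 h8N
  have hcl := hA.cur_left _ h8 h8N
  generalize hi : s.reg 8 = i at *
  generalize hu : s.arr 5 = u at *
  generalize hv : s.arr 6 = v at *
  generalize hhd : s.arr 7 = head at *
  generalize hnx : s.arr 8 = next at *
  generalize hlv : s.arr 10 = lev at *
  generalize hcu : s.arr 11 = cur at *
  generalize hpr : s.arr 12 = price at *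
  generalize hmr : s.arr 13 = mr at *
  simp [auctionStep, hi, hcu, hlv, hpr, hmr, hD.arr0, hD.arr1, hD.arr2, hu, hv, hhd, hnx, hP]
  have take : 0 < cur i → D.c (cur i - 1) - u i - v (D.r (cur i - 1)) < 1 →
      D.Tight u v (cur i - 1) := by
    intro h1 h2
    refine ⟨by omega, by omega, ?_⟩
    have := hf (cur i - 1) (by omega) (by omega)
    rw [hcl h1] at this ⊢
    omega
  refine ⟨fun hc => ⟨fun ht => ⟨fun hp => ?_, fun hp => ?_⟩, fun ht => ?_⟩,
    fun hc => ⟨fun hp => ?_, fun hp => ?_⟩⟩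
  · -- the vertex takes over the right end of the edge
    have htt := take hc ht
    have hA' := hA.take h8 h8N hnS hlev hc htt hp
    have hr0 := D.r_nonneg _ htt.nonneg htt.lt
    have hrN := D.r_lt _ htt.nonneg htt.lt
    have hpot := auctionPot_take (cur := cur) (P := P) hr0 hrN hp
    refine ⟨fun hm => ⟨_, hA', hfresh, by omega, Or.inl ?_⟩,
      fun hm => ⟨_, hA', hfresh, by omega, ?_⟩⟩
    · have hb := hA.matching.left_bounds hr0 hrN hm
      have hcov := (hS _ hb.1 hb.2).1 (hA.matching.covers hr0 hrN hm)
      refine ⟨h9, hb.1, hcov.2.1, hcov.1, ?_⟩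
      intro i' h1 h2
      rw [hS i' h1 h2]
      constructor
      · rintro (rfl | ⟨⟨h3, h4, h5⟩, h6⟩)
        · exact ⟨hlev, h8k, fun h => hcov.2.2 h.symm⟩
        · exact ⟨h3, h4, fun h => h6 ⟨hm, h⟩⟩
      · rintro ⟨h3, h4, h5⟩
        by_cases h6 : i' = i
        · exact Or.inl h6
        · exact Or.inr ⟨⟨h3, h4, h6⟩, fun h => h5 h.2⟩
    · intro i' h1 h2
      rw [hS i' h1 h2]
      constructor
      · rintro (rfl | ⟨⟨h3, h4, h5⟩, h6⟩)
        · exact ⟨hlev, h8k⟩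
        · exact ⟨h3, h4⟩
      · rintro ⟨h3, h4⟩
        by_cases h6 : i' = i
        · exact Or.inl h6
        · exact Or.inr ⟨⟨h3, h4, h6⟩, fun h => by omega⟩
  · -- the right end is too dear
    have hpot := auctionPot_pass (lev := lev) (price := price) (P := P) hadj h8 h8N hc hcm (hcl hc)
    exact ⟨S, hA.pass hadj h8 h8N hc (fun _ => hp), hfresh, by omega,
      Or.inl ⟨h9, h8, h8k, hlev, hS⟩⟩
  · -- the edge is not tight
    have hpot := auctionPot_pass (lev := lev) (price := price) (P := P) hadj h8 h8N hc hcm (hcl hc)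
    refine ⟨S, hA.pass hadj h8 h8N hc (fun h => ?_), hfresh, by omega,
      Or.inl ⟨h9, h8, h8k, hlev, hS⟩⟩
    have := h.eq
    rw [hcl hc] at this
    omega
  -- in the remaining cases the list is exhausted, and the level rises: to less than the cap, or to
  -- the cap, where the vertex stays free
  all_goals
    have hpot := auctionPot_rise (lev := lev) (price := price) (P := P) hadj h8 h8N
      (show cur i = 0 by omega)
    refine ⟨S, hA.rise hadj h8 h8N hnS hlev (by omega), ?_, by omega, ?_⟩
    · intro i' h1 h2
      rw [Function.update_of_ne (by omega)]
      exact hfresh i' h1 h2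
  · refine Or.inl ⟨h9, h8, h8k, hp, ?_⟩
    intro i' h1 h2
    rw [hS i' h1 h2]
    refine ⟨fun h => ?_, fun h => ?_⟩
    · rwa [Function.update_of_ne h.2.2]
    · rwa [Function.update_of_ne h.2.2] at h
  · intro i' h1 h2
    rw [hS i' h1 h2]
    refine ⟨fun h => ?_, fun h => ?_⟩
    · rw [Function.update_of_ne h.2.2]
      exact ⟨h.1, h.2.1⟩
    · rcases eq_or_ne i' i with rfl | hne
      · rw [Function.update_self] at h; omega
      · rw [Function.update_of_ne hne] at h
        exact ⟨h.1, h.2, hne⟩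

lemma wp_auction (hD : D.Holds s) (hadj : D.Adjacency (s.arr 7) (s.arr 8))
    (hf : D.Feasible (s.arr 5) (s.arr 6)) (hP : 1 ≤ s.reg 7) (h10 : s.arr 10 = 0)
    (h12 : s.arr 12 = 0) (h13 : s.arr 13 = 0) :
    wp ξ auction (fun s' t' => D.AuctionInv (s.arr 5) (s.arr 6) (s.reg 7) (s'.arr 10) (s'.arr 11)
      (s'.arr 12) (s'.arr 13) (fun i => s'.arr 10 i < s.reg 7) ∧
      t' ≤ t + 600 * (D.m * s.reg 7)) s t := by
  have hN := D.N_pos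
  have hm := D.N_le_m
  obtain ⟨P, hPe⟩ : ∃ P, P = s.reg 7 := ⟨_, rfl⟩
  rw [← hPe] at hP ⊢
  have hmP : D.m ≤ D.m * P := by nlinarith
  rw [auction, wp_seq]
  refine wp_for D.N 10 (fun k s' => ∀ i, 0 ≤ i → i < k → s'.arr 11 i = s.arr 7 i)
    (by omega) (by norm_num) (by intros; omega) ?_ rfl ?_ ?_
  · intro s' hs
    simp [hs.reg 0 rfl, hD.reg0]
  · intro k s' t' hk hkn hJ hik hs
    simp [hik, hs.arr 7 rfl]
    intro i hi hik
    rw [Function.update_apply]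
    split_ifs with h
    · rw [h]
    · exact hJ i hi (by omega)
  intro s₁ t₁ h₁ _ hs₁ ht₁
  have hD₁ := hD.same hs₁ rfl
  set B : ℤ := t₁ + 60 * D.N + 100 * D.auctionPot P 0 (s₁.arr 11) 0 + 20 with hB
  refine wp_for_clock D.N B (fun k s' t' =>
    D.AuctionInv (s.arr 5) (s.arr 6) P (s'.arr 10) (s'.arr 11)
      (s'.arr 12) (s'.arr 13) (fun i => s'.arr 10 i < P ∧ i < k) ∧
    (∀ i, k ≤ i → i < D.N → s'.arr 10 i = 0) ∧ 0 ≤ k ∧ k ≤ D.N ∧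
    t' + 100 * D.auctionPot P (s'.arr 10) (s'.arr 11) (s'.arr 12) + 60 * (D.N - k) + 10 ≤ B)
    (by omega) ?_ ?_ ?_ rfl ?_ ?_
  · rintro k s' t' ⟨hA, -, -, hk, ht⟩
    have := hA.pot_nonneg (by omega)
    omega
  · have e10 : s₁.arr 10 = 0 := by rw [hs₁.arr 10 rfl, h10]
    have e12 : s₁.arr 12 = 0 := by rw [hs₁.arr 12 rfl, h12]
    have e13 : s₁.arr 13 = 0 := by rw [hs₁.arr 13 rfl, h13]
    simp only [Store.arr_setReg, e10, e12, e13]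
    refine ⟨⟨⟨?_, ?_, ?_, ?_, ?_, ?_⟩, ?_, ?_, ?_, ?_, ?_, ?_, ?_, ?_, ?_, ?_⟩, ?_, le_rfl,
      by omega, by omega⟩ <;> try simp only [Pi.zero_apply]
    · intros; omega
    · intros; omega
    · intros; omega
    · intros; omega
    · intros; omega
    · intro i hi _
      constructor
      · rintro ⟨-, h⟩; omega
      · rintro ⟨_, _, _, h, _⟩; omega
    · intros; omega
    · intros; omega
    · intros; omega
    · intros; omega
    · intro i hi hiN
      rw [h₁ i hi hiN]
      exact (hadj.head i hi hiN).nonneg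
    · intro i hi hiN
      rw [h₁ i hi hiN]
      exact (hadj.head i hi hiN).le
    · intro i hi hiN
      rw [h₁ i hi hiN]
      exact (hadj.head i hi hiN).left
    · intro e he h2
      have hl0 := D.l_nonneg e he.nonneg he.lt
      have hl1 := D.l_lt e he.nonneg he.lt
      rw [h₁ _ hl0 hl1] at h2
      exact absurd rfl ((hadj.head _ hl0 hl1).ne e h2 he.lt)
    · intros; trivial
    · intros; contradiction
    · intros; trivial
  · intro s' hs
    simp [hs.reg 0 rfl, hD₁.reg0]
  · rintro k s' t' hk hkn ⟨hA, hfresh, -, -, ht⟩ hik hs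
    have hD' := hD₁.same hs rfl
    simp only [wp_seq, wp_set, Expr.eval_reg, Expr.eval_lit, hik]
    refine wp_loop (fun s' t' => ∃ S : ℤ → Prop,
      D.AuctionInv (s.arr 5) (s.arr 6) P (s'.arr 10) (s'.arr 11) (s'.arr 12) (s'.arr 13) S ∧
      (∀ i, k + 1 ≤ i → i < D.N → s'.arr 10 i = 0) ∧
      t' + 100 * D.auctionPot P (s'.arr 10) (s'.arr 11) (s'.arr 12) + 60 * (D.N - (k + 1)) + 30 ≤ B
      ∧ (s'.reg 9 = 1 ∧ 0 ≤ s'.reg 8 ∧ s'.reg 8 < k + 1 ∧ s'.arr 10 (s'.reg 8) < P ∧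
          (∀ i, 0 ≤ i → i < D.N → (S i ↔ s'.arr 10 i < P ∧ i < k + 1 ∧ i ≠ s'.reg 8)) ∨
        s'.reg 9 = 0 ∧ (∀ i, 0 ≤ i → i < D.N → (S i ↔ s'.arr 10 i < P ∧ i < k + 1))))
      B ?_ ?_ ?_ ?_
    · rintro s₂ t₂ ⟨S, hA, -, ht, -⟩
      have := hA.pot_nonneg (by omega)
      omega
    · simp
      refine ⟨_, hA, fun i h1 h2 => hfresh i (by omega) h2, by omega, hk,
        by rw [hfresh k le_rfl hkn]; omega, ?_⟩
      intro i h1 h2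
      omega
    · rintro s₂ t₂ ⟨S, hA, hfresh, ht, hcase⟩ hs₂ hlt
      simp only [Expr.eval_lit, Expr.eval_reg] at hlt
      obtain ⟨h9, h8, h8k, hlev, hS⟩ | ⟨h9, -⟩ := hcase
      swap
      · omega
      have hD₂ : D.Holds s₂ := Holds.same (p := auctionStep)
        (s := (s'.setReg 8 k).setReg 9 1)
        ⟨hD'.reg0, hD'.reg1, hD'.reg2, hD'.arr0, hD'.arr1, hD'.arr2⟩ hs₂ rfl
      have e5 : s₂.arr 5 = s.arr 5 :=
        (hs₂.arr 5 rfl).trans ((hs.arr 5 rfl).trans (hs₁.arr 5 rfl))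
      have e6 : s₂.arr 6 = s.arr 6 :=
        (hs₂.arr 6 rfl).trans ((hs.arr 6 rfl).trans (hs₁.arr 6 rfl))
      have e7 : s₂.arr 7 = s.arr 7 :=
        (hs₂.arr 7 rfl).trans ((hs.arr 7 rfl).trans (hs₁.arr 7 rfl))
      have e8 : s₂.arr 8 = s.arr 8 :=
        (hs₂.arr 8 rfl).trans ((hs.arr 8 rfl).trans (hs₁.arr 8 rfl))
      have er7 : s₂.reg 7 = P :=
        (hs₂.reg 7 rfl).trans ((hs.reg 7 rfl).trans ((hs₁.reg 7 rfl).trans hPe.symm))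
      refine (wp_auctionStep (k := k) hD₂ (by rwa [e7, e8]) (by rwa [e5, e6]) er7
        (by rwa [e5, e6]) hfresh hkn h9 h8 (by omega) hlev
        (fun i h1 h2 => by rw [hS i h1 h2]; omega)).mono ?_
      rintro s₃ t₃ ⟨S', hA', hfresh', ht', hcase'⟩
      rw [e5, e6] at hA'
      refine ⟨S', hA', hfresh', ?_, ?_⟩
      · simp at ht'
        linarith
      · simpa only [Int.lt_add_one_iff] using hcase'
    · rintro s₂ t₂ ⟨S, hA, hfresh, ht, hcase⟩ hs₂ hlt
      simp only [Expr.eval_lit, Expr.eval_reg] at hlt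
      obtain ⟨h9, -⟩ | ⟨h9, hS⟩ := hcase
      · omega
      simp
      exact ⟨hA.congr fun i h1 h2 => by rw [hS i h1 h2]; omega, hfresh, by omega, by omega, by omega⟩
  · rintro s₂ t₂ ⟨hA, -, -, -, ht⟩ hik hs₂
    have hp := hA.pot_nonneg (by omega)
    have := auctionPot_init (cur := s₁.arr 11) hadj hP h₁
    refine ⟨hA.congr fun i h1 h2 => by simp [h2], ?_⟩
    simp at ht₁ ⊢
    linarith

end EdgeList

/-! ### Shortest augmenting paths: the invariants -/

namespace EdgeList

variable (D : EdgeList)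

/-- The reduced cost of an edge. -/
def slack (u v : ℤ → ℤ) (e : ℤ) : ℤ := D.c e - u (D.l e) - v (D.r e)

variable {D} {u v u' v' mr : ℤ → ℤ} {S S' : ℤ → Prop}

lemma Feasible.slack_nonneg (h : D.Feasible u v) {e : ℤ} (he : 0 ≤ e) (hem : e < D.m) :
    0 ≤ D.slack u v e := by
  have := h e he hem
  unfold slack; omega

/-- The mate of a matched right vertex becomes free. -/
lemma Matching.erase (h : D.Matching u v mr S) {j : ℤ} (hj : 0 ≤ j) (hjN : j < D.N)
    (hmr : 0 < mr j) :
    D.Matching u v (Function.update mr j 0) (fun i => S i ∧ i ≠ D.l (mr j - 1)) := by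
  have hm : 0 ≤ D.m := by have := D.N_le_m; have := D.N_pos; omega
  refine ⟨?_, ?_, ?_, ?_, ?_, ?_⟩
  · intro j' h1 h2
    have := h.nonneg j' h1 h2
    rw [Function.update_apply]; split_ifs <;> omega
  · intro j' h1 h2
    have := h.le j' h1 h2
    rw [Function.update_apply]; split_ifs <;> omega
  · intro j' h1 h2
    rw [Function.update_apply]
    split_ifs with h3
    · intro h; omega
    · exact h.right j' h1 h2
  · intro j' h1 h2
    rw [Function.update_apply]
    split_ifs with h3
    · intro h; omega
    · exact h.tight j' h1 h2
  · intro j₁ j₂ h1 h2 h3 h4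
    rw [Function.update_apply, Function.update_apply]
    split_ifs with h5 h6 h6
    · intros; omega
    · intros; omega
    · intros; omega
    · exact h.inj j₁ j₂ h1 h2 h3 h4
  · intro i h1 h2
    constructor
    · rintro ⟨h3, h4⟩
      obtain ⟨j', h5, h6, h7, h8⟩ := (h.cover i h1 h2).1 h3
      have : j' ≠ j := by
        rintro rfl
        exact h4 h8.symm
      exact ⟨j', h5, h6, by rwa [Function.update_of_ne this], by rwa [Function.update_of_ne this]⟩
    · rintro ⟨j', h5, h6, h7, h8⟩
      rcases eq_or_ne j' j with rfl | hne
      · rw [Function.update_self] at h7; omega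
      · rw [Function.update_of_ne hne] at h7 h8
        refine ⟨(h.cover i h1 h2).2 ⟨j', h5, h6, h7, h8⟩, ?_⟩
        intro h9
        exact hne (h.inj j' j h5 h6 hj hjN h7 hmr (h8.trans h9))

variable (D)

/-- The invariant of the shortest path search from the free left vertex `i₀`.  A left vertex `i` is
reached if `0 < pr i`, and then `dl i` is its distance; a right vertex `j` is visited if
`0 < vis j`, and then `dr j` is its distance and `pe j` the last edge of a shortest path to it.
A reached vertex `i ≠ i₀` is matched to the visited vertex `fr i`.  The key of an edge is the length
of the shortest path that ends with it, or `top` if the edge is not in the queue.  All keys are at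
least `Δ`, and the vertices are visited in the order of their ranks `rk j < R`. -/
structure SearchInv (u v mr : ℤ → ℤ) (i₀ top : ℤ) (pr dl vis dr pe fr key : ℤ → ℤ) (Δ : ℤ)
    (rk : ℤ → ℤ) (R : ℤ) : Prop where
  root : 0 < pr i₀
  root_from : fr i₀ = -1
  mate : ∀ i, 0 ≤ i → i < D.N → 0 < pr i → i ≠ i₀ →
    0 ≤ fr i ∧ fr i < D.N ∧ 0 < vis (fr i) ∧ 0 < mr (fr i) ∧ D.l (mr (fr i) - 1) = i
  visited : ∀ j, 0 ≤ j → j < D.N → 0 < vis j → 0 < mr j ∧ 0 < pr (D.l (mr j - 1)) ∧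
    dl (D.l (mr j - 1)) = dr j ∧ dr j ≤ Δ
  pred : ∀ j, 0 ≤ j → j < D.N → 0 < vis j → 0 ≤ pe j ∧ pe j < D.m ∧ D.r (pe j) = j ∧
    0 < pr (D.l (pe j)) ∧ dr j = dl (D.l (pe j)) + D.slack u v (pe j)
  rank : ∀ j, 0 ≤ j → j < D.N → 0 < vis j → 0 ≤ rk j ∧ rk j < R ∧
    (D.l (pe j) ≠ i₀ → rk (fr (D.l (pe j))) < rk j)
  key_reached : ∀ e, 0 ≤ e → e < D.m → 0 < pr (D.l e) → key e = dl (D.l e) + D.slack u v e ∨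
    0 < vis (D.r e) ∧ dr (D.r e) ≤ dl (D.l e) + D.slack u v e ∧ key e = top
  key_unreached : ∀ e, 0 ≤ e → e < D.m → ¬ 0 < pr (D.l e) → key e = top
  key_ge : ∀ e, 0 ≤ e → e < D.m → Δ ≤ key e
  bound : ∀ e, 0 ≤ e → e < D.m → 0 < pr (D.l e) → dl (D.l e) + D.slack u v e ≤
    ∑ e ∈ Finset.Ico 0 D.m, if 0 < pr (D.l e) then D.slack u v e else 0
  rank_nonneg : 0 ≤ R

/-- The potential that pays for the search: an edge is inserted into the queue once and removed from
it once. -/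
noncomputable def searchPot (pr key : ℤ → ℤ) (top : ℤ) : ℤ :=
  ∑ e ∈ Finset.Ico 0 D.m, if 0 < pr (D.l e) then (if key e < top then 1 else 0) else 2

variable {D} {i₀ top Δ R : ℤ} {pr dl vis dr pe fr key rk : ℤ → ℤ}

lemma searchPot_nonneg : 0 ≤ D.searchPot pr key top :=
  Finset.sum_nonneg fun e _ => by split_ifs <;> norm_num

lemma searchPot_le : D.searchPot pr key top ≤ 2 * D.m := by
  have h : D.searchPot pr key top ≤ ∑ e ∈ Finset.Ico 0 D.m, 2 :=
    Finset.sum_le_sum fun e _ => by split_ifs <;> norm_num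
  have := D.N_le_m
  have := D.N_pos
  simp at h
  omega

/-- `top` exceeds the total slack of the edges at the reached vertices, and thereby the length of each
path of the search. -/
lemma SearchInv.reach_lt (hf : D.Feasible u v)
    (htop : top = 1 + ∑ e ∈ Finset.Ico 0 D.m, D.slack u v e) :
    (∑ e ∈ Finset.Ico 0 D.m, if 0 < pr (D.l e) then D.slack u v e else 0) < top := by
  rw [htop]
  have : (∑ e ∈ Finset.Ico 0 D.m, if 0 < pr (D.l e) then D.slack u v e else 0) ≤
      ∑ e ∈ Finset.Ico 0 D.m, D.slack u v e := by
    refine Finset.sum_le_sum fun e he => ?_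
    simp only [Finset.mem_Ico] at he
    have := hf.slack_nonneg he.1 he.2
    split_ifs <;> omega
  omega

/-- Some edge leads from a reached vertex to a vertex not yet visited: otherwise the perfect
matching would map the reached left vertices to the visited right vertices, which are fewer, since
they are matched to reached vertices other than the root. -/
lemma SearchInv.exists_frontier (h : D.SearchInv u v mr i₀ top pr dl vis dr pe fr key Δ rk R)
    (hM : D.Matching u v mr S) (hi₀ : 0 ≤ i₀) (hi₀N : i₀ < D.N) (hS : ¬ S i₀) :
    ∃ e, 0 ≤ e ∧ e < D.m ∧ 0 < pr (D.l e) ∧ ¬ 0 < vis (D.r e) := by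
  by_contra! hc
  have h1 : ((Finset.Ico 0 D.N).filter (fun i => 0 < pr i)).card ≤
      ((Finset.Ico 0 D.N).filter (fun j => 0 < vis j)).card := by
    refine Finset.card_le_card_of_injOn (fun i => D.r (D.pm i)) ?_ ?_
    · intro i hi
      simp only [Finset.coe_filter, Finset.mem_Ico, Set.mem_ofPred_eq] at hi ⊢
      obtain ⟨⟨h1, h2⟩, h3⟩ := hi
      have h4 := D.pm_nonneg i h1 h2
      have h5 := D.pm_lt i h1 h2
      exact ⟨⟨D.r_nonneg _ h4 h5, D.r_lt _ h4 h5⟩, hc _ h4 h5 (by rwa [D.l_pm i h1 h2])⟩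
    · intro i hi i' hi'
      simp only [Finset.coe_filter, Finset.mem_Ico, Set.mem_ofPred_eq] at hi hi'
      exact D.r_pm_inj i i' hi.1.1 hi.1.2 hi'.1.1 hi'.1.2
  have h2 : ((Finset.Ico 0 D.N).filter (fun j => 0 < vis j)).card ≤
      (((Finset.Ico 0 D.N).filter (fun i => 0 < pr i)).erase i₀).card := by
    refine Finset.card_le_card_of_injOn (fun j => D.l (mr j - 1)) ?_ ?_
    · intro j hj
      simp only [Finset.coe_filter, Finset.mem_Ico, Set.mem_ofPred_eq, Finset.mem_coe,
        Finset.mem_erase, Finset.mem_filter] at hj ⊢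
      obtain ⟨⟨h1, h2⟩, h3⟩ := hj
      obtain ⟨h4, h5, -⟩ := h.visited j h1 h2 h3
      have hb := hM.left_bounds h1 h2 h4
      exact ⟨fun h => hS (h ▸ hM.covers h1 h2 h4), hb, h5⟩
    · intro j hj j' hj'
      simp only [Finset.coe_filter, Finset.mem_Ico, Set.mem_ofPred_eq] at hj hj'
      exact hM.inj j j' hj.1.1 hj.1.2 hj'.1.1 hj'.1.2 (h.visited j hj.1.1 hj.1.2 hj.2).1
        (h.visited j' hj'.1.1 hj'.1.2 hj'.2).1
  have h3 : i₀ ∈ (Finset.Ico 0 D.N).filter (fun i => 0 < pr i) := by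
    simp [hi₀, hi₀N, h.root]
  have := Finset.card_erase_lt_of_mem h3
  omega

/-- An edge of least key is in the queue. -/
lemma SearchInv.min_lt (h : D.SearchInv u v mr i₀ top pr dl vis dr pe fr key Δ rk R)
    (hM : D.Matching u v mr S) (hi₀ : 0 ≤ i₀) (hi₀N : i₀ < D.N) (hS : ¬ S i₀)
    (hf : D.Feasible u v) (htop : top = 1 + ∑ e ∈ Finset.Ico 0 D.m, D.slack u v e) {e : ℤ}
    (he : 0 ≤ e) (hem : e < D.m) (hmin : ∀ e', 0 ≤ e' → e' < D.m → key e ≤ key e') :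
    key e < top ∧ 0 < pr (D.l e) ∧ key e = dl (D.l e) + D.slack u v e := by
  obtain ⟨f, h1, h2, h3, h4⟩ := h.exists_frontier hM hi₀ hi₀N hS
  have hlt : key e < top := by
    have h5 := hmin f h1 h2
    have h6 := SearchInv.reach_lt (pr := pr) hf htop
    have h7 := h.bound f h1 h2 h3
    rcases h.key_reached f h1 h2 h3 with h8 | ⟨h8, -⟩
    · omega
    · exact absurd h8 h4
  have hpr : 0 < pr (D.l e) := by
    by_contra hc
    have := h.key_unreached e he hem hc
    omega
  refine ⟨hlt, hpr, ?_⟩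
  rcases h.key_reached e he hem hpr with h8 | ⟨-, -, h8⟩
  · exact h8
  · omega

/-- An edge to a visited vertex may be removed from the queue. -/
lemma SearchInv.discard (h : D.SearchInv u v mr i₀ top pr dl vis dr pe fr key Δ rk R)
    {e : ℤ} (he : 0 ≤ e) (hem : e < D.m) (hvis : 0 < vis (D.r e)) (hlt : key e < top)
    (hkey : key e = dl (D.l e) + D.slack u v e) :
    D.SearchInv u v mr i₀ top pr dl vis dr pe fr (Function.update key e top) Δ rk R := by
  have hge := h.key_ge e he hem
  refine { h with key_reached := ?_, key_unreached := ?_, key_ge := ?_ }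
  · intro e' h1 h2 h3
    rcases eq_or_ne e' e with rfl | hne
    · right
      rw [Function.update_self]
      have := (h.visited _ (D.r_nonneg _ he hem) (D.r_lt _ he hem) hvis).2.2.2
      exact ⟨hvis, by omega, rfl⟩
    · rw [Function.update_of_ne hne]
      exact h.key_reached e' h1 h2 h3
  · intro e' h1 h2 h3
    have := h.key_unreached e' h1 h2 h3
    rw [Function.update_apply]; split_ifs <;> omega
  · intro e' h1 h2
    have := h.key_ge e' h1 h2
    rw [Function.update_apply]; split_ifs <;> omega

lemma searchPot_discard {e : ℤ} (he : 0 ≤ e) (hem : e < D.m) (hpr : 0 < pr (D.l e))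
    (hlt : key e < top) :
    D.searchPot pr (Function.update key e top) top + 1 = D.searchPot pr key top := by
  unfold searchPot
  rw [sum_Ico_update he hem
    (fun e => if 0 < pr (D.l e) then (if key e < top then (1 : ℤ) else 0) else 2)]
  · simp [hpr, hlt]
  · intro e' he'
    simp only [Function.update_of_ne he']

/-- The keys after the edge `e` has been removed from the queue and the edges at the left vertex `i`
have been inserted. -/
def newKeys (D : EdgeList) (u v key : ℤ → ℤ) (top Δ e i : ℤ) (e' : ℤ) : ℤ :=
  if D.l e' = i then Δ + D.slack u v e' else Function.update key e top e'

/-- The mate of the vertex that is about to be visited has not been reached. -/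
lemma SearchInv.mate_unreached (h : D.SearchInv u v mr i₀ top pr dl vis dr pe fr key Δ rk R)
    (hM : D.Matching u v mr S) (hS : ¬ S i₀) {j : ℤ} (hj : 0 ≤ j) (hjN : j < D.N)
    (hvis : ¬ 0 < vis j) (hmr : 0 < mr j) : ¬ 0 < pr (D.l (mr j - 1)) := by
  intro hpr
  have hb := hM.left_bounds hj hjN hmr
  have hne : D.l (mr j - 1) ≠ i₀ := fun hc => hS (hc ▸ hM.covers hj hjN hmr)
  obtain ⟨h1, h2, h3, h4, h5⟩ := h.mate _ hb.1 hb.2 hpr hne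
  exact hvis (hM.inj _ _ hj hjN h1 h2 hmr h4 h5.symm ▸ h3)

/-- A matched vertex of least distance is visited, and its mate is reached. -/
lemma SearchInv.visit (h : D.SearchInv u v mr i₀ top pr dl vis dr pe fr key Δ rk R)
    (hM : D.Matching u v mr S) (hS : ¬ S i₀) (hf : D.Feasible u v)
    (htop : top = 1 + ∑ e ∈ Finset.Ico 0 D.m, D.slack u v e)
    {e j i : ℤ} (he : 0 ≤ e) (hem : e < D.m) (hj : D.r e = j) (hi : D.l (mr j - 1) = i)
    (hvis : ¬ 0 < vis j) (hmr : 0 < mr j) (hpr : 0 < pr (D.l e))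
    (hkey : key e = dl (D.l e) + D.slack u v e)
    (hmin : ∀ e', 0 ≤ e' → e' < D.m → key e ≤ key e') :
    D.SearchInv u v mr i₀ top (Function.update pr i 1) (Function.update dl i (key e))
      (Function.update vis j 1) (Function.update dr j (key e)) (Function.update pe j e)
      (Function.update fr i j) (newKeys D u v key top (key e) e i) (key e)
      (Function.update rk j R) (R + 1) := by
  have hj0 : 0 ≤ j := hj ▸ D.r_nonneg e he hem
  have hjN : j < D.N := hj ▸ D.r_lt e he hem
  have hiX : ¬ 0 < pr i := hi ▸ h.mate_unreached hM hS hj0 hjN hvis hmr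
  have hii₀ : i ≠ i₀ := by rintro rfl; exact hiX h.root
  have hib := hM.left_bounds hj0 hjN hmr
  rw [hi] at hib
  have hne : ∀ {i'}, 0 < pr i' → i' ≠ i := by rintro i' h1 rfl; exact hiX h1
  have hne' : ∀ {j'}, 0 < vis j' → j' ≠ j := by rintro j' h1 rfl; exact hvis h1
  have hΔ : Δ ≤ key e := h.key_ge e he hem
  have hR := h.rank_nonneg
  have hreach : (∑ e ∈ Finset.Ico 0 D.m,
      if 0 < Function.update pr i 1 (D.l e) then D.slack u v e else 0) =
      (∑ e ∈ Finset.Ico 0 D.m, if 0 < pr (D.l e) then D.slack u v e else 0) +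
      ∑ e ∈ Finset.Ico 0 D.m, if D.l e = i then D.slack u v e else 0 := by
    rw [← Finset.sum_add_distrib]
    refine Finset.sum_congr rfl fun e _ => ?_
    by_cases h1 : D.l e = i
    · simp [h1, hiX]
    · simp [h1]
  -- the goals are the fields of the invariant, in their order
  refine ⟨?_, ?_, ?_, ?_, ?_, ?_, ?_, ?_, ?_, ?_, by omega⟩
  · rw [Function.update_of_ne hii₀.symm]; exact h.root
  · rw [Function.update_of_ne hii₀.symm]; exact h.root_from
  · intro i' h1 h2 h3 h4
    rcases eq_or_ne i' i with rfl | hi'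
    · simp only [Function.update_self]
      exact ⟨hj0, hjN, by norm_num, hmr, hi⟩
    · rw [Function.update_of_ne hi'] at h3 ⊢
      obtain ⟨h5, h6, h7, h8⟩ := h.mate i' h1 h2 h3 h4
      exact ⟨h5, h6, by rwa [Function.update_of_ne (hne' h7)], h8⟩
  · intro j' h1 h2 h3
    rcases eq_or_ne j' j with rfl | hj'
    · simp [hi, hmr]
    · rw [Function.update_of_ne hj'] at h3 ⊢
      obtain ⟨h5, h6, h7, h8⟩ := h.visited j' h1 h2 h3
      rw [Function.update_of_ne (hne h6), Function.update_of_ne (hne h6)]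
      exact ⟨h5, h6, h7, by omega⟩
  · intro j' h1 h2 h3
    rcases eq_or_ne j' j with rfl | hj'
    · simp only [Function.update_self]
      rw [Function.update_of_ne (hne hpr), Function.update_of_ne (hne hpr)]
      exact ⟨he, hem, hj, hpr, hkey⟩
    · rw [Function.update_of_ne hj'] at h3
      obtain ⟨h5, h6, h7, h8, h9⟩ := h.pred j' h1 h2 h3
      rw [Function.update_of_ne hj', Function.update_of_ne hj', Function.update_of_ne (hne h8),
        Function.update_of_ne (hne h8)]
      exact ⟨h5, h6, h7, h8, h9⟩
  · intro j' h1 h2 h3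
    rcases eq_or_ne j' j with rfl | hj'
    · simp only [Function.update_self]
      refine ⟨hR, by omega, fun h4 => ?_⟩
      obtain ⟨h5, h6, h7, h8⟩ := h.mate _ (D.l_nonneg e he hem) (D.l_lt e he hem) hpr h4
      rw [Function.update_of_ne (hne hpr), Function.update_of_ne (hne' h7)]
      exact (h.rank _ h5 h6 h7).2.1
    · rw [Function.update_of_ne hj'] at h3
      obtain ⟨h5, h6, h7⟩ := h.rank j' h1 h2 h3
      obtain ⟨h8, h9, -, h10, -⟩ := h.pred j' h1 h2 h3
      rw [Function.update_of_ne hj', Function.update_of_ne hj']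
      refine ⟨h5, by omega, fun h4 => ?_⟩
      obtain ⟨h11, h12, h13, h14⟩ := h.mate _ (D.l_nonneg _ h8 h9) (D.l_lt _ h8 h9) h10 h4
      rw [Function.update_of_ne (hne h10), Function.update_of_ne (hne' h13)]
      exact h7 h4
  · intro e' h1 h2 h3
    unfold newKeys
    by_cases h4 : D.l e' = i
    · left; simp [h4]
    · rw [Function.update_of_ne h4] at h3 ⊢
      rw [if_neg h4]
      rcases eq_or_ne e' e with rfl | he'
      · right
        rw [hj]
        simp [hkey]
      · rw [Function.update_of_ne he']
        rcases h.key_reached e' h1 h2 h3 with h5 | ⟨h5, h6, h7⟩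
        · exact Or.inl h5
        · right
          rw [Function.update_of_ne (hne' h5), Function.update_of_ne (hne' h5)]
          exact ⟨h5, h6, h7⟩
  · intro e' h1 h2 h3
    have h4 : D.l e' ≠ i := by
      intro h4; rw [h4, Function.update_self] at h3; omega
    rw [Function.update_of_ne h4] at h3
    unfold newKeys
    rw [if_neg h4]
    have := h.key_unreached e' h1 h2 h3
    rw [Function.update_apply]; split_ifs <;> omega
  · intro e' h1 h2
    have h3 := hf.slack_nonneg h1 h2
    have h4 := hmin e' h1 h2
    have h5 := h.bound e he hem hpr
    have h6 := SearchInv.reach_lt (pr := pr) hf htop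
    unfold newKeys
    rw [Function.update_apply]; split_ifs <;> omega
  · intro e' h1 h2 h3
    rw [hreach]
    have h7 : 0 ≤ ∑ e ∈ Finset.Ico 0 D.m, if D.l e = i then D.slack u v e else 0 := by
      refine Finset.sum_nonneg fun e he => ?_
      simp only [Finset.mem_Ico] at he
      have := hf.slack_nonneg he.1 he.2
      split_ifs <;> omega
    by_cases h4 : D.l e' = i
    · rw [h4, Function.update_self, hkey]
      have h5 := h.bound e he hem hpr
      have h6 : (if D.l e' = i then D.slack u v e' else 0) ≤
          ∑ e ∈ Finset.Ico 0 D.m, if D.l e = i then D.slack u v e else 0 := by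
        refine Finset.single_le_sum (f := fun e => if D.l e = i then D.slack u v e else 0) ?_
          (by simp [h1, h2])
        intro e he
        simp only [Finset.mem_Ico] at he
        have := hf.slack_nonneg he.1 he.2
        split_ifs <;> omega
      rw [if_pos h4] at h6
      omega
    · rw [Function.update_of_ne h4] at h3 ⊢
      have := h.bound e' h1 h2 h3
      omega

lemma searchPot_visit {Δ e i : ℤ} (he : 0 ≤ e) (hem : e < D.m)
    (hpr : 0 < pr (D.l e)) (hlt : key e < top) (hi : ¬ 0 < pr i) :
    D.searchPot (Function.update pr i 1) (newKeys D u v key top Δ e i) top + 1 +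
      cnt D.l i D.m ≤ D.searchPot pr key top := by
  rw [← searchPot_discard he hem hpr hlt, add_right_comm]
  refine add_le_add_left ?_ 1
  unfold searchPot cnt
  rw [Finset.card_filter]
  push_cast
  rw [← Finset.sum_add_distrib]
  refine Finset.sum_le_sum fun e' _ => ?_
  by_cases h1 : D.l e' = i
  · simp only [h1, hi, Function.update_self]
    split_ifs <;> norm_num at *
  · simp [h1, newKeys]

/-- The state of the search after the root has been reached. -/
lemma searchInv_init (hf : D.Feasible u v) (htop : top = 1 + ∑ e ∈ Finset.Ico 0 D.m, D.slack u v e)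
    (hpr : ∀ i, 0 ≤ i → i < D.N → pr i = if i = i₀ then 1 else 0) (hi₀ : 0 ≤ i₀) (hi₀N : i₀ < D.N)
    (hdl : dl i₀ = 0) (hvis : ∀ j, 0 ≤ j → j < D.N → vis j = 0) (hfr : fr i₀ = -1)
    (hkey : ∀ e, 0 ≤ e → e < D.m → key e = if D.l e = i₀ then D.slack u v e else top) :
    D.SearchInv u v mr i₀ top pr dl vis dr pe fr key 0 rk 0 := by
  have hpr' : ∀ e, 0 ≤ e → e < D.m → (0 < pr (D.l e) ↔ D.l e = i₀) := by
    intro e h1 h2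
    rw [hpr _ (D.l_nonneg e h1 h2) (D.l_lt e h1 h2)]
    split_ifs with h <;> simp [h]
  refine ⟨?_, hfr, ?_, ?_, ?_, ?_, ?_, ?_, ?_, ?_, le_rfl⟩
  · rw [hpr _ hi₀ hi₀N]; simp
  · intro i h1 h2 h3 h4
    rw [hpr _ h1 h2, if_neg h4] at h3
    omega
  · intro j h1 h2 h3; rw [hvis j h1 h2] at h3; omega
  · intro j h1 h2 h3; rw [hvis j h1 h2] at h3; omega
  · intro j h1 h2 h3; rw [hvis j h1 h2] at h3; omega
  · intro e h1 h2 h3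
    rw [hpr' e h1 h2] at h3
    left
    rw [hkey e h1 h2, if_pos h3, h3, hdl, zero_add]
  · intro e h1 h2 h3
    rw [hpr' e h1 h2] at h3
    rw [hkey e h1 h2, if_neg h3]
  · intro e h1 h2
    have h3 := hf.slack_nonneg h1 h2
    have h4 := SearchInv.reach_lt (pr := 0) hf htop
    simp at h4
    rw [hkey e h1 h2]
    split_ifs <;> omega
  · intro e h1 h2 h3
    refine le_trans ?_ (Finset.single_le_sum
      (f := fun e => if 0 < pr (D.l e) then D.slack u v e else 0) ?_
      (by simp [h1, h2] : e ∈ Finset.Ico 0 D.m))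
    · simp only [if_pos h3]
      rw [hpr' e h1 h2] at h3
      rw [h3, hdl, zero_add]
    · intro e he
      simp only [Finset.mem_Ico] at he
      have := hf.slack_nonneg he.1 he.2
      split_ifs <;> omega

/-- The left dual vector after the search: a vertex at distance `d` moves up by `Δ - d`. -/
def shiftLeft (pr dl : ℤ → ℤ) (Δ : ℤ) (u : ℤ → ℤ) (i : ℤ) : ℤ :=
  if 0 < pr i then u i + (Δ - dl i) else u i

/-- The right dual vector after the search: a vertex at distance `d` moves down by `Δ - d`. -/
def shiftRight (vis dr : ℤ → ℤ) (Δ : ℤ) (v : ℤ → ℤ) (j : ℤ) : ℤ :=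
  if 0 < vis j then v j - (Δ - dr j) else v j

/-- No key is below the length `K` of the shortest augmenting path, so the shift violates no edge. -/
lemma SearchInv.feasible_shift (h : D.SearchInv u v mr i₀ top pr dl vis dr pe fr key Δ rk R)
    (hf : D.Feasible u v) {K : ℤ} (hΔ : Δ ≤ K)
    (hmin : ∀ e, 0 ≤ e → e < D.m → K ≤ key e) :
    D.Feasible (shiftLeft pr dl K u)
      (shiftRight vis dr K v) := by
  intro e he hem
  have h1 := hf e he hem
  have h2 := hmin e he hem
  unfold shiftLeft shiftRight
  have hv : 0 < vis (D.r e) → dr (D.r e) ≤ Δ := fun hv =>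
    (h.visited _ (D.r_nonneg e he hem) (D.r_lt e he hem) hv).2.2.2
  by_cases hp : 0 < pr (D.l e)
  · have h3 := h.key_reached e he hem hp
    unfold slack at h3
    by_cases hvis : 0 < vis (D.r e)
    · have := hv hvis
      simp only [hp, hvis, if_true]
      rcases h3 with h3 | ⟨-, h3, -⟩
      · omega
      · omega
    · simp only [hp, hvis, if_true, if_false]
      rcases h3 with h3 | ⟨h3, -⟩
      · omega
      · exact absurd h3 hvis
  · simp only [hp, if_false]
    split_ifs with hvis
    · have := hv hvis
      omega
    · exact h1

lemma SearchInv.matching_shift (h : D.SearchInv u v mr i₀ top pr dl vis dr pe fr key Δ rk R)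
    (hM : D.Matching u v mr S) (hS : ¬ S i₀) {K : ℤ} :
    D.Matching (shiftLeft pr dl K u)
      (shiftRight vis dr K v) mr S := by
  refine { hM with tight := ?_ }
  intro j h1 h2 h3
  have ht := hM.tight j h1 h2 h3
  unfold shiftLeft shiftRight
  by_cases hv : 0 < vis j
  · obtain ⟨-, h5, h6, -⟩ := h.visited j h1 h2 hv
    simp only [hv, h5, if_true]
    omega
  · have := h.mate_unreached hM hS h1 h2 hv h3
    simp only [hv, this, if_false]
    exact ht

/-- Every edge of the search tree becomes tight. -/
lemma SearchInv.tight_shift (h : D.SearchInv u v mr i₀ top pr dl vis dr pe fr key Δ rk R)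
    {K j : ℤ} (hj : 0 ≤ j) (hjN : j < D.N) (hvis : 0 < vis j) :
    D.Tight (shiftLeft pr dl K u)
      (shiftRight vis dr K v) (pe j) := by
  obtain ⟨h1, h2, h3, h4, h5⟩ := h.pred j hj hjN hvis
  refine ⟨h1, h2, ?_⟩
  rw [h3]
  simp only [shiftLeft, shiftRight, h4, hvis, if_true]
  unfold slack at h5
  rw [h3] at h5
  omega

variable (D) in
/-- The tree of the search, as it is needed for the augmentation: each vertex `j` among the visited
ones and the end `j₁` of the augmenting path is entered by the tight edge `pe j`, whose left end is
the root `i₀` or is matched to a visited vertex of smaller rank. -/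
structure AugTree (u v mr pe fr vis rk : ℤ → ℤ) (i₀ j₁ : ℤ) : Prop where
  root_from : fr i₀ = -1
  pred : ∀ j, 0 ≤ j → j < D.N → 0 < vis j ∨ j = j₁ → D.Tight u v (pe j) ∧ D.r (pe j) = j ∧
    0 ≤ rk j ∧ rk j ≤ 2 * D.m
  mate : ∀ j, 0 ≤ j → j < D.N → 0 < vis j ∨ j = j₁ → D.l (pe j) ≠ i₀ →
    0 ≤ fr (D.l (pe j)) ∧ fr (D.l (pe j)) < D.N ∧ 0 < vis (fr (D.l (pe j))) ∧
    0 < mr (fr (D.l (pe j))) ∧ D.l (mr (fr (D.l (pe j))) - 1) = D.l (pe j) ∧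
    rk (fr (D.l (pe j))) < rk j

/-- The tree at the end of the search, when the edge `e` of least key leads to a free vertex. -/
lemma SearchInv.augTree (h : D.SearchInv u v mr i₀ top pr dl vis dr pe fr key Δ rk R)
    {e : ℤ} (he : 0 ≤ e) (hem : e < D.m) (hvis : ¬ 0 < vis (D.r e)) (hpr : 0 < pr (D.l e))
    (hkey : key e = dl (D.l e) + D.slack u v e) (hR : R ≤ 2 * D.m) :
    D.AugTree (shiftLeft pr dl (key e) u)
      (shiftRight vis dr (key e) v) mr
      (Function.update pe (D.r e) e) fr vis (Function.update rk (D.r e) R) i₀ (D.r e) := by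
  have hR0 := h.rank_nonneg
  have hne : ∀ {j}, 0 < vis j → j ≠ D.r e := by rintro j h1 rfl; exact hvis h1
  refine ⟨h.root_from, ?_, ?_⟩
  · intro j h1 h2 h3
    rcases eq_or_ne j (D.r e) with rfl | hj
    · simp only [Function.update_self]
      refine ⟨⟨he, hem, ?_⟩, trivial, by omega, by omega⟩
      simp only [shiftLeft, shiftRight, hpr, hvis, if_true, if_false]
      unfold slack at hkey
      omega
    · have hv : 0 < vis j := h3.resolve_right hj
      rw [Function.update_of_ne hj, Function.update_of_ne hj]
      obtain ⟨h4, h5, -⟩ := h.rank j h1 h2 hv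
      exact ⟨h.tight_shift h1 h2 hv, (h.pred j h1 h2 hv).2.2.1, h4, by omega⟩
  · intro j h1 h2 h3 h4
    rcases eq_or_ne j (D.r e) with rfl | hj
    · simp only [Function.update_self] at h4 ⊢
      obtain ⟨h5, h6, h7, h8, h9⟩ := h.mate _ (D.l_nonneg e he hem) (D.l_lt e he hem) hpr h4
      rw [Function.update_of_ne (hne h7)]
      exact ⟨h5, h6, h7, h8, h9, (h.rank _ h5 h6 h7).2.1⟩
    · have hv : 0 < vis j := h3.resolve_right hj
      rw [Function.update_of_ne hj] at h4 ⊢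
      obtain ⟨h5, h6, -, h7, -⟩ := h.pred j h1 h2 hv
      obtain ⟨h8, h9, h10, h11, h12⟩ := h.mate _ (D.l_nonneg _ h5 h6) (D.l_lt _ h5 h6) h7 h4
      rw [Function.update_of_ne hj, Function.update_of_ne (hne h10)]
      exact ⟨h8, h9, h10, h11, h12, (h.rank j h1 h2 hv).2.2 h4⟩

end EdgeList

/-! ### Shortest augmenting paths: the program -/

/-- Inserts the edges at the left vertex in register `9`, whose distance is in register `10`, into
the queue. -/
def relax : Prog :=
  .set 16 (.get 7 (.reg 9)) ;;
  .loop (.lit 0) (.reg 16) (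
    .set 15 (.reg 2 + .reg 16 - .lit 1) ;;
    .put 14 (.reg 15) (.reg 10 + .get 2 (.reg 16 - .lit 1) - .get 5 (.reg 9) -
      .get 6 (.get 1 (.reg 16 - .lit 1))) ;;
    climb ;;
    .set 16 (.get 8 (.reg 16 - .lit 1)))

/-- Visits the matched right vertex in register `14` and reaches its mate. -/
def visit : Prog :=
  .set 15 (.reg 12) ;; clearLeaf ;;
  .put 17 (.reg 14) (.lit 1) ;;
  .put 18 (.reg 14) (.reg 10) ;;
  .set 9 (.get 0 (.get 13 (.reg 14) - .lit 1)) ;;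
  .put 15 (.reg 9) (.lit 1) ;;
  .put 16 (.reg 9) (.reg 10) ;;
  .put 20 (.reg 9) (.reg 14) ;;
  relax

/-- Takes an edge of least key from the queue.  If it leads to a free vertex, register `11` is
cleared. -/
def searchStep : Prog :=
  findLeaf ;;
  .set 13 (.reg 12 - .reg 2) ;;
  .set 14 (.get 1 (.reg 13)) ;;
  .branch (.lit 0) (.get 17 (.reg 14))
    (.set 15 (.reg 12) ;; clearLeaf)
    (.set 10 (.get 14 (.lit 1)) ;;
      .put 19 (.reg 14) (.reg 13) ;;
      .branch (.lit 0) (.get 13 (.reg 14)) visit (.set 11 (.lit 0)))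

/-- Prepares the search from the left vertex in register `5`.  Register `8` receives a number above
the lengths of all paths. -/
def initSearch : Prog :=
  .set 8 (.lit 1) ;;
  forLoop 6 (.reg 2) (.set 8 (.reg 8 + (.get 2 (.reg 6) - .get 5 (.get 0 (.reg 6)) -
    .get 6 (.get 1 (.reg 6))))) ;;
  forLoop 6 (.reg 2 + .reg 2) (.put 14 (.reg 6) (.reg 8)) ;;
  forLoop 6 (.reg 0) (.put 15 (.reg 6) (.lit 0) ;; .put 17 (.reg 6) (.lit 0)) ;;
  .set 9 (.reg 5) ;;
  .set 10 (.lit 0) ;;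
  .put 15 (.reg 9) (.lit 1) ;;
  .put 16 (.reg 9) (.lit 0) ;;
  .put 20 (.reg 9) (.lit (-1)) ;;
  relax ;;
  .set 11 (.lit 1)

/-- Searches a shortest augmenting path from the left vertex in register `5`.  The other end of the
path is left in register `14`, and its length in register `10`. -/
def search : Prog := initSearch ;; .loop (.lit 0) (.reg 11) searchStep

/-- Shifts the dual vector after the search. -/
def shiftDuals : Prog :=
  forLoop 6 (.reg 0)
    (.branch (.lit 0) (.get 15 (.reg 6))
      (.put 5 (.reg 6) (.get 5 (.reg 6) + (.reg 10 - .get 16 (.reg 6)))) .skip) ;;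
  forLoop 6 (.reg 1)
    (.branch (.lit 0) (.get 17 (.reg 6))
      (.put 6 (.reg 6) (.get 6 (.reg 6) - (.reg 10 - .get 18 (.reg 6)))) .skip)

/-- Augments the matching along the path that ends in the right vertex in register `14`. -/
def augment : Prog :=
  .set 11 (.lit 1) ;;
  .loop (.lit 0) (.reg 11) (
    .set 13 (.get 19 (.reg 14)) ;;
    .put 13 (.reg 14) (.reg 13 + .lit 1) ;;
    .set 14 (.get 20 (.get 0 (.reg 13))) ;;
    .branch (.reg 14) (.lit 0) (.set 11 (.lit 0)) .skip)

namespace EdgeList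

variable {D : EdgeList} {ξ : ℤ → ℝ} {s : Store} {t : ℤ}

lemma lg_two_mul_pos (D : EdgeList) : 1 ≤ lg (2 * D.m) := by
  have hN := D.N_pos
  have hm := D.N_le_m
  have := lg_mono (show 2 ≤ 2 * D.m by omega)
  have h2 : lg 2 = 1 := by
    have := lg_double (k := 1) le_rfl
    rw [lg_one] at this
    simpa using this
  omega

lemma Holds.congr {s' : Store} (h : D.Holds s) (h0 : s'.reg 0 = s.reg 0) (h1 : s'.reg 1 = s.reg 1)
    (h2 : s'.reg 2 = s.reg 2) (a0 : s'.arr 0 = s.arr 0) (a1 : s'.arr 1 = s.arr 1)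
    (a2 : s'.arr 2 = s.arr 2) : D.Holds s' :=
  ⟨h0.trans h.reg0, h1.trans h.reg1, h2.trans h.reg2, a0.trans h.arr0, a1.trans h.arr1,
    a2.trans h.arr2⟩

/-- The loop of the relaxation writes leaves and repairs the tree, so it is a tournament all the
time. -/
lemma wp_relax (hD : D.Holds s) (hadj : D.Adjacency (s.arr 7) (s.arr 8))
    (hh : IsHalfTable D.m (s.arr 9)) (ht : IsTournament D.m (s.arr 14))
    (h9 : 0 ≤ s.reg 9) (h9N : s.reg 9 < D.N) :
    wp ξ relax (fun s' t' => IsTournament D.m (s'.arr 14) ∧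
      (∀ e, 0 ≤ e → e < D.m → s'.arr 14 (D.m + e) = if D.l e = s.reg 9 then
        s.reg 10 + D.slack (s.arr 5) (s.arr 6) e else s.arr 14 (D.m + e)) ∧
      t' ≤ t + cnt D.l (s.reg 9) D.m * (40 * lg (2 * D.m) + 50) + 6) s t := by
  have hN := D.N_pos
  have hm := D.N_le_m
  have hlg := lg_nonneg (2 * D.m)
  obtain ⟨κ, hκ⟩ : ∃ κ, κ = 40 * lg (2 * D.m) + 50 := ⟨_, rfl⟩
  have hlast := hadj.head _ h9 h9N
  rw [relax, wp_seq, wp_set, ← hκ]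
  refine wp_loop (fun s' t' => 0 ≤ s'.reg 16 ∧ s'.reg 16 ≤ D.m ∧
    (0 < s'.reg 16 → D.l (s'.reg 16 - 1) = s.reg 9) ∧ IsTournament D.m (s'.arr 14) ∧
    (∀ e, 0 ≤ e → e < D.m → s'.arr 14 (D.m + e) = if D.l e = s.reg 9 ∧ s'.reg 16 ≤ e then
        s.reg 10 + D.slack (s.arr 5) (s.arr 6) e else s.arr 14 (D.m + e)) ∧
    t' + cnt D.l (s.reg 9) (s'.reg 16) * κ ≤ t + 3 + cnt D.l (s.reg 9) D.m * κ)
    (t + 3 + cnt D.l (s.reg 9) D.m * κ) ?_ ?_ ?_ ?_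
  · rintro s' t' ⟨-, -, -, -, -, h⟩
    have := mul_nonneg (cnt_nonneg D.l (s.reg 9) (s'.reg 16)) (show 0 ≤ κ by omega)
    omega
  · simp only [Expr.eval_get, Expr.eval_reg, Store.reg_setReg, if_true, Store.arr_setReg]
    refine ⟨hlast.nonneg, hlast.le, hlast.left, ht, ?_, ?_⟩
    · intro e h1 h2
      rw [if_neg]
      rintro ⟨h3, h4⟩
      exact hlast.ne e h4 h2 h3
    · rw [hlast.cnt_eq]; simp
  · rintro s' t' ⟨h0, hle, hl, htree, hkey, ht'⟩ hs hlt
    simp only [Expr.eval_lit, Expr.eval_reg] at hlt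
    have e2 : s'.reg 2 = D.m := (hs.reg 2 rfl).trans hD.reg2
    have e9 : s'.reg 9 = s.reg 9 := hs.reg 9 rfl
    have e10 : s'.reg 10 = s.reg 10 := hs.reg 10 rfl
    have a1 : s'.arr 1 = D.r := (hs.arr 1 rfl).trans hD.arr1
    have a2 : s'.arr 2 = D.c := (hs.arr 2 rfl).trans hD.arr2
    have a5 : s'.arr 5 = s.arr 5 := hs.arr 5 rfl
    have a6 : s'.arr 6 = s.arr 6 := hs.arr 6 rfl
    have a8 : s'.arr 8 = s.arr 8 := hs.arr 8 rfl
    have a9 : s'.arr 9 = s.arr 9 := hs.arr 9 rfl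
    obtain ⟨e, he⟩ : ∃ e, s'.reg 16 = e + 1 := ⟨s'.reg 16 - 1, by omega⟩
    have hle' := hl hlt
    rw [he, add_sub_cancel_right] at hle'
    have hcnt : cnt D.l (s.reg 9) (e + 1) = cnt D.l (s.reg 9) e + 1 := by
      have := cnt_pred (l := D.l) (h := e + 1) (by omega)
      rw [add_sub_cancel_right, hle'] at this
      exact this
    have hnext := hadj.next e (by omega) (by omega)
    rw [hle'] at hnext
    simp only [wp_seq, wp_set, wp_put]
    simp [e2, e9, e10, a1, a2, a5, a6, he]
    refine (wp_climb (m := D.m) ?_ ?_ ?_ ?_).frame.mono ?_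
    · simpa [a9] using hh
    · simp; omega
    · simp; omega
    · simp
      intro k hk hkm h1 h2
      unfold NodeOK
      rw [Function.update_of_ne (by omega), Function.update_of_ne (by omega),
        Function.update_of_ne (by omega)]
      exact htree k hk hkm
    · rintro s₂ t₂ ⟨⟨htree₂, hleaf, ht₂⟩, hs₂⟩
      have e16 : s₂.reg 16 = e + 1 := by rw [hs₂.reg 16 rfl]; simp [he]
      have a8' : s₂.arr 8 = s.arr 8 := by rw [hs₂.arr 8 rfl]; simp [a8]
      simp [e16, a8']
      refine ⟨hnext.nonneg, by linarith [hnext.le], hnext.left, htree₂, ?_, ?_⟩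
      · intro f hf hfm
        rw [hleaf _ (by omega)]
        simp
        rcases eq_or_ne f e with rfl | hne
        · rw [show D.m + (f + 1) - 1 = D.m + f by ring, Function.update_self,
            if_pos ⟨hle', hnext.le⟩]
          unfold slack
          rw [hle']; ring
        · rw [Function.update_of_ne (by omega), hkey f hf hfm]
          congr 1
          rw [he]
          refine propext (and_congr_right fun h3 => ⟨fun h4 => by linarith [hnext.le], fun h4 => ?_⟩)
          by_contra h5
          exact hnext.ne f h4 (by omega) h3
      · rw [he, hcnt] at ht'
        rw [← hnext.cnt_eq]
        linarith
  · rintro s' t' ⟨h0, hle, hl, htree, hkey, ht'⟩ hs hlt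
    simp only [Expr.eval_lit, Expr.eval_reg] at hlt
    have h16 : s'.reg 16 = 0 := by omega
    rw [h16, cnt_zero] at ht'
    refine ⟨htree, ?_, by simp; omega⟩
    intro e h1 h2
    rw [hkey e h1 h2, h16]
    simp [h1]

lemma wp_clearLeaf {m : ℤ} (hh : IsHalfTable m (s.arr 9)) (ht : IsTournament m (s.arr 14))
    (h1 : m ≤ s.reg 15) (h2 : s.reg 15 < 2 * m) :
    wp ξ clearLeaf (fun s' t' => IsTournament m (s'.arr 14) ∧
      (∀ k, m ≤ k → s'.arr 14 k = Function.update (s.arr 14) (s.reg 15) (s.reg 8) k) ∧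
      t' ≤ t + 40 * lg (2 * m) + 6) s t := by
  rw [clearLeaf, wp_seq, wp_put]
  refine (wp_climb (m := m) ?_ ?_ ?_ ?_).mono ?_
  · simpa using hh
  · simp; omega
  · simp; omega
  · simp
    intro k hk hkm h1 h2
    unfold NodeOK
    rw [Function.update_of_ne (by omega), Function.update_of_ne (by omega),
      Function.update_of_ne (by omega)]
    exact ht k hk hkm
  · rintro s₂ t₂ ⟨htree₂, hleaf, ht₂⟩
    refine ⟨htree₂, fun k hk => ?_, ?_⟩
    · rw [hleaf k hk]; simp
    · simp at ht₂; omega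

end EdgeList

namespace EdgeList

variable {D : EdgeList} {ξ : ℤ → ℝ} {s : Store} {t : ℤ}
  {u v u' v' mr : ℤ → ℤ} {S S' : ℤ → Prop}
  {i₀ top Δ R : ℤ} {pr dl vis dr pe fr key rk : ℤ → ℤ}

lemma SearchInv.congr_key (h : D.SearchInv u v mr i₀ top pr dl vis dr pe fr key Δ rk R)
    {key' : ℤ → ℤ} (hk : ∀ e, 0 ≤ e → e < D.m → key' e = key e) :
    D.SearchInv u v mr i₀ top pr dl vis dr pe fr key' Δ rk R :=
  { h with
    key_reached := fun e h1 h2 h3 => by rw [hk e h1 h2]; exact h.key_reached e h1 h2 h3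
    key_unreached := fun e h1 h2 h3 => by rw [hk e h1 h2]; exact h.key_unreached e h1 h2 h3
    key_ge := fun e h1 h2 => by rw [hk e h1 h2]; exact h.key_ge e h1 h2 }

lemma searchPot_congr {key' : ℤ → ℤ} (hk : ∀ e, 0 ≤ e → e < D.m → key' e = key e) :
    D.searchPot pr key' top = D.searchPot pr key top := by
  refine Finset.sum_congr rfl fun e he => ?_
  simp only [Finset.mem_Ico] at he
  rw [hk e he.1 he.2]

variable (D) in
/-- The state of the program during the search.  Array `14` is the tournament tree, whose leaf
`m + e` holds the key of the edge `e`; the arrays `15, 16` hold the marks and the distances of the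
left vertices, `17, 18, 19` the marks, the distances and the last edges of the right vertices, and
`20` the visited vertices to which the reached left vertices are matched.  The ranks are not
stored. -/
structure SearchState (u v mr : ℤ → ℤ) (i₀ top : ℤ) (s : Store) (Δ : ℤ) (rk : ℤ → ℤ) (R : ℤ) :
    Prop where
  holds : D.Holds s
  adj : D.Adjacency (s.arr 7) (s.arr 8)
  half : IsHalfTable D.m (s.arr 9)
  tree : IsTournament D.m (s.arr 14)
  arr5 : s.arr 5 = u
  arr6 : s.arr 6 = v
  arr13 : s.arr 13 = mr
  reg8 : s.reg 8 = top
  inv : D.SearchInv u v mr i₀ top (s.arr 15) (s.arr 16) (s.arr 17) (s.arr 18) (s.arr 19)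
    (s.arr 20) (fun e => s.arr 14 (D.m + e)) Δ rk R
  rank_le : R + D.searchPot (s.arr 15) (fun e => s.arr 14 (D.m + e)) top ≤ 2 * D.m

variable (D) in
/-- The state of the program after the search: shifting the dual vector by the length of the path in
register `10` makes all edges of the search tree tight, and this tree contains an augmenting path to
the free vertex in register `14`. -/
structure SearchDone (u v mr : ℤ → ℤ) (S : ℤ → Prop) (i₀ : ℤ) (s : Store) : Prop where
  feasible : D.Feasible (shiftLeft (s.arr 15) (s.arr 16) (s.reg 10) u)
    (shiftRight (s.arr 17) (s.arr 18) (s.reg 10) v)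
  matching : D.Matching (shiftLeft (s.arr 15) (s.arr 16) (s.reg 10) u)
    (shiftRight (s.arr 17) (s.arr 18) (s.reg 10) v) mr S
  nonneg : 0 ≤ s.reg 14
  lt : s.reg 14 < D.N
  free : mr (s.reg 14) = 0
  tree : ∃ rk, D.AugTree (shiftLeft (s.arr 15) (s.arr 16) (s.reg 10) u)
    (shiftRight (s.arr 17) (s.arr 18) (s.reg 10) v) mr (s.arr 19) (s.arr 20) (s.arr 17) rk i₀
    (s.reg 14)

lemma wp_searchStep (hM : D.Matching u v mr S) (hf : D.Feasible u v) (hi₀ : 0 ≤ i₀)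
    (hi₀N : i₀ < D.N) (hS : ¬ S i₀) (htop : top = 1 + ∑ e ∈ Finset.Ico 0 D.m, D.slack u v e)
    (hs : D.SearchState u v mr i₀ top s Δ rk R) :
    wp ξ searchStep (fun s' t' =>
      ((∃ Δ rk R, D.SearchState u v mr i₀ top s' Δ rk R) ∧
        t' + 10 + D.searchPot (s'.arr 15) (fun e => s'.arr 14 (D.m + e)) top * (80 * lg (2 * D.m) + 200) ≤
        t + D.searchPot (s.arr 15) (fun e => s.arr 14 (D.m + e)) top * (80 * lg (2 * D.m) + 200) ∧
        s'.reg 11 = s.reg 11) ∨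
      s'.reg 11 = 0 ∧ D.SearchDone u v mr S i₀ s' ∧ t' ≤ t + (80 * lg (2 * D.m) + 200)) s t := by
  have hN := D.N_pos
  have hm := D.N_le_m
  have hlg := lg_nonneg (2 * D.m)
  rw [searchStep, wp_seq]
  refine (wp_findLeaf (by omega) hs.holds.reg2 hs.tree).frame.mono ?_
  rintro s₁ t₁ ⟨⟨h12, h12', hmin, ht₁⟩, hs₁⟩
  obtain ⟨e, he⟩ : ∃ e, s₁.reg 12 = D.m + e := ⟨s₁.reg 12 - D.m, by omega⟩
  rw [he] at hmin
  have he0 : 0 ≤ e := by omega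
  have hem : e < D.m := by omega
  have hmin' : ∀ e', 0 ≤ e' → e' < D.m → s.arr 14 (D.m + e) ≤ s.arr 14 (D.m + e') := by
    intro e' h1 h2
    rw [hmin]
    exact hs.tree.root_le (by omega) (by omega)
  obtain ⟨hlt, hpr, hkey⟩ := hs.inv.min_lt hM hi₀ hi₀N hS hf htop he0 hem hmin'
  have hD₁ := hs.holds.same hs₁ rfl
  have ha : s₁.arr = s.arr := funext fun a => hs₁.arr a rfl
  have e8 : s₁.reg 8 = top := (hs₁.reg 8 rfl).trans hs.reg8
  have e11 : s₁.reg 11 = s.reg 11 := hs₁.reg 11 rfl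
  have hr0 := D.r_nonneg e he0 hem
  have hrN := D.r_lt e he0 hem
  have hb : 40 * lg (2 * D.m) + 6 ≤ 1 * (80 * lg (2 * D.m) + 200) := by omega
  simp only [wp_seq, wp_set, wp_branch, wp_put]
  simp [hD₁.reg2, he, ha, hs.holds.arr1, hs.arr13]
  refine ⟨fun hvis => ?_, fun hvis => ⟨fun hmr => ?_, fun hmr => ?_⟩⟩
  · -- the right end has already been visited
    refine (wp_clearLeaf (m := D.m) ?_ ?_ ?_ ?_).frame.mono ?_
    · simpa [ha] using hs.half
    · simpa [ha] using hs.tree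
    · simp; omega
    · simp; omega
    rintro s₂ t₂ ⟨⟨htree, hleaf, ht₂⟩, hs₂⟩
    have hd := hs.inv.discard he0 hem hvis hlt hkey
    have hk : ∀ e', 0 ≤ e' → e' < D.m → s₂.arr 14 (D.m + e') =
        Function.update (fun e => s.arr 14 (D.m + e)) e top e' := by
      intro e' h1 h2
      rw [hleaf _ (by omega)]
      simp [e8, ha, Function.update_apply]
    have e15 : s₂.arr 15 = s.arr 15 := by rw [hs₂.arr 15 rfl]; simp [ha]
    have hp : D.searchPot (s₂.arr 15) (fun e => s₂.arr 14 (D.m + e)) top + 1 =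
        D.searchPot (s.arr 15) (fun e => s.arr 14 (D.m + e)) top := by
      rw [e15, searchPot_congr hk]
      exact searchPot_discard he0 hem hpr hlt
    left
    refine ⟨⟨Δ, rk, R, ⟨?_, ?_, ?_, htree, ?_, ?_, ?_, ?_, ?_, ?_⟩⟩, ?_, ?_⟩
    · refine hD₁.congr ?_ ?_ ?_ ?_ ?_ ?_ <;>
        first | rw [hs₂.reg _ rfl]; rfl | rw [hs₂.arr _ rfl]; rfl
    · rw [hs₂.arr 7 rfl, hs₂.arr 8 rfl]; simpa [ha] using hs.adj
    · rw [hs₂.arr 9 rfl]; simpa [ha] using hs.half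
    · rw [hs₂.arr 5 rfl]; simpa [ha] using hs.arr5
    · rw [hs₂.arr 6 rfl]; simpa [ha] using hs.arr6
    · rw [hs₂.arr 13 rfl]; simpa [ha] using hs.arr13
    · rw [hs₂.reg 8 rfl]; simpa using e8
    · have := hd.congr_key hk
      rw [hs₂.arr 15 rfl, hs₂.arr 16 rfl, hs₂.arr 17 rfl, hs₂.arr 18 rfl, hs₂.arr 19 rfl,
        hs₂.arr 20 rfl]
      simpa [ha] using this
    · have := hs.rank_le
      omega
    · rw [← hp]
      linarith
    · rw [hs₂.reg 11 rfl]; simpa using e11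
  · -- the right end is visited now
    obtain ⟨i, hi⟩ : ∃ i, D.l (mr (D.r e) - 1) = i := ⟨_, rfl⟩
    have hiX := hs.inv.mate_unreached hM hS hr0 hrN (by omega) hmr
    have hib := hM.left_bounds hr0 hrN hmr
    rw [hi] at hiX hib
    have hv := hs.inv.visit hM hS hf htop he0 hem rfl hi (by omega) hmr hpr hkey hmin'
    have hpv := searchPot_visit (u := u) (v := v) (key := fun e => s.arr 14 (D.m + e))
      (Δ := s.arr 14 (D.m + e)) he0 hem hpr hlt hiX
    simp only [visit, wp_seq, wp_set]
    refine (wp_clearLeaf (m := D.m) ?_ ?_ ?_ ?_).frame.mono ?_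
    · simpa [ha] using hs.half
    · simpa [ha] using hs.tree
    · simp; omega
    · simp; omega
    rintro s₂ t₂ ⟨⟨htree, hleaf, ht₂⟩, hs₂⟩
    have r14 : s₂.reg 14 = D.r e := by rw [hs₂.reg 14 rfl]; simp
    have r10 : s₂.reg 10 = s.arr 14 (D.m + e) := by rw [hs₂.reg 10 rfl]; simp [hmin]
    have b13 : s₂.arr 13 = mr := by rw [hs₂.arr 13 rfl]; simp [ha, hs.arr13]
    have b0 : s₂.arr 0 = D.l := by rw [hs₂.arr 0 rfl]; simp [ha, hs.holds.arr0]
    have b5 : s₂.arr 5 = u := by rw [hs₂.arr 5 rfl]; simp [ha, hs.arr5]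
    have b6 : s₂.arr 6 = v := by rw [hs₂.arr 6 rfl]; simp [ha, hs.arr6]
    have b7 : s₂.arr 7 = s.arr 7 := by rw [hs₂.arr 7 rfl]; simp [ha]
    have b8 : s₂.arr 8 = s.arr 8 := by rw [hs₂.arr 8 rfl]; simp [ha]
    have b9 : s₂.arr 9 = s.arr 9 := by rw [hs₂.arr 9 rfl]; simp [ha]
    simp only [wp_put]
    simp [r14, r10, b13, b0, hi]
    refine (wp_relax (D := D) ?_ ?_ ?_ ?_ ?_ ?_).frame.mono ?_
    · refine hD₁.congr ?_ ?_ ?_ ?_ ?_ ?_ <;> simp <;>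
        first | rw [hs₂.reg _ rfl]; rfl | rw [hs₂.arr _ rfl]; rfl
    · simpa [b7, b8] using hs.adj
    · simpa [b9] using hs.half
    · simpa using htree
    · simpa using hib.1
    · simpa using hib.2
    rintro s₃ t₃ ⟨⟨htree₃, hkey₃, ht₃⟩, hs₃⟩
    simp [r10, b5, b6] at hkey₃ ht₃
    have hk : ∀ e', 0 ≤ e' → e' < D.m → s₃.arr 14 (D.m + e') =
        newKeys D u v (fun e => s.arr 14 (D.m + e)) top (s.arr 14 (D.m + e)) e i e' := by
      intro e' h1 h2
      rw [hkey₃ e' h1 h2, hleaf _ (by omega)]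
      unfold newKeys
      congr 1
      simp [e8, ha, he, Function.update_apply]
    have c15 : s₃.arr 15 = Function.update (s.arr 15) i 1 := by
      rw [hs₃.arr 15 rfl]; simp; rw [hs₂.arr 15 rfl]; simp [ha]
    have hp : D.searchPot (s₃.arr 15) (fun e => s₃.arr 14 (D.m + e)) top + 1 + cnt D.l i D.m ≤
        D.searchPot (s.arr 15) (fun e => s.arr 14 (D.m + e)) top := by
      rw [c15, searchPot_congr hk]
      exact hpv
    left
    refine ⟨⟨s.arr 14 (D.m + e), Function.update rk (D.r e) R, R + 1,
      ⟨?_, ?_, ?_, htree₃, ?_, ?_, ?_, ?_, ?_, ?_⟩⟩, ?_, ?_⟩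
    · refine hD₁.congr ?_ ?_ ?_ ?_ ?_ ?_ <;>
        first
        | rw [hs₃.reg _ rfl]; simp; rw [hs₂.reg _ rfl]; rfl
        | rw [hs₃.arr _ rfl]; simp; rw [hs₂.arr _ rfl]; rfl
    · rw [hs₃.arr 7 rfl, hs₃.arr 8 rfl]; simpa [b7, b8] using hs.adj
    · rw [hs₃.arr 9 rfl]; simpa [b9] using hs.half
    · rw [hs₃.arr 5 rfl]; simpa using b5
    · rw [hs₃.arr 6 rfl]; simpa using b6
    · rw [hs₃.arr 13 rfl]; simpa using b13
    · rw [hs₃.reg 8 rfl]; simp; rw [hs₂.reg 8 rfl]; simpa using e8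
    · have := hv.congr_key hk
      rw [c15, hs₃.arr 16 rfl, hs₃.arr 17 rfl, hs₃.arr 18 rfl, hs₃.arr 19 rfl, hs₃.arr 20 rfl]
      simp
      rw [hs₂.arr 16 rfl, hs₂.arr 17 rfl, hs₂.arr 18 rfl, hs₂.arr 19 rfl, hs₂.arr 20 rfl]
      simpa [ha] using this
    · have := hs.rank_le
      have := cnt_nonneg D.l i D.m
      omega
    · have h1 := mul_le_mul_of_nonneg_right hp (show 0 ≤ 80 * lg (2 * D.m) + 200 by omega)
      have h2 := mul_le_mul_of_nonneg_left (show 40 * lg (2 * D.m) + 50 ≤ 80 * lg (2 * D.m) + 200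
        by omega) (cnt_nonneg D.l i D.m)
      simp at ht₂
      linarith
    · rw [hs₃.reg 11 rfl]; simp; rw [hs₂.reg 11 rfl]; simpa using e11
  · -- the right end is free
    right
    have hmr0 : mr (D.r e) = 0 := le_antisymm hmr (hM.nonneg _ hr0 hrN)
    have hge := hs.inv.key_ge e he0 hem
    refine ⟨⟨?_, ?_, ?_, ?_, ?_, Function.update rk (D.r e) R, ?_⟩, by omega⟩ <;> simp [ha]
    · rw [← hmin]
      exact hs.inv.feasible_shift hf hge hmin'
    · exact hs.inv.matching_shift hM hS
    · exact hr0
    · exact hrN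
    · exact hmr0
    · rw [← hmin]
      have hR : R ≤ 2 * D.m := by
        have := hs.rank_le
        have := searchPot_nonneg (D := D) (pr := s.arr 15) (key := fun e => s.arr 14 (D.m + e))
          (top := top)
        omega
      exact hs.inv.augTree he0 hem (by omega) hpr hkey hR

lemma wp_initSearch (hD : D.Holds s) (hadj : D.Adjacency (s.arr 7) (s.arr 8))
    (hh : IsHalfTable D.m (s.arr 9)) (hf : D.Feasible (s.arr 5) (s.arr 6))
    (hi₀ : 0 ≤ s.reg 5) (hi₀N : s.reg 5 < D.N) :
    wp ξ initSearch (fun s' t' => D.SearchState (s.arr 5) (s.arr 6) (s.arr 13) (s.reg 5)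
      (1 + ∑ e ∈ Finset.Ico 0 D.m, D.slack (s.arr 5) (s.arr 6) e) s' 0 0 0 ∧ s'.reg 11 = 1 ∧
      t' ≤ t + D.m * (40 * lg (2 * D.m) + 500)) s t := by
  have hN := D.N_pos
  have hm := D.N_le_m
  have hlg := lg_two_mul_pos D
  obtain ⟨top, htop⟩ : ∃ top, top = 1 + ∑ e ∈ Finset.Ico 0 D.m, D.slack (s.arr 5) (s.arr 6) e :=
    ⟨_, rfl⟩
  rw [← htop]
  simp only [initSearch, wp_seq, wp_set]
  refine wp_for D.m 15 (fun k s' => s'.reg 8 = 1 + ∑ e ∈ Finset.Ico 0 k,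
    D.slack (s.arr 5) (s.arr 6) e) (by omega) (by norm_num) (by simp) ?_ rfl ?_ ?_
  · intro s' hs
    simp [hs.reg 2 rfl, hD.reg2]
  · intro k s' t' hk hkn hJ hik hs
    have hsum : ∑ e ∈ Finset.Ico 0 (k + 1), D.slack (s.arr 5) (s.arr 6) e =
        ∑ e ∈ Finset.Ico 0 k, D.slack (s.arr 5) (s.arr 6) e + D.slack (s.arr 5) (s.arr 6) k := by
      rw [← Finset.insert_Ico_right_eq_Ico_add_one hk, Finset.sum_insert (by simp), add_comm]
    simp [hik, hs.arr 0 rfl, hs.arr 1 rfl, hs.arr 2 rfl, hs.arr 5 rfl, hs.arr 6 rfl, hD.arr0,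
      hD.arr1, hD.arr2]
    rw [hJ, hsum]
    unfold slack
    ring
  intro s₁ t₁ h₁ _ hs₁ ht₁
  rw [← htop] at h₁
  have hD₁ : D.Holds s₁ := by
    refine hD.congr ?_ ?_ ?_ ?_ ?_ ?_ <;>
      first | rw [hs₁.reg _ rfl]; rfl | rw [hs₁.arr _ rfl]; rfl
  refine wp_for (2 * D.m) 10 (fun k s' => ∀ e, 0 ≤ e → e < k → s'.arr 14 e = top)
    (by omega) (by norm_num) (by intros; omega) ?_ rfl ?_ ?_
  · intro s' hs
    simp [hs.reg 2 rfl, hD₁.reg2]; ring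
  · intro k s' t' hk hkn hJ hik hs
    simp [hik, hs.reg 8 rfl, h₁]
    intro e he hek
    rw [Function.update_apply]
    split_ifs with h
    · rfl
    · exact hJ e he (by omega)
  intro s₂ t₂ h₂ _ hs₂ ht₂
  have hD₂ := hD₁.same hs₂ rfl
  refine wp_for D.N 10 (fun k s' => ∀ i, 0 ≤ i → i < k → s'.arr 15 i = 0 ∧ s'.arr 17 i = 0)
    (by omega) (by norm_num) (by intros; omega) ?_ rfl ?_ ?_
  · intro s' hs
    simp [hs.reg 0 rfl, hD₂.reg0]
  · intro k s' t' hk hkn hJ hik hs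
    simp [hik]
    refine ⟨fun e he hek => ?_, by omega⟩
    rw [Function.update_apply, Function.update_apply]
    split_ifs with h
    · simp
    · exact hJ e he (by omega)
  intro s₃ t₃ h₃ _ hs₃ ht₃
  have hD₃ := hD₂.same hs₃ rfl
  have a (b : ℕ) (h : (b == 14) = false) (h' : (b == 15) = false) (h'' : (b == 17) = false) :
      s₃.arr b = s.arr b := by
    rw [hs₃.arr b (by simp [forLoop, Prog.writesArr, h', h'']),
      hs₂.arr b (by simp [forLoop, Prog.writesArr, h]), hs₁.arr b rfl]
    rfl
  have e5 : s₃.reg 5 = s.reg 5 := by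
    rw [hs₃.reg 5 rfl, hs₂.reg 5 rfl, hs₁.reg 5 rfl]; rfl
  have e8 : s₃.reg 8 = top := by rw [hs₃.reg 8 rfl, hs₂.reg 8 rfl, h₁]
  simp only [wp_put]
  have htree : ∀ k, 0 ≤ k → k < 2 * D.m → s₃.arr 14 k = top := by
    intro k h1 h2
    rw [hs₃.arr 14 rfl]
    exact h₂ k h1 h2
  refine (wp_relax (D := D) ?_ ?_ ?_ ?_ ?_ ?_).frame.mono ?_
  · exact hD₃.congr rfl rfl rfl rfl rfl rfl
  · simpa [a] using hadj
  · simpa [a] using hh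
  · simp
    intro k hk hkm
    unfold NodeOK
    rw [htree _ (by omega) (by omega), htree _ (by omega) (by omega),
      htree _ (by omega) (by omega), min_self]
  · simpa [e5] using hi₀
  · simpa [e5] using hi₀N
  rintro s₄ t₄ ⟨⟨htree₄, hkey, ht₄⟩, hs₄⟩
  simp [e5, a] at hkey ht₄
  simp
  have hcnt : cnt D.l (s.reg 5) D.m ≤ D.m := by
    rw [← D.sum_cnt]
    refine le_trans ?_ (Finset.single_le_sum (f := fun i => cnt D.l i D.m)
      (fun i _ => cnt_nonneg _ _ _) (by simp [hi₀, hi₀N] : s.reg 5 ∈ Finset.Ico 0 D.N))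
    rw [D.sum_cnt]
  refine ⟨⟨?_, ?_, ?_, htree₄, ?_, ?_, ?_, ?_, ?_, ?_⟩, ?_⟩
  · refine hD₃.congr ?_ ?_ ?_ ?_ ?_ ?_ <;> simp <;>
      first | rw [hs₄.reg _ rfl]; rfl | rw [hs₄.arr _ rfl]; rfl
  · simp; rw [hs₄.arr 7 rfl, hs₄.arr 8 rfl]; simpa [a] using hadj
  · simp; rw [hs₄.arr 9 rfl]; simpa [a] using hh
  · simp; rw [hs₄.arr 5 rfl]; simp [a]
  · simp; rw [hs₄.arr 6 rfl]; simp [a]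
  · simp; rw [hs₄.arr 13 rfl]; simp [a]
  · simp; rw [hs₄.reg 8 rfl]; simp [e8]
  · simp
    rw [hs₄.arr 15 rfl, hs₄.arr 16 rfl, hs₄.arr 17 rfl, hs₄.arr 18 rfl, hs₄.arr 19 rfl,
      hs₄.arr 20 rfl]
    simp [e5]
    refine searchInv_init hf htop ?_ hi₀ hi₀N ?_ ?_ ?_ ?_
    · intro i h1 h2
      rw [Function.update_apply, (h₃ i h1 h2).1]
    · simp
    · exact fun j h1 h2 => (h₃ j h1 h2).2
    · simp
    · intro e h1 h2
      rw [hkey e h1 h2, htree _ (by omega) (by omega)]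
  · simpa using searchPot_le
  · have := mul_le_mul_of_nonneg_right hcnt (show 0 ≤ 40 * lg (2 * D.m) + 50 by omega)
    simp at ht₁ ht₂ ht₃
    linarith

lemma wp_search (hD : D.Holds s) (hadj : D.Adjacency (s.arr 7) (s.arr 8))
    (hh : IsHalfTable D.m (s.arr 9)) (hf : D.Feasible (s.arr 5) (s.arr 6))
    (hM : D.Matching (s.arr 5) (s.arr 6) (s.arr 13) S)
    (hi₀ : 0 ≤ s.reg 5) (hi₀N : s.reg 5 < D.N) (hS : ¬ S (s.reg 5)) :
    wp ξ search (fun s' t' => D.SearchDone (s.arr 5) (s.arr 6) (s.arr 13) S (s.reg 5) s' ∧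
      t' ≤ t + D.m * (300 * lg (2 * D.m) + 1500)) s t := by
  have hN := D.N_pos
  have hm := D.N_le_m
  have hlg := lg_two_mul_pos D
  rw [search, wp_seq]
  refine (wp_initSearch hD hadj hh hf hi₀ hi₀N).mono ?_
  rintro s₁ t₁ ⟨hst, h11, ht₁⟩
  generalize hu : s.arr 5 = u at *
  generalize hv : s.arr 6 = v at *
  generalize hmr : s.arr 13 = mr at *
  generalize hr5 : s.reg 5 = i₀ at *
  generalize htop : 1 + ∑ e ∈ Finset.Ico 0 D.m, D.slack u v e = top at *
  obtain ⟨κ, hκ⟩ : ∃ κ, κ = 80 * lg (2 * D.m) + 200 := ⟨_, rfl⟩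
  have hmκ : κ ≤ D.m * κ := by nlinarith
  refine wp_loop (fun s' t' => s'.reg 11 = 1 ∧ (∃ Δ rk R, D.SearchState u v mr i₀ top s' Δ rk R) ∧
      t' + D.searchPot (s'.arr 15) (fun e => s'.arr 14 (D.m + e)) top * κ ≤
        t₁ + 2 * D.m * κ ∨
      s'.reg 11 = 0 ∧ D.SearchDone u v mr S i₀ s' ∧ t' ≤ t₁ + 2 * D.m * κ + κ + 10)
    (t₁ + 2 * D.m * κ + κ + 10) ?_ ?_ ?_ ?_
  · rintro s' t' (⟨-, -, h⟩ | ⟨-, -, h⟩)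
    · have := mul_nonneg (searchPot_nonneg (D := D) (pr := s'.arr 15)
        (key := fun e => s'.arr 14 (D.m + e)) (top := top)) (show 0 ≤ κ by omega)
      omega
    · exact h
  · have := mul_le_mul_of_nonneg_right (searchPot_le (D := D) (pr := s₁.arr 15)
      (key := fun e => s₁.arr 14 (D.m + e)) (top := top)) (show 0 ≤ κ by omega)
    exact Or.inl ⟨h11, ⟨0, 0, 0, hst⟩, by linarith⟩
  · rintro s' t' (⟨h11', ⟨Δ, rk, R, hst'⟩, ht'⟩ | ⟨h11', -⟩) hs' hlt
    swap
    · simp [h11'] at hlt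
    refine (wp_searchStep hM hf hi₀ hi₀N hS htop.symm hst').mono ?_
    rw [← hκ]
    have hp := mul_nonneg (searchPot_nonneg (D := D) (pr := s'.arr 15)
        (key := fun e => s'.arr 14 (D.m + e)) (top := top)) (show 0 ≤ κ by omega)
    rintro s₂ t₂ (⟨hst₂, ht₂, h11₂⟩ | ⟨h11₂, hdone, ht₂⟩)
    · left
      refine ⟨h11₂.trans h11', hst₂, ?_⟩
      simp at ht₂
      linarith
    · right
      refine ⟨h11₂, hdone, ?_⟩
      simp at ht₂
      omega
  · rintro s' t' (⟨h11', -⟩ | ⟨h11', hdone, ht'⟩) hs' hlt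
    · simp [h11'] at hlt
    · refine ⟨hdone, ?_⟩
      simp
      subst hκ
      nlinarith

lemma wp_shiftDuals (hD : D.Holds s) :
    wp ξ shiftDuals (fun s' t' =>
      (∀ i, 0 ≤ i → i < D.N → s'.arr 5 i = shiftLeft (s.arr 15) (s.arr 16) (s.reg 10) (s.arr 5) i) ∧
      (∀ j, 0 ≤ j → j < D.N → s'.arr 6 j = shiftRight (s.arr 17) (s.arr 18) (s.reg 10) (s.arr 6) j)
      ∧ t' ≤ t + 60 * D.N + 20) s t := by
  rw [shiftDuals, wp_seq]
  refine wp_for D.N 20 (fun k s' => (∀ i, 0 ≤ i → i < k → s'.arr 5 i =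
      shiftLeft (s.arr 15) (s.arr 16) (s.reg 10) (s.arr 5) i) ∧ ∀ i, k ≤ i → s'.arr 5 i = s.arr 5 i)
    (by linarith [D.N_pos]) (by norm_num) ⟨by intros; omega, fun _ _ => rfl⟩ ?_ rfl ?_ ?_
  · intro s' hs
    simp [hs.reg 0 rfl, hD.reg0]
  · intro k s' t' hk hkn hJ hik hs
    simp [hik, hs.arr 15 rfl, hs.arr 16 rfl, hs.reg 10 rfl, hJ.2 k le_rfl]
    refine ⟨fun h => ⟨⟨?_, ?_⟩, by omega⟩, fun h => ⟨?_, ?_⟩⟩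
    · intro i hi hik
      rcases eq_or_ne i k with rfl | hne
      · simp [shiftLeft, h]
      · rw [Function.update_of_ne hne]; exact hJ.1 i hi (by omega)
    · intro i hi
      rw [Function.update_of_ne (by omega)]; exact hJ.2 i (by omega)
    · intro i hi hik
      rcases eq_or_ne i k with rfl | hne
      · rw [hJ.2 i le_rfl]; simp [shiftLeft, h]
      · exact hJ.1 i hi (by omega)
    · exact fun i hi => hJ.2 i (by omega)
  intro s₁ t₁ h₁ _ hs₁ ht₁
  have hD₁ := hD.same hs₁ rfl
  refine wp_for D.N 20 (fun k s' => (∀ i, 0 ≤ i → i < k → s'.arr 6 i =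
      shiftRight (s.arr 17) (s.arr 18) (s.reg 10) (s.arr 6) i) ∧ ∀ i, k ≤ i → s'.arr 6 i = s.arr 6 i)
    (by linarith [D.N_pos]) (by norm_num) ⟨by intros; omega, fun i _ => ?_⟩ ?_ rfl ?_ ?_
  · simp [hs₁.arr 6 rfl]
  · intro s' hs
    simp [hs.reg 1 rfl, hD₁.reg1]
  · intro k s' t' hk hkn hJ hik hs
    simp [hik, hs.arr 17 rfl, hs.arr 18 rfl, hs.reg 10 rfl, hJ.2 k le_rfl, hs₁.arr 17 rfl,
      hs₁.arr 18 rfl, hs₁.reg 10 rfl]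
    refine ⟨fun h => ⟨⟨?_, ?_⟩, by omega⟩, fun h => ⟨?_, ?_⟩⟩
    · intro i hi hik
      rcases eq_or_ne i k with rfl | hne
      · simp [shiftRight, h]
      · rw [Function.update_of_ne hne]; exact hJ.1 i hi (by omega)
    · intro i hi
      rw [Function.update_of_ne (by omega)]; exact hJ.2 i (by omega)
    · intro i hi hik
      rcases eq_or_ne i k with rfl | hne
      · rw [hJ.2 i le_rfl]; simp [shiftRight, h]
      · exact hJ.1 i hi (by omega)
    · exact fun i hi => hJ.2 i (by omega)
  intro s₂ t₂ h₂ _ hs₂ ht₂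
  refine ⟨?_, h₂.1, ?_⟩
  · rw [hs₂.arr 5 rfl]; exact h₁.1
  · simp at ht₁ ht₂; linarith [D.N_pos]

/-- Along the path, each right vertex takes over the left end of its tree edge, and the former mate
of that vertex becomes the hole of the matching. -/
lemma wp_augment {j₁ : ℤ} (hD : D.Holds s) (hM : D.Matching u v (s.arr 13) S)
    (hT : D.AugTree u v (s.arr 13) (s.arr 19) (s.arr 20) vis rk i₀ j₁)
    (hS : ¬ S i₀) (hj : s.reg 14 = j₁) (hj₁ : 0 ≤ j₁) (hj₁N : j₁ < D.N)
    (hfree : s.arr 13 j₁ = 0) :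
    wp ξ augment (fun s' t' => D.Matching u v (s'.arr 13) (fun i => i = i₀ ∨ S i) ∧
      t' ≤ t + 60 * D.m + 100) s t := by
  have hN := D.N_pos
  have hm := D.N_le_m
  rw [augment, wp_seq, wp_set]
  generalize hmr : s.arr 13 = mr at *
  generalize hpe : s.arr 19 = pe at *
  generalize hfr : s.arr 20 = fr at *
  -- the matching without the right vertex in register `14` is sound, and the mates of the vertices
  -- of smaller rank, among them those of the rest of the path, are still the original ones
  refine wp_loop (fun s' t' =>
    (s'.reg 11 = 1 ∧ 0 ≤ s'.reg 14 ∧ s'.reg 14 < D.N ∧ (0 < vis (s'.reg 14) ∨ s'.reg 14 = j₁) ∧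
      D.Matching u v (Function.update (s'.arr 13) (s'.reg 14) 0) S ∧
      (∀ j, 0 < vis j → rk j ≤ rk (s'.reg 14) → s'.arr 13 j = mr j) ∧
      t' + 30 * rk (s'.reg 14) ≤ t + 2 + 60 * D.m) ∨
    (s'.reg 11 = 0 ∧ D.Matching u v (s'.arr 13) (fun i => i = i₀ ∨ S i) ∧
      t' ≤ t + 60 * D.m + 60)) (t + 60 * D.m + 60) ?_ ?_ ?_ ?_
  · rintro s' t' (⟨-, h1, h2, h3, -, -, h4⟩ | ⟨-, -, h⟩)
    · have := (hT.pred _ h1 h2 h3).2.2.1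
      omega
    · exact h
  · left
    have := (hT.pred _ hj₁ hj₁N (Or.inr rfl)).2.2.2
    simp [hj, hmr]
    refine ⟨hj₁, hj₁N, ?_, by omega⟩
    rw [Function.update_eq_self_iff.2 hfree.symm]
    exact hM
  · rintro s' t' (⟨h11, h0, h1, hvis, hMj, hsame, ht'⟩ | ⟨h11, -⟩) hs hlt
    swap
    · simp [h11] at hlt
    generalize hk : s'.reg 14 = j at *
    obtain ⟨he, hej, hrk0, hrk⟩ := hT.pred j h0 h1 hvis
    have hmate := hT.mate j h0 h1 hvis
    generalize hpej : pe j = e at *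
    have a0 : s'.arr 0 = D.l := (hs.arr 0 rfl).trans hD.arr0
    have a19 : s'.arr 19 = pe := (hs.arr 19 rfl).trans hpe
    have a20 : s'.arr 20 = fr := (hs.arr 20 rfl).trans hfr
    simp [a0, a19, a20, hk, hpej]
    refine ⟨fun hneg => ?_, fun hneg => ?_⟩
    · -- the path has reached the root
      have hi : D.l e = i₀ := by
        by_contra hne
        have := (hmate hne).1
        omega
      refine ⟨?_, by omega⟩
      have := hMj.insert he (by rwa [hi])
      rw [hej] at this
      simp only [Function.update_idem, Function.update_self, lt_irrefl, false_and, not_false_iff,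
        and_true, hi] at this
      exact this
    · -- the path goes on to the former mate `j₂` of the left end
      have hi : D.l e ≠ i₀ := by
        rintro h
        rw [h, hT.root_from] at hneg
        omega
      obtain ⟨k0, k1, k2, k3, k4, k5⟩ := hmate hi
      generalize fr (D.l e) = j₂ at *
      have hjj : j₂ ≠ j := by rintro rfl; omega
      have hmj := hsame j₂ k2 k5.le
      left
      refine ⟨h11, k0, k1, Or.inl k2, ?_, ?_, ?_⟩
      · have hE := hMj.erase k0 k1 (by rw [Function.update_of_ne hjj]; omega)
        rw [Function.update_of_ne hjj, hmj, k4] at hE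
        have hI := hE.insert he (by simp)
        rw [hej, Function.update_of_ne hjj.symm, Function.update_self] at hI
        rw [Function.update_comm hjj.symm, Function.update_idem, Function.update_comm hjj] at hI
        refine hI.congr fun i _ _ => ?_
        have hc : S (D.l e) := by
          rw [← k4]
          exact hM.covers k0 k1 k3
        simp only [lt_irrefl, false_and, not_false_iff, and_true]
        constructor
        · intro h
          by_cases h' : i = D.l e
          · exact Or.inl h'
          · exact Or.inr ⟨h, h'⟩
        · rintro (rfl | h)
          · exact hc
          · exact h.1
      · intro j' hv hrk'
        rw [Function.update_of_ne (by rintro rfl; omega)]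
        exact hsame j' hv (by omega)
      · omega
  · rintro s' t' (⟨h11, -⟩ | ⟨h11, hMd, ht'⟩) hs hlt
    · simp [h11] at hlt
    · refine ⟨hMd, ?_⟩
      simp
      omega

end EdgeList

/-! ### The matching program -/

/-- One shortest-path augmentation from the left vertex in register `5`. -/
def matchVertex : Prog := search ;; shiftDuals ;; augment

/-- Matches the vertices that the auction has left free. -/
def matchFree : Prog :=
  forLoop 5 (.reg 0) (.branch (.get 10 (.reg 5)) (.reg 7) .skip matchVertex)

/-- Writes the indicator vector of the matching to array `4`. -/
def writeMatching : Prog := forLoop 6 (.reg 1) (.put 4 (.get 13 (.reg 6) - .lit 1) (.lit 1))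

/-- Everything up to the auction. -/
def prepare : Prog := roundDuals ;; repairDuals ;; buildAdjacency ;; buildHalves ;; computeCap

/-- The matching algorithm: an auction that starts from the repaired prediction and stops when each
free vertex has been outbid about `√n` times, followed by shortest augmenting paths. -/
def matcher : Prog := prepare ;; auction ;; matchFree ;; writeMatching

namespace EdgeList

variable {D : EdgeList} {ξ : ℤ → ℝ} {s : Store} {t : ℤ} {u v u' v' mr : ℤ → ℤ} {S S' : ℤ → Prop}

lemma Feasible.congr (h : D.Feasible u v) (hu : ∀ i, 0 ≤ i → i < D.N → u' i = u i)
    (hv : ∀ j, 0 ≤ j → j < D.N → v' j = v j) : D.Feasible u' v' := by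
  intro e he hem
  rw [hu _ (D.l_nonneg e he hem) (D.l_lt e he hem), hv _ (D.r_nonneg e he hem) (D.r_lt e he hem)]
  exact h e he hem

lemma Matching.congr_duals (h : D.Matching u v mr S) (hu : ∀ i, 0 ≤ i → i < D.N → u' i = u i)
    (hv : ∀ j, 0 ≤ j → j < D.N → v' j = v j) : D.Matching u' v' mr S :=
  { h with
    tight := fun j hj hjN hmr => by
      have hb := h.left_bounds hj hjN hmr
      rw [hu _ hb.1 hb.2, hv j hj hjN]
      exact h.tight j hj hjN hmr }

lemma AugTree.congr_duals {pe fr vis rk : ℤ → ℤ} {i₀ j₁ : ℤ}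
    (h : D.AugTree u v mr pe fr vis rk i₀ j₁) (hu : ∀ i, 0 ≤ i → i < D.N → u' i = u i)
    (hv : ∀ j, 0 ≤ j → j < D.N → v' j = v j) : D.AugTree u' v' mr pe fr vis rk i₀ j₁ :=
  { h with
    pred := fun j hj hjN hvis => by
      obtain ⟨h1, h2⟩ := h.pred j hj hjN hvis
      refine ⟨⟨h1.nonneg, h1.lt, ?_⟩, h2⟩
      rw [hu _ (D.l_nonneg _ h1.nonneg h1.lt) (D.l_lt _ h1.nonneg h1.lt),
        hv _ (D.r_nonneg _ h1.nonneg h1.lt) (D.r_lt _ h1.nonneg h1.lt)]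
      exact h1.eq }

lemma wp_matchVertex (hD : D.Holds s) (hadj : D.Adjacency (s.arr 7) (s.arr 8))
    (hh : IsHalfTable D.m (s.arr 9)) (hf : D.Feasible (s.arr 5) (s.arr 6))
    (hM : D.Matching (s.arr 5) (s.arr 6) (s.arr 13) S)
    (hi₀ : 0 ≤ s.reg 5) (hi₀N : s.reg 5 < D.N) (hS : ¬ S (s.reg 5)) :
    wp ξ matchVertex (fun s' t' => D.Feasible (s'.arr 5) (s'.arr 6) ∧
      D.Matching (s'.arr 5) (s'.arr 6) (s'.arr 13) (fun i => i = s.reg 5 ∨ S i) ∧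
      t' ≤ t + 2500 * (D.m * lg (2 * D.m))) s t := by
  have hN := D.N_pos
  have hm := D.N_le_m
  have hlg := lg_two_mul_pos D
  rw [matchVertex, wp_seq]
  refine (wp_search hD hadj hh hf hM hi₀ hi₀N hS).frame.mono ?_
  rintro s₁ t₁ ⟨⟨hd, ht₁⟩, hs₁⟩
  have hD₁ := hD.same hs₁ rfl
  rw [wp_seq]
  refine (wp_shiftDuals hD₁).frame.mono ?_
  rintro s₂ t₂ ⟨⟨h5, h6, ht₂⟩, hs₂⟩
  rw [hs₁.arr 5 rfl] at h5
  rw [hs₁.arr 6 rfl] at h6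
  have hD₂ := hD₁.same hs₂ rfl
  obtain ⟨rk, htree⟩ := hd.tree
  have e13 : s₂.arr 13 = s.arr 13 := (hs₂.arr 13 rfl).trans (hs₁.arr 13 rfl)
  have e14 : s₂.reg 14 = s₁.reg 14 := hs₂.reg 14 rfl
  have hM₂ := hd.matching.congr_duals h5 h6
  have hT₂ := htree.congr_duals h5 h6
  rw [← e13] at hM₂
  rw [← e13, ← hs₂.arr 19 rfl, ← hs₂.arr 20 rfl] at hT₂
  refine (wp_augment hD₂ hM₂ hT₂ hS e14 hd.nonneg hd.lt (by rw [e13]; exact hd.free)).frame.mono ?_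
  rintro s₃ t₃ ⟨⟨hM₃, ht₃⟩, hs₃⟩
  rw [hs₃.arr 5 rfl, hs₃.arr 6 rfl]
  refine ⟨hd.feasible.congr h5 h6, hM₃, ?_⟩
  have : D.m ≤ D.m * lg (2 * D.m) := by nlinarith
  linarith

open Finset Classical in
lemma wp_matchFree (hD : D.Holds s) (hadj : D.Adjacency (s.arr 7) (s.arr 8))
    (hh : IsHalfTable D.m (s.arr 9)) (hf : D.Feasible (s.arr 5) (s.arr 6))
    (hM : D.Matching (s.arr 5) (s.arr 6) (s.arr 13) (fun i => s.arr 10 i < s.reg 7)) :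
    wp ξ matchFree (fun s' t' => D.Feasible (s'.arr 5) (s'.arr 6) ∧
      D.Matching (s'.arr 5) (s'.arr 6) (s'.arr 13) (fun _ => True) ∧
      t' ≤ t + 2600 * (D.m * lg (2 * D.m)) *
        (1 + #{i ∈ Ico 0 D.N | s.reg 7 ≤ s.arr 10 i})) s t := by
  have hN := D.N_pos
  have hm := D.N_le_m
  have hlg := lg_two_mul_pos D
  have hmlg : D.m ≤ D.m * lg (2 * D.m) := by nlinarith
  obtain ⟨κ, hκ⟩ : ∃ κ, κ = D.m * lg (2 * D.m) := ⟨_, rfl⟩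
  rw [← hκ] at hmlg ⊢
  have hcard : ∀ k, k ≤ D.N → (#{i ∈ Ico 0 k | s.reg 7 ≤ s.arr 10 i} : ℤ) ≤
      #{i ∈ Ico 0 D.N | s.reg 7 ≤ s.arr 10 i} := by
    intro k hk
    exact_mod_cast card_le_card (filter_subset_filter _ (Ico_subset_Ico_right hk))
  refine wp_for_clock D.N (t + 2 + 60 * D.N + 2500 * κ * #{i ∈ Ico 0 D.N | s.reg 7 ≤ s.arr 10 i})
    (fun k s' t' => D.Feasible (s'.arr 5) (s'.arr 6) ∧
      D.Matching (s'.arr 5) (s'.arr 6) (s'.arr 13) (fun i => s.arr 10 i < s.reg 7 ∨ i < k) ∧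
      k ≤ D.N ∧ t' ≤ t + 2 + 60 * k + 2500 * κ * #{i ∈ Ico 0 k | s.reg 7 ≤ s.arr 10 i})
    (by omega) ?_ ?_ ?_ rfl ?_ ?_
  · rintro k s' t' ⟨-, -, hk, ht⟩
    have := mul_le_mul_of_nonneg_left (hcard k hk) (show 0 ≤ 2500 * κ by omega)
    omega
  · simp
    exact ⟨hf, hM.congr (fun i hi _ => by simp [hi]), by omega⟩
  · intro s' hs
    simp [hs.reg 0 rfl, hD.reg0]
  · rintro k s' t' hk hkN ⟨hf', hM', -, ht'⟩ hik hs
    have hIco : Ico 0 (k + 1) = insert k (Ico 0 k) :=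
      (Finset.insert_Ico_right_eq_Ico_add_one hk).symm
    simp only [wp_branch, Expr.eval_get, Expr.eval_reg, hik, hs.arr 10 rfl, hs.reg 7 rfl]
    refine ⟨fun hlt => ?_, fun hlt => ?_⟩
    · simp only [wp_skip, Store.arr_setReg]
      refine ⟨hf', hM'.congr fun i hi _ => ?_, by omega, ?_⟩
      · rw [Int.lt_add_one_iff, le_iff_lt_or_eq]
        constructor
        · rintro (h | h | rfl)
          · exact Or.inl h
          · exact Or.inr h
          · exact Or.inl hlt
        · tauto
      · rw [hIco, filter_insert, if_neg (by omega)]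
        simp
        omega
    · refine (wp_matchVertex (hD.same hs rfl) (by rw [hs.arr 7 rfl, hs.arr 8 rfl]; exact hadj)
        (by rw [hs.arr 9 rfl]; exact hh) hf' hM' (by omega) (by omega)
        (by rw [hik]; omega)).mono ?_
      rintro s₂ t₂ ⟨hf₂, hM₂, ht₂⟩
      simp only [Store.arr_setReg]
      refine ⟨hf₂, hM₂.congr fun i hi _ => ?_, by omega, ?_⟩
      · rw [Int.lt_add_one_iff, le_iff_lt_or_eq, hik]
        tauto
      · rw [hIco, filter_insert, if_pos (by omega), card_insert_of_notMem (by simp)]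
        rw [← hκ] at ht₂
        simp at ht₂ ⊢
        linarith
  · rintro s' t' ⟨hf', hM', -, ht'⟩ hik hs
    refine ⟨hf', hM'.congr fun i _ hi => by simp [hi], ?_⟩
    simp
    have : 0 ≤ κ * #{i ∈ Ico 0 D.N | s.reg 7 ≤ s.arr 10 i} := mul_nonneg (by omega) (by positivity)
    linarith

lemma wp_writeMatching (hD : D.Holds s) (hM : D.Matching u v (s.arr 13) (fun _ => True))
    (h4 : s.arr 4 = 0) :
    wp ξ writeMatching (fun s' t' => (∀ e, 0 ≤ e → e < D.m → s'.arr 4 e =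
      if s.arr 13 (D.r e) = e + 1 then 1 else 0) ∧ t' ≤ t + 30 * D.N + 20) s t := by
  have hN := D.N_pos
  refine wp_for D.N 10 (fun k s' => ∀ e, 0 ≤ e → e < D.m → s'.arr 4 e =
    if s.arr 13 (D.r e) = e + 1 ∧ D.r e < k then 1 else 0) (by omega) (by norm_num) ?_ ?_ rfl ?_ ?_
  · intro e h1 h2
    have := D.r_nonneg e h1 h2
    rw [if_neg (by omega)]
    simp [h4]
  · intro s' hs
    simp [hs.reg 1 rfl, hD.reg1]
  · intro k s' t' hk hkn hJ hik hs
    simp [hik, hs.arr 13 rfl]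
    intro e h1 h2
    rw [Function.update_apply, hJ e h1 h2]
    by_cases hk' : e = s.arr 13 k - 1
    · rw [if_pos hk', if_pos]
      have h3 := hM.right k hk hkn (by omega)
      rw [← hk'] at h3
      rw [h3]
      omega
    · rw [if_neg hk']
      congr 1
      refine propext (and_congr_right fun h3 => ⟨fun h4 => by omega, fun h4 => ?_⟩)
      rcases (show D.r e ≤ k by omega).lt_or_eq with h5 | h5
      · exact h5
      · rw [h5] at h3; omega
  · intro s₁ t₁ h₁ _ hs₁ ht₁
    refine ⟨fun e h1 h2 => ?_, by simp at ht₁; linarith⟩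
    rw [h₁ e h1 h2]
    simp [D.r_lt e h1 h2]

/-- The edges of a perfect matching, indexed by their left ends. -/
structure PerfectEdges (D : EdgeList) (u v mr σ : ℤ → ℤ) : Prop where
  tight : ∀ i, 0 ≤ i → i < D.N → D.Tight u v (σ i)
  left : ∀ i, 0 ≤ i → i < D.N → D.l (σ i) = i
  mate : ∀ i, 0 ≤ i → i < D.N → mr (D.r (σ i)) = σ i + 1

lemma Matching.perfectEdges (h : D.Matching u v mr (fun _ => True)) :
    ∃ σ, D.PerfectEdges u v mr σ := by
  have h' : ∀ i, ∃ e, 0 ≤ i → i < D.N → D.Tight u v e ∧ D.l e = i ∧ mr (D.r e) = e + 1 := by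
    intro i
    by_cases hi : 0 ≤ i ∧ i < D.N
    · obtain ⟨j, h1, h2, h3, h4⟩ := (h.cover i hi.1 hi.2).1 trivial
      have h5 := h.le j h1 h2
      have h6 := h.right j h1 h2 h3
      refine ⟨mr j - 1, fun _ _ => ⟨⟨by omega, by omega, ?_⟩, h4, by rw [h6]; omega⟩⟩
      rw [h6]
      exact h.tight j h1 h2 h3
    · exact ⟨0, fun h1 h2 => absurd ⟨h1, h2⟩ hi⟩
  choose σ hσ using h'
  exact ⟨σ, fun i h1 h2 => (hσ i h1 h2).1, fun i h1 h2 => (hσ i h1 h2).2.1,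
    fun i h1 h2 => (hσ i h1 h2).2.2⟩

variable {σ : ℤ → ℤ}

lemma PerfectEdges.inj (h : D.PerfectEdges u v mr σ) (i i' : ℤ) (hi : 0 ≤ i) (hiN : i < D.N)
    (hi' : 0 ≤ i') (hiN' : i' < D.N) (he : D.r (σ i) = D.r (σ i')) : i = i' := by
  have h1 := h.mate i hi hiN
  rw [he, h.mate i' hi' hiN'] at h1
  rw [← h.left i hi hiN, ← h.left i' hi' hiN', add_right_cancel h1]

lemma PerfectEdges.injOn (h : D.PerfectEdges u v mr σ) :
    Set.InjOn (fun i => D.r (σ i)) (Finset.Ico 0 D.N) := by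
  intro i hi i' hi' he
  simp only [Finset.coe_Ico, Set.mem_Ico] at hi hi'
  exact h.inj i i' hi.1 hi.2 hi'.1 hi'.2 he

lemma PerfectEdges.image (h : D.PerfectEdges u v mr σ) :
    (Finset.Ico 0 D.N).image (fun i => D.r (σ i)) = Finset.Ico 0 D.N := by
  refine Finset.eq_of_subset_of_card_le ?_ ?_
  · intro j hj
    simp only [Finset.mem_image, Finset.mem_Ico] at hj ⊢
    obtain ⟨i, hi, rfl⟩ := hj
    have ht := h.tight i hi.1 hi.2
    exact ⟨D.r_nonneg _ ht.nonneg ht.lt, D.r_lt _ ht.nonneg ht.lt⟩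
  · rw [Finset.card_image_of_injOn h.injOn]

lemma PerfectEdges.sum (h : D.PerfectEdges u v mr σ) (w : ℤ → ℤ) :
    ∑ i ∈ Finset.Ico 0 D.N, w (D.r (σ i)) = ∑ j ∈ Finset.Ico 0 D.N, w j := by
  conv_rhs => rw [← h.image]
  rw [Finset.sum_image h.injOn]

open Finset Classical in
/-- Each edge of the final matching that is not tight for a feasible vector `u', v'` contributes at
least one to the duality gap of that vector, which is at most its distance to an optimal one. -/
lemma PerfectEdges.card_not_tight (h : D.PerfectEdges u v mr σ) (hf : D.Feasible u' v')
    {y z : ℤ → ℤ} (hyz : ∑ i ∈ Ico 0 D.N, u i + ∑ j ∈ Ico 0 D.N, v j ≤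
      ∑ i ∈ Ico 0 D.N, y i + ∑ j ∈ Ico 0 D.N, z j) :
    (#{i ∈ Ico 0 D.N | ¬ D.Tight u' v' (σ i)} : ℤ) ≤ D.dist u' v' y z := by
  have h1 : (#{i ∈ Ico 0 D.N | ¬ D.Tight u' v' (σ i)} : ℤ) ≤
      ∑ i ∈ Ico 0 D.N, (u i + v (D.r (σ i)) - u' i - v' (D.r (σ i))) := by
    rw [card_filter, Nat.cast_sum]
    refine sum_le_sum fun i hi => ?_
    simp only [mem_Ico] at hi
    have ht := h.tight i hi.1 hi.2
    have hl := h.left i hi.1 hi.2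
    have h2 := hf _ ht.nonneg ht.lt
    have h3 := ht.eq
    rw [hl] at h2 h3
    split_ifs with h4
    · push_cast
      omega
    · have : u' i + v' (D.r (σ i)) ≠ D.c (σ i) := fun h5 =>
        h4 ⟨ht.nonneg, ht.lt, by rw [hl]; exact h5⟩
      push_cast
      omega
  have h2 : ∑ i ∈ Ico 0 D.N, (y i - u' i) ≤ ∑ i ∈ Ico 0 D.N, |u' i - y i| :=
    sum_le_sum fun i _ => by rw [abs_sub_comm]; exact le_abs_self _
  have h3 : ∑ i ∈ Ico 0 D.N, (z i - v' i) ≤ ∑ i ∈ Ico 0 D.N, |v' i - z i| :=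
    sum_le_sum fun i _ => by rw [abs_sub_comm]; exact le_abs_self _
  unfold dist
  have h4 := h.sum v
  have h5 := h.sum v'
  simp only [sum_sub_distrib, sum_add_distrib] at h1 h2 h3
  omega

lemma wp_prepare (hD : D.Holds s) (h7 : s.arr 7 = 0) :
    wp ξ prepare (fun s' t' => D.Holds s' ∧ D.Feasible (s'.arr 5) (s'.arr 6) ∧
      (∀ y z, D.Feasible y z → D.dist (s'.arr 5) (s'.arr 6) y z ≤
        D.dist (fun i => round (ξ i)) (fun j => round (ξ (D.N + j))) y z) ∧
      D.Adjacency (s'.arr 7) (s'.arr 8) ∧ IsHalfTable D.m (s'.arr 9) ∧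
      D.N ≤ s'.reg 7 ^ 2 ∧ (s'.reg 7 - 1) ^ 2 < D.N ∧ 1 ≤ s'.reg 7 ∧
      t' ≤ t + 300 * (D.m * s'.reg 7)) s t := by
  have hN := D.N_pos
  have hm := D.N_le_m
  rw [prepare, wp_seq]
  refine (wp_roundDuals hD).frame.mono ?_
  rintro s₁ t₁ ⟨⟨h5, h6, ht₁⟩, hs₁⟩
  have hD₁ := hD.same hs₁ rfl
  rw [wp_seq]
  refine (wp_repairDuals hD₁).frame.mono ?_
  rintro s₂ t₂ ⟨⟨hf, hd, ht₂⟩, hs₂⟩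
  have hD₂ := hD₁.same hs₂ rfl
  rw [wp_seq]
  refine (wp_buildAdjacency hD₂ (by rw [hs₂.arr 7 rfl, hs₁.arr 7 rfl, h7])).frame.mono ?_
  rintro s₃ t₃ ⟨⟨hadj, ht₃⟩, hs₃⟩
  have hD₃ := hD₂.same hs₃ rfl
  rw [wp_seq]
  refine (wp_buildHalves hD₃).frame.mono ?_
  rintro s₄ t₄ ⟨⟨hh, ht₄⟩, hs₄⟩
  have hD₄ := hD₃.same hs₄ rfl
  refine (wp_computeCap hD₄).frame.mono ?_
  rintro s₅ t₅ ⟨⟨hP, hP', hP1, ht₅⟩, hs₅⟩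
  have e5 : s₅.arr 5 = s₂.arr 5 := by rw [hs₅.arr 5 rfl, hs₄.arr 5 rfl, hs₃.arr 5 rfl]
  have e6 : s₅.arr 6 = s₂.arr 6 := by rw [hs₅.arr 6 rfl, hs₄.arr 6 rfl, hs₃.arr 6 rfl]
  rw [e5, e6, hs₅.arr 7 rfl, hs₅.arr 8 rfl, hs₄.arr 7 rfl, hs₄.arr 8 rfl, hs₅.arr 9 rfl]
  refine ⟨hD₄.same hs₅ rfl, hf, fun y z hyz => (hd y z hyz).trans_eq ?_, hadj, hh, hP, hP', hP1, ?_⟩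
  · unfold dist
    congr 1
    · refine Finset.sum_congr rfl fun i hi => ?_
      simp only [Finset.mem_Ico] at hi
      rw [h5 i hi.1 hi.2]
    · refine Finset.sum_congr rfl fun i hi => ?_
      simp only [Finset.mem_Ico] at hi
      rw [h6 i hi.1 hi.2]
  · have : D.m ≤ D.m * s₅.reg 7 := by nlinarith
    have : s₅.reg 7 ≤ D.m * s₅.reg 7 := by nlinarith
    linarith

variable (D) in
/-- The result of the matching algorithm.  The running time is governed by the number `f` of left
vertices that the auction leaves free. -/
structure Solved (ξ : ℤ → ℝ) (s' : Store) (τ : ℤ) : Prop where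
  feasible : D.Feasible (s'.arr 5) (s'.arr 6)
  matching : D.Matching (s'.arr 5) (s'.arr 6) (s'.arr 13) (fun _ => True)
  output : ∀ e, 0 ≤ e → e < D.m → s'.arr 4 e = if s'.arr 13 (D.r e) = e + 1 then 1 else 0
  time : ∃ P f : ℤ, 1 ≤ P ∧ D.N ≤ P ^ 2 ∧ (P - 1) ^ 2 < D.N ∧ 0 ≤ f ∧ f ≤ D.N ∧
    τ ≤ 3600 * (D.m * lg (2 * D.m)) * (P + f) ∧ ∀ y z, D.Feasible y z →
    ∑ i ∈ Finset.Ico 0 D.N, s'.arr 5 i + ∑ j ∈ Finset.Ico 0 D.N, s'.arr 6 j ≤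
      ∑ i ∈ Finset.Ico 0 D.N, y i + ∑ j ∈ Finset.Ico 0 D.N, z j →
    P * f ≤ D.N + P * D.dist (fun i => round (ξ i)) (fun j => round (ξ (D.N + j))) y z

open Finset Classical in
lemma wp_matcher (hD : D.Holds s) (h4 : s.arr 4 = 0) (h7 : s.arr 7 = 0) (h10 : s.arr 10 = 0)
    (h12 : s.arr 12 = 0) (h13 : s.arr 13 = 0) : wp ξ matcher (D.Solved ξ) s 0 := by
  have hN := D.N_pos
  have hm := D.N_le_m
  have hlg := lg_two_mul_pos D
  rw [matcher, wp_seq]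
  refine (wp_prepare hD h7).frame.mono ?_
  rintro s₁ t₁ ⟨⟨hD₁, hf, hd, hadj, hh, hP, hP', hP1, ht₁⟩, hs₁⟩
  rw [wp_seq]
  refine (wp_auction hD₁ hadj hf hP1 ((hs₁.arr 10 rfl).trans h10) ((hs₁.arr 12 rfl).trans h12)
    ((hs₁.arr 13 rfl).trans h13)).frame.mono ?_
  rintro s₂ t₂ ⟨⟨hA, ht₂⟩, hs₂⟩
  have hD₂ := hD₁.same hs₂ rfl
  have e5 := hs₂.arr 5 rfl
  have e6 := hs₂.arr 6 rfl
  have e7 := hs₂.reg 7 rfl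
  rw [wp_seq]
  refine (wp_matchFree (s := s₂) hD₂ (by rw [hs₂.arr 7 rfl, hs₂.arr 8 rfl]; exact hadj)
    (by rw [hs₂.arr 9 rfl]; exact hh) (by rw [e5, e6]; exact hf)
    (by rw [e5, e6, e7]; exact hA.matching)).frame.mono ?_
  rintro s₃ t₃ ⟨⟨hf₃, hM₃, ht₃⟩, hs₃⟩
  have hD₃ := hD₂.same hs₃ rfl
  refine (wp_writeMatching hD₃ hM₃
    (by rw [hs₃.arr 4 rfl, hs₂.arr 4 rfl, hs₁.arr 4 rfl, h4])).frame.mono ?_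
  rintro s₄ t₄ ⟨⟨hout, ht₄⟩, hs₄⟩
  have b5 := hs₄.arr 5 rfl
  have b6 := hs₄.arr 6 rfl
  have b13 := hs₄.arr 13 rfl
  refine ⟨by rwa [b5, b6], by rwa [b5, b6, b13], by rwa [b13], s₁.reg 7,
    #{i ∈ Ico 0 D.N | s₁.reg 7 ≤ s₂.arr 10 i}, hP1, hP, hP', by positivity, ?_, ?_, ?_⟩
  · have := card_filter_le (Ico 0 D.N) (fun i => s₁.reg 7 ≤ s₂.arr 10 i)
    rw [Int.card_Ico, sub_zero] at this
    omega
  · rw [e7] at ht₃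
    have hf0 : (0 : ℤ) ≤ #{i ∈ Ico 0 D.N | s₁.reg 7 ≤ s₂.arr 10 i} := by positivity
    generalize (#{i ∈ Ico 0 D.N | s₁.reg 7 ≤ s₂.arr 10 i} : ℤ) = f at *
    have h1 : D.m ≤ D.m * lg (2 * D.m) := by nlinarith
    generalize D.m * lg (2 * D.m) = κ at *
    generalize s₁.reg 7 = P at *
    have h2 : D.m * P ≤ κ * P := mul_le_mul_of_nonneg_right h1 (by omega)
    have h3 : κ ≤ κ * P := le_mul_of_one_le_right (by omega) hP1
    have h4 : 0 ≤ κ * f := mul_nonneg (by omega) hf0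
    linarith
  · intro y z hyz hsum
    rw [b5, b6] at hsum
    obtain ⟨σ, hσ⟩ := hM₃.perfectEdges
    have h1 := hA.card_free (by omega) (σ := σ) (fun i h1 h2 => ⟨(hσ.tight i h1 h2).nonneg,
      (hσ.tight i h1 h2).lt, hσ.left i h1 h2⟩) hσ.inj
    have h2 := (hσ.card_not_tight hf hsum).trans (hd y z hyz)
    have h3 := mul_le_mul_of_nonneg_left h2 (show 0 ≤ s₁.reg 7 by omega)
    linarith

end EdgeList

/-! ### From bipartite graphs to edge lists -/

lemma arrayOf_natCast {α : Type*} [Zero α] (l : List α) (k : ℕ) :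
    arrayOf l (k : ℤ) = l.getD k 0 := by simp [arrayOf]

lemma arrayOf_ofFn {α : Type*} [Zero α] {n : ℕ} (f : Fin n → α) (k : Fin n) :
    arrayOf (List.ofFn f) ((k : ℕ) : ℤ) = f k := by
  rw [arrayOf_natCast, List.getD_eq_getElem _ _ (by simp)]
  simp

lemma exists_fin_of_int {n : ℕ} {i : ℤ} (h : 0 ≤ i) (h' : i < n) : ∃ k : Fin n, ((k : ℕ) : ℤ) = i :=
  ⟨⟨i.toNat, by omega⟩, by simp [h]⟩

lemma sum_Ico_natCast {α : Type*} [AddCommMonoid α] (n : ℕ) (f : ℤ → α) :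
    ∑ i ∈ Finset.Ico (0 : ℤ) n, f i = ∑ k : Fin n, f ((k : ℕ) : ℤ) := by
  symm
  refine Finset.sum_bij (fun k _ => ((k : ℕ) : ℤ)) (fun k _ => by simp) (fun k _ k' _ h => ?_)
    (fun i hi => ?_) (fun _ _ => rfl)
  · exact Fin.ext (by exact_mod_cast h)
  · simp only [Finset.mem_Ico] at hi
    obtain ⟨k, hk⟩ := exists_fin_of_int hi.1 hi.2
    exact ⟨k, by simp, hk⟩

namespace BipGraph

variable {G : BipGraph} {M : Finset (Fin G.m)} {c : Fin G.m → ℤ}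

lemma IsPerfectMatching.card_eq (hM : G.IsPerfectMatching M) : G.nL = G.nR := by
  choose f hf hf' using hM.1
  choose g hg hg' using hM.2
  have h1 : Function.Injective (fun i => G.right (f i)) := by
    intro i i' h
    have h1 := hg' (G.right (f i)) (f i) ⟨(hf i).1, rfl⟩
    have h2 := hg' (G.right (f i)) (f i') ⟨(hf i').1, h.symm⟩
    rw [← (hf i).2, ← (hf i').2, h1, h2]
  have h2 : Function.Injective (fun j => G.left (g j)) := by
    intro j j' h
    have h1 := hf' (G.left (g j)) (g j) ⟨(hg j).1, rfl⟩
    have h2 := hf' (G.left (g j)) (g j') ⟨(hg j').1, h.symm⟩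
    rw [← (hg j).2, ← (hg j').2, h1, h2]
  have h3 := Fintype.card_le_of_injective _ h1
  have h4 := Fintype.card_le_of_injective _ h2
  simp at h3 h4
  omega

lemma IsPerfectMatching.sum_left (hM : G.IsPerfectMatching M) (f : Fin G.nL → ℝ) :
    ∑ e ∈ M, f (G.left e) = ∑ i, f i := by
  classical
  rw [← Finset.sum_fiberwise M G.left]
  refine Finset.sum_congr rfl fun i _ => ?_
  obtain ⟨e, he, he'⟩ := hM.1 i
  have : (M.filter fun e => G.left e = i) = {e} := by
    ext e'
    simp only [Finset.mem_filter, Finset.mem_singleton]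
    exact ⟨he' e', fun h => h ▸ he⟩
  rw [this, Finset.sum_singleton, he.2]

lemma IsPerfectMatching.sum_right (hM : G.IsPerfectMatching M) (f : Fin G.nR → ℝ) :
    ∑ e ∈ M, f (G.right e) = ∑ j, f j := by
  classical
  rw [← Finset.sum_fiberwise M G.right]
  refine Finset.sum_congr rfl fun i _ => ?_
  obtain ⟨e, he, he'⟩ := hM.2 i
  have : (M.filter fun e => G.right e = i) = {e} := by
    ext e'
    simp only [Finset.mem_filter, Finset.mem_singleton]
    exact ⟨he' e', fun h => h ▸ he⟩
  rw [this, Finset.sum_singleton, he.2]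

lemma IsPerfectMatching.sum_ends (hM : G.IsPerfectMatching M) (z : G.V → ℝ) :
    ∑ e ∈ M, (z (Sum.inl (G.left e)) + z (Sum.inr (G.right e))) = ∑ v, z v := by
  rw [Finset.sum_add_distrib, hM.sum_left (fun i => z (Sum.inl i)),
    hM.sum_right (fun j => z (Sum.inr j)), Fintype.sum_sum_type]

lemma IsPerfectMatching.weak_duality (hM : G.IsPerfectMatching M) {z : G.V → ℝ}
    (hz : G.IsDualFeasible c z) : ∑ v, z v ≤ ((∑ e ∈ M, c e : ℤ) : ℝ) := by
  rw [← hM.sum_ends]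
  push_cast
  exact Finset.sum_le_sum fun e _ => hz e

/-- Complementary slackness. -/
lemma IsPerfectMatching.optimal_of_tight (hM : G.IsPerfectMatching M) {y : G.V → ℤ}
    (hy : G.IsDualFeasible c fun v => (y v : ℝ))
    (ht : ∀ e ∈ M, y (Sum.inl (G.left e)) + y (Sum.inr (G.right e)) = c e) :
    G.IsOptimalDual c y ∧ G.IsMinWeightPerfectMatching c M := by
  have h : ∑ v, (y v : ℝ) = ((∑ e ∈ M, c e : ℤ) : ℝ) := by
    rw [← hM.sum_ends, Int.cast_sum]
    exact Finset.sum_congr rfl fun e he => by rw [← ht e he]; push_cast; rfl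
  refine ⟨⟨hy, fun z hz => ?_⟩, hM, fun M' hM' => ?_⟩
  · rw [h]
    exact hM.weak_duality hz
  · have := hM'.weak_duality hy
    rw [h] at this
    exact_mod_cast this

variable (G c) in
/-- A graph with a perfect matching as an edge list. -/
noncomputable def toEdgeList (hn : 1 ≤ G.nL) (hM : ∃ M, G.IsPerfectMatching M) : EdgeList where
  N := G.nL
  m := G.m
  l := arrayOf (List.ofFn fun e => ((G.left e : ℕ) : ℤ))
  r := arrayOf (List.ofFn fun e => ((G.right e : ℕ) : ℤ))
  c := arrayOf (List.ofFn c)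
  N_pos := by exact_mod_cast hn
  l_nonneg e h1 h2 := by
    obtain ⟨k, rfl⟩ := exists_fin_of_int h1 h2
    rw [arrayOf_ofFn]; positivity
  l_lt e h1 h2 := by
    obtain ⟨k, rfl⟩ := exists_fin_of_int h1 h2
    rw [arrayOf_ofFn]; exact_mod_cast (G.left k).2
  r_nonneg e h1 h2 := by
    obtain ⟨k, rfl⟩ := exists_fin_of_int h1 h2
    rw [arrayOf_ofFn]; positivity
  r_lt e h1 h2 := by
    obtain ⟨k, rfl⟩ := exists_fin_of_int h1 h2
    rw [arrayOf_ofFn, hM.choose_spec.card_eq]; exact_mod_cast (G.right k).2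
  pm i := if h : 0 ≤ i ∧ i < G.nL then
    (((hM.choose_spec.1 ⟨i.toNat, by omega⟩).choose : ℕ) : ℤ) else 0
  pm_nonneg i h1 h2 := by
    rw [dif_pos ⟨h1, h2⟩]; positivity
  pm_lt i h1 h2 := by
    rw [dif_pos ⟨h1, h2⟩]
    exact_mod_cast (hM.choose_spec.1 ⟨i.toNat, by omega⟩).choose.2
  l_pm i h1 h2 := by
    rw [dif_pos ⟨h1, h2⟩, arrayOf_ofFn,
      (hM.choose_spec.1 ⟨i.toNat, by omega⟩).choose_spec.1.2]
    simp [h1]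
  r_pm_inj i i' h1 h2 h3 h4 h := by
    rw [dif_pos ⟨h1, h2⟩, dif_pos ⟨h3, h4⟩, arrayOf_ofFn, arrayOf_ofFn] at h
    have k1 := (hM.choose_spec.1 ⟨i.toNat, by omega⟩).choose_spec.1
    have k2 := (hM.choose_spec.1 ⟨i'.toNat, by omega⟩).choose_spec.1
    generalize (hM.choose_spec.1 ⟨i.toNat, by omega⟩).choose = e at *
    generalize (hM.choose_spec.1 ⟨i'.toNat, by omega⟩).choose = e' at *
    have hr : G.right e = G.right e' := Fin.ext (by exact_mod_cast h)
    obtain ⟨e₀, -, he₀⟩ := hM.choose_spec.2 (G.right e)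
    have h5 := he₀ e ⟨k1.1, rfl⟩
    have h6 := he₀ e' ⟨k2.1, hr.symm⟩
    have h7 := k1.2
    rw [h5, ← h6, k2.2, Fin.mk.injEq] at h7
    omega

variable {hn : 1 ≤ G.nL} {hM : ∃ M, G.IsPerfectMatching M}

lemma toEdgeList_l (e : Fin G.m) : (G.toEdgeList c hn hM).l ((e : ℕ) : ℤ) = (G.left e : ℕ) :=
  arrayOf_ofFn (fun e => ((G.left e : ℕ) : ℤ)) e

lemma toEdgeList_r (e : Fin G.m) : (G.toEdgeList c hn hM).r ((e : ℕ) : ℤ) = (G.right e : ℕ) :=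
  arrayOf_ofFn (fun e => ((G.right e : ℕ) : ℤ)) e

lemma toEdgeList_c (e : Fin G.m) : (G.toEdgeList c hn hM).c ((e : ℕ) : ℤ) = c e :=
  arrayOf_ofFn c e

lemma toEdgeList_holds : (G.toEdgeList c hn hM).Holds (G.matchingInput c) where
  reg0 := rfl
  reg1 := by
    obtain ⟨M, hM⟩ := hM
    exact (congrArg _ hM.card_eq).symm
  reg2 := rfl
  arr0 := rfl
  arr1 := rfl
  arr2 := rfl

lemma matchingInput_arr {a : ℕ} (ha : 3 ≤ a) : (G.matchingInput c).arr a = 0 := by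
  funext i
  match a, ha with
  | 3, _ => simp [matchingInput, store, arrayOf]
  | a + 4, _ => simp [matchingInput, store, arrayOf]

/-- The dual vector that the matching algorithm leaves in the arrays `5` and `6`. -/
def dualOf (G : BipGraph) (s : Store) : G.V → ℤ
  | Sum.inl i => s.arr 5 ((i : ℕ) : ℤ)
  | Sum.inr j => s.arr 6 ((j : ℕ) : ℤ)

lemma isDualFeasible_iff {y : G.V → ℤ} {u v : ℤ → ℤ} (hu : ∀ i : Fin G.nL, u (i : ℕ) = y (Sum.inl i))
    (hv : ∀ j : Fin G.nR, v (j : ℕ) = y (Sum.inr j)) :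
    G.IsDualFeasible c (fun v => (y v : ℝ)) ↔ (G.toEdgeList c hn hM).Feasible u v := by
  constructor
  · intro h e h1 h2
    obtain ⟨k, rfl⟩ := exists_fin_of_int (n := G.m) h1 h2
    rw [toEdgeList_l, toEdgeList_r, toEdgeList_c, hu, hv]
    have := h k
    simp only at this
    exact_mod_cast this
  · intro h e
    have := h ((e : ℕ) : ℤ) (by positivity) (show _ < (G.m : ℤ) by exact_mod_cast e.2)
    rw [toEdgeList_l, toEdgeList_r, toEdgeList_c, hu, hv] at this
    simp only
    exact_mod_cast this

variable {ξ : ℤ → ℝ} {s' : Store} {τ : ℤ}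

/-- The edge set that array `13` encodes. -/
def matchingOf (G : BipGraph) (s : Store) : Finset (Fin G.m) :=
  Finset.univ.filter fun e => s.arr 13 ((G.right e : ℕ) : ℤ) = (e : ℕ) + 1

lemma isPerfectMatching_matchingOf (h : (G.toEdgeList c hn hM).Solved ξ s' τ) :
    G.IsPerfectMatching (G.matchingOf s') := by
  have hLR : G.nL = G.nR := hM.choose_spec.card_eq
  obtain ⟨σ, hσ⟩ := h.matching.perfectEdges
  have hedge : ∀ i : Fin G.nL, ∃ e ∈ G.matchingOf s', G.left e = i ∧ ((e : ℕ) : ℤ) = σ (i : ℕ) := by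
    intro i
    have h1 : (0 : ℤ) ≤ ((i : ℕ) : ℤ) := by positivity
    have h2 : ((i : ℕ) : ℤ) < (G.toEdgeList c hn hM).N := by
      show _ < (G.nL : ℤ)
      exact_mod_cast i.2
    have ht := hσ.tight _ h1 h2
    obtain ⟨e, he⟩ := exists_fin_of_int (n := G.m) ht.nonneg ht.lt
    have h3 := hσ.left _ h1 h2
    have h4 := hσ.mate _ h1 h2
    rw [← he, toEdgeList_r] at h4
    rw [← he, toEdgeList_l] at h3
    exact ⟨e, by simp [matchingOf, h4], Fin.ext (by exact_mod_cast h3), he⟩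
  refine ⟨fun i => ?_, fun j => ?_⟩
  · obtain ⟨e, he, hl, hσe⟩ := hedge i
    refine ⟨e, ⟨he, hl⟩, ?_⟩
    rintro e' ⟨he', hl'⟩
    have hb : ∀ e : Fin G.m, 0 ≤ ((G.right e : ℕ) : ℤ) ∧
        ((G.right e : ℕ) : ℤ) < (G.toEdgeList c hn hM).N := by
      intro e
      refine ⟨by positivity, ?_⟩
      show _ < (G.nL : ℤ)
      rw [hLR]
      exact_mod_cast (G.right e).2
    simp only [matchingOf, Finset.mem_filter, Finset.mem_univ, true_and] at he he'
    have := h.matching.inj _ _ (hb e').1 (hb e').2 (hb e).1 (hb e).2 (by omega) (by omega)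
      (by rw [he, he', add_sub_cancel_right, add_sub_cancel_right, toEdgeList_l, toEdgeList_l, hl,
        hl'])
    rw [this, he] at he'
    exact Fin.ext (by omega)
  · have hj : ((j : ℕ) : ℤ) ∈ Finset.Ico 0 (G.toEdgeList c hn hM).N := by
      simp only [Finset.mem_Ico]
      refine ⟨by positivity, ?_⟩
      show _ < (G.nL : ℤ)
      rw [hLR]
      exact_mod_cast j.2
    rw [← hσ.image] at hj
    simp only [Finset.mem_image, Finset.mem_Ico] at hj
    obtain ⟨i, ⟨h1, h2⟩, h3⟩ := hj
    obtain ⟨i, rfl⟩ := exists_fin_of_int (n := G.nL) h1 h2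
    obtain ⟨e, he, hl, hσe⟩ := hedge i
    rw [← hσe, toEdgeList_r] at h3
    have hr : G.right e = j := Fin.ext (by exact_mod_cast h3)
    refine ⟨e, ⟨he, hr⟩, ?_⟩
    rintro e' ⟨he', hr'⟩
    simp only [matchingOf, Finset.mem_filter, Finset.mem_univ, true_and] at he he'
    rw [hr', ← hr, he] at he'
    exact Fin.ext (by omega)

lemma outputsMatching_matchingOf (h : (G.toEdgeList c hn hM).Solved ξ s' τ) :
    G.OutputsMatching s' (G.matchingOf s') := by
  intro e
  rw [h.output _ (by positivity) (show ((e : ℕ) : ℤ) < (G.m : ℤ) by exact_mod_cast e.2),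
    toEdgeList_r]
  simp [matchingOf]

lemma optimal_of_solved (h : (G.toEdgeList c hn hM).Solved ξ s' τ) :
    G.IsOptimalDual c (G.dualOf s') ∧ G.IsMinWeightPerfectMatching c (G.matchingOf s') := by
  have hLR : G.nL = G.nR := hM.choose_spec.card_eq
  refine (isPerfectMatching_matchingOf h).optimal_of_tight
    ((isDualFeasible_iff (fun _ => rfl) (fun _ => rfl)).2 h.feasible) fun e he => ?_
  simp only [matchingOf, Finset.mem_filter, Finset.mem_univ, true_and] at he
  have := h.matching.tight ((G.right e : ℕ) : ℤ) (by positivity) (by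
    show _ < (G.nL : ℤ)
    rw [hLR]
    exact_mod_cast (G.right e).2) (by omega)
  rw [he, add_sub_cancel_right, toEdgeList_l, toEdgeList_c] at this
  exact this

lemma edges_le (G : BipGraph) : G.m ≤ G.n ^ 2 := by
  have := Fintype.card_le_of_injective _ G.simple
  simp only [Fintype.card_prod, Fintype.card_fin] at this
  unfold n
  nlinarith

lemma lg_le_log (h3 : 3 ≤ G.n) (hm : 1 ≤ G.m) : (lg (2 * G.m) : ℝ) ≤ 6 * Real.log G.n := by
  have h1 := G.edges_le
  -- a simple graph has at most `n ^ 2` edges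
  have h2 : 2 * G.m ≤ G.n ^ 3 := by nlinarith
  have h4 : 2 ^ Nat.log 2 (2 * G.m) ≤ G.n ^ 3 :=
    (Nat.pow_log_le_self 2 (by omega)).trans h2
  have h5 : (2 : ℝ) ^ Nat.log 2 (2 * G.m) ≤ (G.n : ℝ) ^ 3 := by exact_mod_cast h4
  have h6 := Real.log_le_log (by positivity) h5
  rw [Real.log_pow, Real.log_pow] at h6
  have h7 : lg (2 * G.m) = Nat.log 2 (2 * G.m) := by
    unfold lg
    congr 2
  rw [h7]
  have := Real.log_two_gt_d9
  have h8 : (0 : ℝ) ≤ Nat.log 2 (2 * G.m) := by positivity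
  push_cast at h6 ⊢
  nlinarith

/-- Rounding at most doubles the distance to an integer. -/
lemma abs_round_sub_le (x : ℝ) (y : ℤ) : |((round x - y : ℤ) : ℝ)| ≤ 2 * |x - y| := by
  have h1 := round_le x y
  have h2 := abs_sub_le (round x : ℝ) x y
  rw [abs_sub_comm (round x : ℝ) x] at h2
  push_cast
  linarith

/-- The auction takes time proportional to its price cap `P ≈ √N`, and the augmentations time
proportional to the number `f` of free vertices after the auction.  Since `N ≤ P ^ 2`, the bound on
`P * f` says `f ≤ P + 2 * U`. -/
lemma work_le {N P f : ℤ} {n U : ℝ} (hN : 2 ≤ N) (hn : n = 2 * N) (hP : 1 ≤ P) (hNP : N ≤ P ^ 2)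
    (hPN : (P - 1) ^ 2 < N) (hf : f ≤ N) (hU : 0 ≤ U) (h : (P * f : ℝ) ≤ N + P * (2 * U)) :
    ((P + f : ℤ) : ℝ) ≤ 4 * (√n * min (1 + U) √n) := by
  have hP' : (1 : ℝ) ≤ P := by exact_mod_cast hP
  have hN' : (2 : ℝ) ≤ N := by exact_mod_cast hN
  have hf' : (f : ℝ) ≤ N := by exact_mod_cast hf
  have h1 : ((P - 1 : ℝ)) ^ 2 ≤ N := by exact_mod_cast hPN.le
  have h2 : (N : ℝ) ≤ (P : ℝ) ^ 2 := by exact_mod_cast hNP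
  have hs : √n ^ 2 = n := Real.sq_sqrt (by linarith)
  have hs0 := Real.sqrt_nonneg n
  have hs2 : 2 ≤ √n := Real.le_sqrt_of_sq_le (by nlinarith)
  have h3 : (P : ℝ) - 1 ≤ √n := Real.le_sqrt_of_sq_le (by linarith)
  have h4 : (f : ℝ) ≤ P + 2 * U := by
    have : (P : ℝ) * f ≤ P * (P + 2 * U) := by nlinarith
    exact le_of_mul_le_mul_left this (by linarith)
  push_cast
  rw [mul_min_of_nonneg _ _ hs0, mul_min_of_nonneg _ _ (by norm_num)]
  refine le_min ?_ ?_
  · nlinarith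
  · nlinarith

/-- The prediction-dependent running time of the matching algorithm. -/
theorem exec_matcher (h3 : 3 ≤ G.n) (hm : 1 ≤ G.m) (hM : ∃ M, G.IsPerfectMatching M)
    (c : Fin G.m → ℤ) (x : G.V → ℝ) :
    ∃ (s' : Store) (τ : ℕ), Exec (arrayOf (G.vecList x)) matcher (G.matchingInput c) s' τ ∧
      G.OutputsMatching s' (G.matchingOf s') ∧
      G.IsMinWeightPerfectMatching c (G.matchingOf s') ∧ G.IsOptimalDual c (G.dualOf s') ∧
      ∀ y : G.V → ℤ, G.IsOptimalDual c y →
        (τ : ℝ) ≤ 86400 * (G.m * √(G.n : ℝ) *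
          min (1 + l1Dist x (fun v => (y v : ℝ))) √(G.n : ℝ)) * Real.log G.n ^ 1 := by
  have hLR := hM.choose_spec.card_eq
  have hnL : 2 ≤ G.nL := by unfold n at h3; omega
  have hn : 1 ≤ G.nL := by omega
  obtain ⟨s', τ, hE, hS⟩ := EdgeList.wp_matcher (ξ := arrayOf (G.vecList x))
    (toEdgeList_holds (c := c) (hn := hn) (hM := hM))
    (matchingInput_arr (by norm_num)) (matchingInput_arr (by norm_num))
    (matchingInput_arr (by norm_num)) (matchingInput_arr (by norm_num))
    (matchingInput_arr (by norm_num))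
  obtain ⟨hopt, hmin⟩ := optimal_of_solved hS
  refine ⟨s', τ, hE, outputsMatching_matchingOf hS, hmin, hopt, fun y hy => ?_⟩
  obtain ⟨P, f, hP, hNP, hPN, hf0, hfN, hτ, hPf⟩ := hS.time
  have hy' := (isDualFeasible_iff (hn := hn) (hM := hM)
    (u := arrayOf (List.ofFn fun i => y (Sum.inl i)))
    (v := arrayOf (List.ofFn fun j => y (Sum.inr j))) (arrayOf_ofFn _) (arrayOf_ofFn _)).1 hy.1
  have hsum : ∀ {f g : ℤ → ℤ} {z : G.V → ℤ}, (∀ i : Fin G.nL, f (i : ℕ) = z (Sum.inl i)) →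
      (∀ j : Fin G.nR, g (j : ℕ) = z (Sum.inr j)) →
      ∑ i ∈ Finset.Ico 0 (G.toEdgeList c hn hM).N, f i +
        ∑ j ∈ Finset.Ico 0 (G.toEdgeList c hn hM).N, g j = ∑ v, z v := by
    intro f g z hf hg
    show ∑ i ∈ Finset.Ico 0 (G.nL : ℤ), f i + ∑ j ∈ Finset.Ico 0 (G.nL : ℤ), g j = _
    have hLR' : (G.nL : ℤ) = G.nR := by exact_mod_cast hLR
    rw [Fintype.sum_sum_type, sum_Ico_natCast, hLR', sum_Ico_natCast]
    simp only [hf, hg]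
  have h1 := hPf _ _ hy' (by
    rw [hsum (z := G.dualOf s') (fun _ => rfl) (fun _ => rfl), hsum (z := y) (arrayOf_ofFn _)
      (arrayOf_ofFn _)]
    have := hy.2 _ hopt.1
    exact_mod_cast this)
  have hd : ((G.toEdgeList c hn hM).dist (fun i => round (arrayOf (G.vecList x) i))
      (fun j => round (arrayOf (G.vecList x) ((G.toEdgeList c hn hM).N + j)))
      (arrayOf (List.ofFn fun i => y (Sum.inl i)))
      (arrayOf (List.ofFn fun j => y (Sum.inr j))) : ℝ) ≤
      2 * l1Dist x (fun v => (y v : ℝ)) := by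
    unfold EdgeList.dist
    rw [hsum (z := fun v => |round (x v) - y v|)]
    · unfold l1Dist
      rw [Finset.mul_sum]
      push_cast
      refine Finset.sum_le_sum fun v _ => ?_
      have := abs_round_sub_le (x v) (y v)
      push_cast at this
      exact this
    · intro i
      simp only
      rw [arrayOf_ofFn, arrayOf_natCast, vecList, List.getD_append _ _ _ _ (by simp),
        List.getD_eq_getElem _ _ (by simp)]
      simp
    · intro j
      have : (G.toEdgeList c hn hM).N + ((j : ℕ) : ℤ) = ((G.nL + j : ℕ) : ℤ) := by
        push_cast; rfl
      simp only
      rw [this, arrayOf_ofFn, arrayOf_natCast, vecList, List.getD_append_right _ _ _ _ (by simp)]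
      simp
  have hU : 0 ≤ l1Dist x (fun v => (y v : ℝ)) := Finset.sum_nonneg fun _ _ => abs_nonneg _
  have hNe : (G.toEdgeList c hn hM).N = G.nL := rfl
  have hme : (G.toEdgeList c hn hM).m = G.m := rfl
  rw [hNe] at h1 hNP hPN hfN hd
  rw [hme] at hτ
  have hP' : (0 : ℝ) ≤ P := by exact_mod_cast (by omega : (0 : ℤ) ≤ P)
  have h2 : (P * f : ℝ) ≤ (G.nL : ℤ) + P * (2 * l1Dist x (fun v => (y v : ℝ))) := by
    refine le_trans ?_ (add_le_add le_rfl (mul_le_mul_of_nonneg_left hd hP'))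
    exact_mod_cast h1
  have hw := work_le (n := (G.n : ℝ)) (by exact_mod_cast hnL)
    (by unfold n; rw [← hLR]; push_cast; ring) hP hNP hPN hfN hU h2
  have hlg := lg_le_log h3 hm
  have hτ' : (τ : ℝ) ≤ 3600 * (G.m * lg (2 * G.m)) * ((P + f : ℤ) : ℝ) := by
    have : (τ : ℤ) ≤ 3600 * (G.m * lg (2 * G.m)) * (P + f) := by simpa using hτ
    exact_mod_cast this
  have hm0 : (0 : ℝ) ≤ G.m := by positivity
  have hlg0 : (0 : ℝ) ≤ lg (2 * G.m) := by exact_mod_cast lg_nonneg _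
  generalize (lg (2 * (G.m : ℤ)) : ℝ) = ℓ at *
  have h4 : (0 : ℝ) ≤ ((P + f : ℤ) : ℝ) := by exact_mod_cast (by omega : (0 : ℤ) ≤ P + f)
  generalize ((P + f : ℤ) : ℝ) = W at *
  -- `86400 = 3600 * 6 * 4`
  calc (τ : ℝ) ≤ 3600 * (G.m * ℓ) * W := hτ'
    _ ≤ 3600 * (G.m * (6 * Real.log G.n)) *
        (4 * (√G.n * min (1 + l1Dist x fun v => (y v : ℝ)) √G.n)) := by
      gcongr
    _ = _ := by ring

end BipGraph

/-! ### Online subgradient descent -/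

lemma convex_cube {ι : Type*} (C : ℝ) : Convex ℝ (cube ι C) := by
  intro x hx y hy a b ha hb hab i
  have h1 := abs_le.1 (hx i)
  have h2 := abs_le.1 (hy i)
  simp only [Pi.add_apply, Pi.smul_apply, smul_eq_mul]
  refine abs_le.2 ⟨?_, ?_⟩ <;> nlinarith

section OnlineDescent

variable {ι : Type*} [Fintype ι]

/-- The loss is `1`-Lipschitz in each coordinate. -/
lemma abs_subgradient_le {y x g : ι → ℝ} (h : IsSubgradient (fun z => l1Dist z y) x g) (i : ι) :
    |g i| ≤ 1 := by
  classical
  have key : ∀ δ : ℝ, g i * δ ≤ |δ| := by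
    intro δ
    have h1 := h (Function.update x i (x i + δ))
    have h2 : ∑ j, g j * (Function.update x i (x i + δ) j - x j) = g i * δ := by
      rw [Finset.sum_eq_single i]
      · simp
      · intro j _ hj
        simp [hj]
      · simp
    have h3 : l1Dist (Function.update x i (x i + δ)) y ≤ l1Dist x y + |δ| := by
      have : ∀ j, |Function.update x i (x i + δ) j - y j| ≤
          |x j - y j| + if j = i then |δ| else 0 := by
        intro j
        rcases eq_or_ne j i with rfl | hj
        · simpa [add_sub_right_comm] using abs_add_le (x j - y j) δ
        · simp [hj]
      calc l1Dist (Function.update x i (x i + δ)) y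
          ≤ ∑ j, (|x j - y j| + if j = i then |δ| else 0) := Finset.sum_le_sum fun j _ => this j
        _ = _ := by rw [Finset.sum_add_distrib]; simp [l1Dist]
    simp only at h1
    linarith
  have h1 := key 1
  have h2 := key (-1)
  simp only [abs_neg, abs_one] at h1 h2
  exact abs_le.2 ⟨by linarith, by linarith⟩

/-- The first-order condition at the minimum of the proximal objective. -/
lemma variational_inequality {X : Set (ι → ℝ)} (hX : Convex ℝ X) {η : ℝ} {g x z u : ι → ℝ}
    (hz : z ∈ X) (hmin : IsMinOn (fun z => η * ∑ i, g i * z i + (∑ i, (z i - x i) ^ 2) / 2) X z)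
    (hu : u ∈ X) : 0 ≤ η * ∑ i, g i * (u i - z i) + ∑ i, (z i - x i) * (u i - z i) := by
  set A := η * ∑ i, g i * (u i - z i) + ∑ i, (z i - x i) * (u i - z i) with hA
  set B := ∑ i, (u i - z i) ^ 2 with hB
  have key : ∀ r : ℝ, 0 < r → r ≤ 1 → 0 ≤ A + r * (B / 2) := by
    intro r hr hr1
    have hmem : (1 - r) • z + r • u ∈ X := hX hz hu (by linarith) hr.le (by ring)
    have h := hmin hmem
    simp only [Set.mem_ofPred_eq, Pi.add_apply, Pi.smul_apply, smul_eq_mul] at h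
    have e1 : ∑ i, g i * ((1 - r) * z i + r * u i) =
        ∑ i, g i * z i + r * ∑ i, g i * (u i - z i) := by
      rw [Finset.mul_sum, ← Finset.sum_add_distrib]
      exact Finset.sum_congr rfl fun i _ => by ring
    have e2 : ∑ i, ((1 - r) * z i + r * u i - x i) ^ 2 = ∑ i, (z i - x i) ^ 2 +
        2 * r * ∑ i, (z i - x i) * (u i - z i) + r ^ 2 * B := by
      rw [hB, Finset.mul_sum, Finset.mul_sum, ← Finset.sum_add_distrib, ← Finset.sum_add_distrib]
      exact Finset.sum_congr rfl fun i _ => by ring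
    rw [e1, e2] at h
    have : 0 ≤ r * (A + r * (B / 2)) := by
      rw [hA]
      nlinarith
    exact nonneg_of_mul_nonneg_right this hr
  by_contra hneg
  push Not at hneg
  have hB0 : 0 ≤ B := Finset.sum_nonneg fun i _ => sq_nonneg _
  have h1 := key 1 one_pos le_rfl
  have h2 := key (-A / B) (div_pos (by linarith) (by linarith))
    ((div_le_one (by linarith)).2 (by linarith))
  rw [show -A / B * (B / 2) = -A / 2 by field_simp [show B ≠ 0 by linarith]] at h2
  linarith

/-- One step of the descent moves the iterate towards every point `u` of smaller linearized loss. -/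
lemma ogd_step {X : Set (ι → ℝ)} (hX : Convex ℝ X) {η : ℝ} {g x z u : ι → ℝ}
    (hz : z ∈ X) (hmin : IsMinOn (fun z => η * ∑ i, g i * z i + (∑ i, (z i - x i) ^ 2) / 2) X z)
    (hu : u ∈ X) (hg : ∀ i, |g i| ≤ 1) :
    2 * η * ∑ i, g i * (x i - u i) ≤ ∑ i, (u i - x i) ^ 2 - ∑ i, (u i - z i) ^ 2 +
      η ^ 2 * Fintype.card ι := by
  have h := variational_inequality hX hz hmin hu
  have e : ∑ i, (u i - x i) ^ 2 - ∑ i, (u i - z i) ^ 2 + η ^ 2 * Fintype.card ι -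
      2 * η * ∑ i, g i * (x i - u i) - 2 * (η * ∑ i, g i * (u i - z i) +
        ∑ i, (z i - x i) * (u i - z i)) =
      ∑ i, ((z i - x i + η * g i) ^ 2 + η ^ 2 * (1 - g i ^ 2)) := by
    have : η ^ 2 * (Fintype.card ι : ℝ) = ∑ _i : ι, η ^ 2 := by simp [mul_comm]
    rw [this]
    simp only [Finset.mul_sum, mul_add, ← Finset.sum_sub_distrib, ← Finset.sum_add_distrib]
    exact Finset.sum_congr rfl fun i _ => by ring
  have : 0 ≤ ∑ i, ((z i - x i + η * g i) ^ 2 + η ^ 2 * (1 - g i ^ 2)) := by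
    refine Finset.sum_nonneg fun i _ => ?_
    have := (sq_le_one_iff_abs_le_one _).2 (hg i)
    have := mul_nonneg (sq_nonneg η) (show 0 ≤ 1 - g i ^ 2 by linarith)
    positivity
  linarith

lemma ogd_regret {C η : ℝ} (hη : 0 < η) {y x : ℕ → ι → ℝ}
    (hx : IsOGD (cube ι C) η (fun t z => l1Dist z (y t)) x) {u : ι → ℝ} (hu : u ∈ cube ι C)
    (T : ℕ) : 2 * η * ∑ t ∈ Finset.range T, (l1Dist (x t) (y t) - l1Dist u (y t)) ≤
      Fintype.card ι * C ^ 2 + T * (η ^ 2 * Fintype.card ι) := by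
  have key : 2 * η * ∑ t ∈ Finset.range T, (l1Dist (x t) (y t) - l1Dist u (y t)) ≤
      ∑ i, (u i - x 0 i) ^ 2 - ∑ i, (u i - x T i) ^ 2 + T * (η ^ 2 * Fintype.card ι) := by
    induction T with
    | zero => simp
    | succ T ih =>
      obtain ⟨g, hg, hmem, hmin⟩ := hx.2 T
      have h1 := ogd_step (convex_cube C) hmem hmin hu (abs_subgradient_le hg)
      have h2 := hg u
      simp only at h2
      have e : ∑ i, g i * (u i - x T i) = -∑ i, g i * (x T i - u i) := by
        rw [← Finset.sum_neg_distrib]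
        exact Finset.sum_congr rfl fun i _ => by ring
      rw [e] at h2
      have h3 := mul_le_mul_of_nonneg_left (show l1Dist (x T) (y T) - l1Dist u (y T) ≤
        ∑ i, g i * (x T i - u i) by linarith) (show 0 ≤ 2 * η by linarith)
      rw [Finset.sum_range_succ, mul_add]
      push_cast
      linarith
  have h0 : ∑ i, (u i - x 0 i) ^ 2 ≤ Fintype.card ι * C ^ 2 := by
    rw [hx.1]
    calc ∑ i, (u i - (0 : ι → ℝ) i) ^ 2 ≤ ∑ _i : ι, C ^ 2 := by
          refine Finset.sum_le_sum fun i _ => ?_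
          simpa using sq_le_sq' (abs_le.1 (hu i)).1 (abs_le.1 (hu i)).2
      _ = _ := by simp
  have h1 : 0 ≤ ∑ i, (u i - x T i) ^ 2 := Finset.sum_nonneg fun i _ => sq_nonneg _
  linarith

theorem exists_step_size {C : ℝ} (hC : 0 ≤ C) (T : ℕ) : ∃ η : ℝ, 0 < η ∧ ∀ y x : ℕ → ι → ℝ,
    IsOGD (cube ι C) η (fun t z => l1Dist z (y t)) x → ∀ u ∈ cube ι C,
      ∑ t ∈ Finset.range T, (l1Dist (x t) (y t) - l1Dist u (y t)) ≤
        C * Fintype.card ι * √(2 * (T : ℝ)) := by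
  rcases T.eq_zero_or_pos with rfl | hT
  · exact ⟨1, one_pos, fun y x _ u _ => by simp⟩
  rcases hC.eq_or_lt with rfl | hC'
  · -- the cube is a single point
    refine ⟨1, one_pos, fun y x hx u hu => ?_⟩
    have h0 : ∀ {z : ι → ℝ}, z ∈ cube ι 0 → z = 0 := fun {z} hz =>
      funext fun i => abs_nonpos_iff.1 (hz i)
    have h1 : ∀ t, x t = 0 := by
      rintro (_ | t)
      · exact hx.1
      · obtain ⟨g, -, h, -⟩ := hx.2 t
        exact h0 h
    simp [h0 hu, h1]
  · have hT' : (0 : ℝ) < √T := Real.sqrt_pos.2 (by exact_mod_cast hT)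
    -- this step size balances the two terms of the bound
    refine ⟨C / √T, div_pos hC' hT', fun y x hx u hu => ?_⟩
    have h := ogd_regret (div_pos hC' hT') hx hu T
    have hsq : √(T : ℝ) ^ 2 = T := Real.sq_sqrt (by positivity)
    have e : (T : ℝ) * ((C / √T) ^ 2 * Fintype.card ι) = Fintype.card ι * C ^ 2 := by
      rw [div_pow, hsq]
      field_simp
    rw [e] at h
    set R := ∑ t ∈ Finset.range T, (l1Dist (x t) (y t) - l1Dist u (y t))
    have h2 : R ≤ C * Fintype.card ι * √T := by
      have : C * R ≤ C * (C * Fintype.card ι * √T) := by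
        have h3 := mul_le_mul_of_nonneg_right h hT'.le
        rw [show 2 * (C / √T) * R * √T = 2 * (C * R) by field_simp] at h3
        nlinarith
      exact le_of_mul_le_mul_left this hC'
    refine h2.trans (mul_le_mul_of_nonneg_left (Real.sqrt_le_sqrt ?_) (by positivity))
    have : (0 : ℝ) ≤ T := by positivity
    linarith

end OnlineDescent

lemma BipGraph.card_V (G : BipGraph) : Fintype.card G.V = G.n := by simp [BipGraph.n]

/-! ### The learner -/

/-- A step of online subgradient descent on the line, in integer units of `1 / σ`: from `X` towards
`σ * y`, and back to `[-σ * C, σ * C]`. -/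
def descentStep (C σ X y : ℤ) : ℤ :=
  max (-(σ * C)) (min (σ * C) (if X < σ * y then X + C else if σ * y < X then X - C else X))

/-- The sum of the iterates before each step, for a list of labels. -/
def descentSum (C σ : ℤ) : List ℤ → ℤ → ℤ
  | [], _ => 0
  | y :: ys, X => X + descentSum C σ ys (descentStep C σ X y)

/-- `σ` is the least positive integer with `T ≤ σ ^ 2`. -/
structure IsScale (T σ : ℤ) : Prop where
  pos : 1 ≤ σ
  le : T ≤ σ ^ 2
  lt : σ = 1 ∨ (σ - 1) ^ 2 < T

lemma IsScale.unique {T σ σ' : ℤ} (h : IsScale T σ) (h' : IsScale T σ') : σ = σ' := by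
  rcases lt_trichotomy σ σ' with hlt | rfl | hlt
  · have h1 := h.le
    have h2 := h.pos
    rcases h'.lt with h3 | h3
    · omega
    · nlinarith
  · rfl
  · have h1 := h'.le
    have h2 := h'.pos
    rcases h.lt with h3 | h3
    · omega
    · nlinarith

lemma exists_isScale (T : ℕ) : ∃ σ, IsScale T σ := by
  classical
  have h : ∃ k : ℕ, 1 ≤ k ∧ T ≤ k ^ 2 := ⟨T + 1, by omega, by nlinarith⟩
  refine ⟨(Nat.find h : ℕ), by exact_mod_cast (Nat.find_spec h).1,
    by exact_mod_cast (Nat.find_spec h).2, ?_⟩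
  rcases eq_or_ne (Nat.find h) 1 with h1 | h1
  · left; exact_mod_cast h1
  · right
    have h2 := (Nat.find_spec h).1
    have h3 := Nat.find_min h (m := Nat.find h - 1) (by omega)
    have h4 : ¬ T ≤ (Nat.find h - 1) ^ 2 := fun h5 => h3 ⟨by omega, h5⟩
    obtain ⟨k, hk⟩ : ∃ k, Nat.find h = k + 1 := ⟨Nat.find h - 1, by omega⟩
    rw [hk, Nat.add_sub_cancel, not_le] at h4
    rw [hk]
    push_cast
    rw [add_sub_cancel_right]
    exact_mod_cast h4

lemma IsScale.le_succ {T σ : ℤ} (h : IsScale T σ) (hT : 0 ≤ T) : σ ≤ T + 1 := by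
  rcases h.lt with h1 | h1
  · omega
  · nlinarith [h.pos]

/-- Adds the value of `e` up as often as register `6` says, in register `r`. -/
def timesScale (r : ℕ) (e : Expr) : Prog :=
  .set r (.lit 0) ;; forLoop 9 (.reg 6) (.set r (.reg r + e))

/-- One step of the descent in register `12` for the label at position `14`; register `13` sums up
the iterates. -/
def learnStep : Prog :=
  .set 13 (.reg 13 + .reg 12) ;;
  timesScale 16 (.get 3 (.reg 14)) ;;
  .branch (.reg 12) (.reg 16) (.set 12 (.reg 12 + .reg 3))
    (.branch (.reg 16) (.reg 12) (.set 12 (.reg 12 - .reg 3)) .skip) ;;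
  .branch (.reg 8) (.reg 12) (.set 12 (.reg 8)) .skip ;;
  .branch (.reg 12) (.lit 0 - .reg 8) (.set 12 (.lit 0 - .reg 8)) .skip ;;
  .set 14 (.reg 14 + .reg 5)

/-- Computes the least positive `σ` with `T ≤ σ ^ 2` in register `6`. -/
def computeScale : Prog :=
  .set 6 (.lit 1) ;; .set 7 (.lit 1) ;;
  .loop (.reg 7) (.reg 4) (
    .set 7 (.reg 7 + .reg 6 + .reg 6 + .lit 1) ;;
    .set 6 (.reg 6 + .lit 1))

/-- The learner: online subgradient descent with step size `C / σ` in each coordinate, where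
`σ ≈ √T`, and the average of the iterates as output.  Register `6` holds `σ`, register `8` the bound
`σ * C` of the iterates, and register `10` the common denominator `σ * T` of the output, which is
replaced by `1` if there are no samples. -/
def learner : Prog :=
  .set 5 (.reg 0 + .reg 1) ;;
  computeScale ;;
  timesScale 8 (.reg 3) ;;
  timesScale 10 (.reg 4) ;;
  forLoop 11 (.reg 5) (
    .set 12 (.lit 0) ;; .set 13 (.lit 0) ;; .set 14 (.reg 11) ;;
    forLoop 15 (.reg 4) learnStep ;;
    .put 4 (.reg 11) (.reg 13)) ;;
  .set 0 (.reg 10) ;;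
  .branch (.lit 0) (.reg 0) .skip (.set 0 (.lit 1))

section Learner

variable {ξ : ℤ → ℝ} {s : Store} {t : ℤ} {n C T σ : ℤ}

lemma wp_computeScale (hT : 0 ≤ T) (h4 : s.reg 4 = T) (hσ : IsScale T σ) :
    wp ξ computeScale (fun s' t' => s'.reg 6 = σ ∧ t' ≤ t + 20 * T + 50) s t := by
  rw [computeScale, wp_seq, wp_set, wp_seq, wp_set]
  refine wp_loop (fun s' t' => 1 ≤ s'.reg 6 ∧ s'.reg 7 = s'.reg 6 ^ 2 ∧
    (s'.reg 6 = 1 ∨ (s'.reg 6 - 1) ^ 2 < T) ∧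
    t' ≤ t + 4 + 20 * s'.reg 6) (t + 4 + 20 * (T + 1)) ?_ ?_ ?_ ?_
  · rintro s' t' ⟨h1, h2, h3, h4⟩
    have : s'.reg 6 ≤ T + 1 := by
      rcases h3 with h3 | h3
      · omega
      · nlinarith
    omega
  · simp; omega
  · rintro s' t' ⟨h1, h2, h3, h5⟩ hs hlt
    have e0 : s'.reg 4 = T := by rw [hs.reg 4 rfl]; simpa using h4
    simp [e0] at hlt
    simp
    exact ⟨by omega, by rw [h2]; ring, by omega, by omega⟩
  · rintro s' t' ⟨h1, h2, h3, h5⟩ hs hlt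
    have e0 : s'.reg 4 = T := by rw [hs.reg 4 rfl]; simpa using h4
    simp [e0] at hlt
    have h6 : IsScale T (s'.reg 6) := ⟨h1, by omega, h3⟩
    have h7 := h6.le_succ hT
    exact ⟨h6.unique hσ, by simp; omega⟩

lemma wp_timesScale {r : ℕ} {e : Expr} {k : ℤ} (hr : r ≠ 9) (hr6 : r ≠ 6) (hσ : 1 ≤ σ)
    (h6 : s.reg 6 = σ)
    (he : ∀ s', (timesScale r e).Same s s' → e.eval ξ s' = k) :
    wp ξ (timesScale r e) (fun s' t' => s'.reg r = σ * k ∧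
      t' ≤ t + σ * (e.size + 20) + 10) s t := by
  have hb : ∀ {a b : ℕ}, a ≠ b → (a == b) = false := by intro a b h; simp [h]
  have hsame : ∀ s', (forLoop 9 (.reg 6) (.set r (.reg r + e))).Same (s.setReg r 0) s' →
      (timesScale r e).Same s s' := by
    intro s' hs
    refine ⟨fun q hq => ?_, fun a ha => ?_⟩
    · simp only [timesScale, Prog.writesReg, Bool.or_eq_false_iff] at hq
      rw [hs.reg q hq.2]
      have : q ≠ r := by
        rintro rfl
        simp at hq
      simp [this]
    · rw [hs.arr a (by simp [forLoop, Prog.writesArr])]; simp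
  rw [timesScale, wp_seq, wp_set]
  refine wp_for σ (e.size + 3) (fun i s' => s'.reg r = i * k) (by omega) (by positivity) ?_ ?_ ?_ ?_ ?_
  · simp [hr]
  · intro s' hs
    rw [Expr.eval_reg, hs.reg 6 (by simp [forLoop, Prog.writesReg, hr6.symm])]
    simpa [hr6.symm] using h6
  · simp [Prog.writesReg, hr.symm]
  · intro i s' t' hi hin hJ hik hs
    have := he s' (hsame s' hs)
    simp [hr, this, hJ]
    refine ⟨by ring, by omega⟩
  · intro s' t' hJ _ hs ht
    refine ⟨hJ, ?_⟩
    simp at ht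
    linarith

lemma wp_learnStep {y X A : ℤ} (hC : 0 ≤ C) (hσ : 1 ≤ σ) (h3 : s.reg 3 = C) (h6 : s.reg 6 = σ)
    (h8 : s.reg 8 = σ * C) (hy : s.arr 3 (s.reg 14) = y) (h12 : s.reg 12 = X)
    (h13 : s.reg 13 = A) :
    wp ξ learnStep (fun s' t' => s'.reg 12 = descentStep C σ X y ∧ s'.reg 13 = A + X ∧
      s'.reg 14 = s.reg 14 + s.reg 5 ∧ t' ≤ t + σ * 22 + 60) s t := by
  have hσC : 0 ≤ σ * C := by positivity
  rw [learnStep, wp_seq, wp_set, wp_seq]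
  refine (wp_timesScale (σ := σ) (k := y) (by norm_num) (by norm_num) hσ (by simpa using h6)
    ?_).frame.mono ?_
  · intro s' hs
    simp [hs.arr 3 rfl, hs.reg 14 rfl, hy]
  rintro s₁ t₁ ⟨⟨h16, ht₁⟩, hs₁⟩
  have e12 : s₁.reg 12 = X := by rw [hs₁.reg 12 rfl]; simpa using h12
  have e13 : s₁.reg 13 = A + X := by rw [hs₁.reg 13 rfl]; simp [h12, h13]
  have e14 : s₁.reg 14 = s.reg 14 := by rw [hs₁.reg 14 rfl]; simp
  have e5 : s₁.reg 5 = s.reg 5 := by rw [hs₁.reg 5 rfl]; simp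
  have e3 : s₁.reg 3 = C := by rw [hs₁.reg 3 rfl]; simpa using h3
  have e8 : s₁.reg 8 = σ * C := by rw [hs₁.reg 8 rfl]; simpa using h8
  simp only [Expr.size_get, Expr.size_reg, Expr.size_add] at ht₁
  generalize hz : σ * C = z at *
  generalize hw : σ * y = w at *
  simp [e12, e13, e14, e5, e3, e8, h16, descentStep, hz, hw]
  refine ⟨fun h1 => ⟨fun h2 => ⟨fun h3 => ?_, fun h3 => ?_⟩, fun h2 => ⟨fun h3 => ?_, fun h3 => ?_⟩⟩,
    fun h1 => ⟨fun h1' => ⟨fun h2 => ⟨fun h3 => ?_, fun h3 => ?_⟩, fun h2 =>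
    ⟨fun h3 => ?_, fun h3 => ?_⟩⟩, fun h1' => ⟨fun h2 => ⟨fun h3 => ?_, fun h3 => ?_⟩, fun h2 =>
    ⟨fun h3 => ?_, fun h3 => ?_⟩⟩⟩⟩
  all_goals
    refine ⟨?_, by push_cast at ht₁; linarith⟩
    split_ifs <;> omega

/-- `L p` is the list of the labels of the coordinate `p`. -/
lemma wp_learner {L : ℤ → List ℤ} (hn : 0 ≤ n) (hC : 0 ≤ C) (hT : 0 ≤ T)
    (h01 : s.reg 0 + s.reg 1 = n) (h3 : s.reg 3 = C) (h4 : s.reg 4 = T) (hσ : IsScale T σ)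
    (hlen : ∀ p, ((L p).length : ℤ) = T)
    (hL : ∀ p, 0 ≤ p → p < n → ∀ (k : ℕ) (hk : k < (L p).length), s.arr 3 (p + k * n) = (L p)[k]) :
    wp ξ learner (fun s' t' => s'.reg 0 = (if 0 < σ * T then σ * T else 1) ∧
      (∀ p, 0 ≤ p → p < n → s'.arr 4 p = descentSum C σ (L p) 0) ∧
      t' ≤ t + 1000 * ((n + 1) * (T + 1) * σ)) s t := by
  have hσ1 := hσ.pos
  have hσT := hσ.le_succ hT
  rw [learner, wp_seq, wp_set, wp_seq]
  refine (wp_computeScale hT (by simpa using h4) hσ).frame.mono ?_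
  rintro s₁ t₁ ⟨⟨h6₁, ht₁⟩, hs₁⟩
  have h3₁ : s₁.reg 3 = C := by rw [hs₁.reg 3 rfl]; simpa using h3
  have h4₁ : s₁.reg 4 = T := by rw [hs₁.reg 4 rfl]; simpa using h4
  have h5₁ : s₁.reg 5 = n := by rw [hs₁.reg 5 rfl]; simpa using h01
  rw [wp_seq]
  refine (wp_timesScale (σ := σ) (k := C) (by norm_num) (by norm_num) hσ1 h6₁
    (fun s' hs => by simp [hs.reg 3 rfl, h3₁])).frame.mono ?_
  rintro s₂ t₂ ⟨⟨h8₂, ht₂⟩, hs₂⟩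
  rw [wp_seq]
  refine (wp_timesScale (σ := σ) (k := T) (by norm_num) (by norm_num) hσ1 (by rw [hs₂.reg 6 rfl, h6₁])
    (fun s' hs => by simp [hs.reg 4 rfl, hs₂.reg 4 rfl, h4₁])).frame.mono ?_
  rintro s₃ t₃ ⟨⟨h10₃, ht₃⟩, hs₃⟩
  have a3 : s₃.arr 3 = s.arr 3 := by rw [hs₃.arr 3 rfl, hs₂.arr 3 rfl, hs₁.arr 3 rfl]; rfl
  have e3 : s₃.reg 3 = C := by rw [hs₃.reg 3 rfl, hs₂.reg 3 rfl, h3₁]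
  have e4 : s₃.reg 4 = T := by rw [hs₃.reg 4 rfl, hs₂.reg 4 rfl, h4₁]
  have e5 : s₃.reg 5 = n := by rw [hs₃.reg 5 rfl, hs₂.reg 5 rfl, h5₁]
  have e6 : s₃.reg 6 = σ := by rw [hs₃.reg 6 rfl, hs₂.reg 6 rfl, h6₁]
  have e8 : s₃.reg 8 = σ * C := by rw [hs₃.reg 8 rfl, h8₂]
  rw [wp_seq]
  obtain ⟨κ, hκ⟩ : ∃ κ, κ = T * (σ * 22 + 60 + 7) + 20 := ⟨_, rfl⟩
  have hκ0 : 0 ≤ κ := by rw [hκ]; positivity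
  refine wp_for n κ (fun k s' => ∀ p, 0 ≤ p → p < k → s'.arr 4 p = descentSum C σ (L p) 0) hn hκ0
    (by intros; omega) ?_ rfl ?_ ?_
  · intro s' hs
    simp [hs.reg 5 rfl, e5]
  · intro p s' t' hp hpn hJ hip hs
    have f3 := (hs.reg 3 rfl).trans e3
    have f4 := (hs.reg 4 rfl).trans e4
    have f5 := (hs.reg 5 rfl).trans e5
    have f6 := (hs.reg 6 rfl).trans e6
    have f8 := (hs.reg 8 rfl).trans e8
    have fa : s'.arr 3 = s.arr 3 := (hs.arr 3 rfl).trans a3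
    simp only [wp_seq, wp_set]
    refine wp_for T (σ * 22 + 60) (fun k s₄ => s₄.reg 14 = p + k * n ∧
      s₄.reg 13 + descentSum C σ ((L p).drop k.toNat) (s₄.reg 12) = descentSum C σ (L p) 0)
      hT (by positivity) ?_ ?_ rfl ?_ ?_
    · simp [hip]
    · intro s₄ hs₄
      rw [Expr.eval_reg, hs₄.reg 4 rfl]
      simpa using f4
    · rintro k s₄ t₄ hk hkT ⟨h14, hsum⟩ hik hs₄
      have hk' : k.toNat < (L p).length := by have := hlen p; omega
      have hlab : s₄.arr 3 (s₄.reg 14) = (L p)[k.toNat] := by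
        rw [hs₄.arr 3 rfl, h14, ← hL p hp hpn _ hk']
        simp [fa, hk]
      refine (wp_learnStep (C := C) (σ := σ) hC hσ1 ?_ ?_ ?_ hlab rfl rfl).mono ?_
      · rw [hs₄.reg 3 rfl]; simpa using f3
      · rw [hs₄.reg 6 rfl]; simpa using f6
      · rw [hs₄.reg 8 rfl]; simpa using f8
      rintro s₅ t₅ ⟨g12, g13, g14, ht₅⟩
      have g5 : s₄.reg 5 = n := by rw [hs₄.reg 5 rfl]; simpa using f5
      simp only [Store.reg_setReg]
      refine ⟨⟨?_, ?_⟩, by linarith⟩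
      · simp [g14, g5, h14]; ring
      · rw [List.drop_eq_getElem_cons hk', descentSum] at hsum
        have : (k + 1).toNat = k.toNat + 1 := by omega
        simp [g12, g13, this]
        linarith
    · rintro s₄ t₄ ⟨-, hsum⟩ - hs₄ ht₄
      have g11 : s₄.reg 11 = p := by rw [hs₄.reg 11 rfl]; simpa using hip
      have g4 : s₄.arr 4 = s'.arr 4 := by rw [hs₄.arr 4 rfl]; simp
      rw [List.drop_of_length_le (by have := hlen p; omega), descentSum, add_zero] at hsum
      simp [g11, hsum]
      refine ⟨fun q hq hqp => ?_, ?_⟩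
      · rw [Function.update_apply, g4]
        split_ifs with h
        · rw [h]
        · exact hJ q hq (by omega)
      · simp at ht₄
        rw [hκ]
        linarith
  · intro s' t' hJ _ hs ht'
    have g10 : s'.reg 10 = σ * T := by rw [hs.reg 10 rfl, h10₃]
    simp only [wp_seq, wp_set, wp_branch, wp_skip]
    simp [g10]
    have hfin : t' + 20 ≤ t + 1000 * ((n + 1) * (T + 1) * σ) := by
      simp at ht₁ ht₂ ht₃ ht'
      have k1 : 0 ≤ n * T * σ := by positivity
      have k2 : n ≤ n * σ := by nlinarith
      have k3 : T ≤ T * σ := by nlinarith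
      have k4 : n * T ≤ n * T * σ := by nlinarith [mul_nonneg hn hT]
      rw [hκ] at ht'
      linarith
    refine ⟨fun h => ?_, fun h => ?_⟩
    · exact ⟨by omega, hJ, by linarith⟩
    · exact ⟨by omega, hJ, by linarith⟩

end Learner

/-! ### Learning from independent samples -/

/-- The sum of `f` along the run of a state machine with the transitions `upd` on a list of inputs;
each summand depends on the input and on the state before it is read. -/
def runSum {Z Ω : Type*} (f : Z → Ω → ℝ) (upd : Z → Ω → Z) : List Ω → Z → ℝ
  | [], _ => 0
  | c :: cs, z => f z c + runSum f upd cs (upd z c)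

section RunSum

variable {Z Ω : Type*} {upd : Z → Ω → Z}

lemma runSum_sub (f g : Z → Ω → ℝ) (l : List Ω) (z : Z) :
    runSum (fun z c => f z c - g z c) upd l z = runSum f upd l z - runSum g upd l z := by
  induction l generalizing z with
  | nil => simp [runSum]
  | cons c l ih => simp only [runSum, ih]; ring

lemma runSum_const (a : ℝ) (l : List Ω) (z : Z) :
    runSum (fun _ _ => a) upd l z = l.length * a := by
  induction l generalizing z with
  | nil => simp [runSum]
  | cons c l ih => simp only [runSum, ih, List.length_cons]; push_cast; ring

lemma runSum_const_mul (a : ℝ) (f : Z → Ω → ℝ) (l : List Ω) (z : Z) :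
    runSum (fun z c => a * f z c) upd l z = a * runSum f upd l z := by
  induction l generalizing z with
  | nil => simp [runSum]
  | cons c l ih => simp only [runSum, ih]; ring

variable [MeasurableSpace Ω] {D : Measure Ω}

/-- The expectation of a run with respect to a fresh sample `c`, for fixed inputs of the run. -/
lemma integral_runSum {Ω' : Type*} {f : Ω → Z → ℝ} {upd : Z → Ω' → Z}
    (hf : ∀ z, Integrable (fun c => f c z) D) (l : List Ω') (z : Z) :
    Integrable (fun c => runSum (fun z _ => f c z) upd l z) D ∧
      ∫ c, runSum (fun z _ => f c z) upd l z ∂D =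
        runSum (fun z _ => ∫ c, f c z ∂D) upd l z := by
  induction l generalizing z with
  | nil => simp [runSum]
  | cons c l ih =>
    obtain ⟨h1, h2⟩ := ih (upd z c)
    simp only [runSum]
    exact ⟨(hf z).add h1, by rw [integral_add (hf z) h1, h2]⟩

variable [Countable Ω] [MeasurableSingletonClass Ω] [IsProbabilityMeasure D]

/-- The exponential moments of a run on independent inputs multiply up. -/
lemma lintegral_exp_runSum_le {P : Z → Prop} (hP : ∀ z c, P z → P (upd z c)) {f : Z → Ω → ℝ}
    {K : ENNReal} (hf : ∀ z, P z → ∫⁻ c, ENNReal.ofReal (Real.exp (f z c)) ∂D ≤ K) (T : ℕ) {z : Z}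
    (hz : P z) :
    ∫⁻ S, ENNReal.ofReal (Real.exp (runSum f upd (List.ofFn S) z))
      ∂(Measure.pi fun _ : Fin T => D) ≤ K ^ T := by
  induction T generalizing z with
  | zero => simp [runSum]
  | succ T ih =>
    have hmp := measurePreserving_piFinSuccAbove (fun _ : Fin (T + 1) => D) 0
    set g : Ω × (Fin T → Ω) → ENNReal := fun q => ENNReal.ofReal (Real.exp (f z q.1)) *
      ENNReal.ofReal (Real.exp (runSum f upd (List.ofFn q.2) (upd z q.1))) with hg
    have hgm : Measurable g := measurable_of_countable g
    calc ∫⁻ S, ENNReal.ofReal (Real.exp (runSum f upd (List.ofFn S) z))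
          ∂(Measure.pi fun _ : Fin (T + 1) => D)
        = ∫⁻ S, g (MeasurableEquiv.piFinSuccAbove (fun _ => Ω) 0 S)
          ∂(Measure.pi fun _ : Fin (T + 1) => D) := by
          refine lintegral_congr fun S => ?_
          rw [List.ofFn_succ, runSum, Real.exp_add, ENNReal.ofReal_mul (Real.exp_pos _).le]
          rfl
      _ = ∫⁻ q, g q ∂(D.prod (Measure.pi fun _ : Fin T => D)) := hmp.lintegral_comp hgm
      _ = ∫⁻ c, ∫⁻ S, g (c, S) ∂(Measure.pi fun _ : Fin T => D) ∂D :=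
          lintegral_prod _ hgm.aemeasurable
      _ ≤ ∫⁻ c, ENNReal.ofReal (Real.exp (f z c)) * K ^ T ∂D := by
          refine lintegral_mono fun c => ?_
          simp only [hg]
          rw [lintegral_const_mul _ (measurable_of_countable _)]
          gcongr
          exact ih (hP z c hz)
      _ = (∫⁻ c, ENNReal.ofReal (Real.exp (f z c)) ∂D) * K ^ T :=
          lintegral_mul_const _ (measurable_of_countable _)
      _ ≤ K * K ^ T := by gcongr; exact hf z hz
      _ = K ^ (T + 1) := by ring

/-- Hoeffding's lemma. -/
lemma lintegral_exp_le_of_mem_Icc {X : Ω → ℝ} {a b r : ℝ} (hr : b - a = 2 * r)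
    (hX : ∀ᵐ c ∂D, X c ∈ Set.Icc a b) (h0 : ∫ c, X c ∂D = 0) (q : ℝ) :
    ∫⁻ c, ENNReal.ofReal (Real.exp (q * X c)) ∂D ≤
      ENNReal.ofReal (Real.exp (r ^ 2 * q ^ 2 / 2)) := by
  have h := ProbabilityTheory.hasSubgaussianMGF_of_mem_Icc_of_integral_eq_zero
    (measurable_of_countable X).aemeasurable hX h0
  rw [← ofReal_integral_eq_lintegral_ofReal (h.integrable_exp_mul q)
    (Filter.Eventually.of_forall fun _ => (Real.exp_pos _).le)]
  refine ENNReal.ofReal_le_ofReal ((h.mgf_le q).trans_eq ?_)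
  congr 2
  push_cast
  rw [hr]
  simp only [Real.norm_eq_abs, abs_mul, div_pow, mul_pow, sq_abs]
  norm_num

/-- Azuma's inequality for runs on independent inputs. -/
lemma measure_runSum_gt_le {P : Z → Prop} (hP : ∀ z c, P z → P (upd z c)) {f : Z → Ω → ℝ} {r : ℝ}
    (hr : 0 < r) (hf : ∀ z, P z → ∃ a, ∀ᵐ c ∂D, f z c ∈ Set.Icc (a - r) (a + r))
    (h0 : ∀ z, P z → ∫ c, f z c ∂D = 0) (T : ℕ) {z : Z} (hz : P z) {ε : ℝ} (hε : 0 < ε) :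
    (Measure.pi fun _ : Fin T => D) {S | T * ε < runSum f upd (List.ofFn S) z} ≤
      ENNReal.ofReal (Real.exp (-(T * ε ^ 2 / (2 * r ^ 2)))) := by
  set q := ε / r ^ 2 with hq
  have hq0 : 0 < q := by positivity
  set μ := Measure.pi fun _ : Fin T => D
  have h1 := lintegral_exp_runSum_le (D := D) (upd := upd) hP (f := fun z c => q * f z c)
    (K := ENNReal.ofReal (Real.exp (r ^ 2 * q ^ 2 / 2))) (fun z hz => by
      obtain ⟨a, ha⟩ := hf z hz
      exact lintegral_exp_le_of_mem_Icc (by ring) ha (h0 z hz) q) T hz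
  simp only [runSum_const_mul] at h1
  have h2 := mul_meas_ge_le_lintegral (μ := μ) (measurable_of_countable
    fun S : Fin T → Ω => ENNReal.ofReal (Real.exp (q * runSum f upd (List.ofFn S) z)))
    (ENNReal.ofReal (Real.exp (q * (T * ε))))
  have h3 : μ {S | T * ε < runSum f upd (List.ofFn S) z} ≤
      μ {S | ENNReal.ofReal (Real.exp (q * (T * ε))) ≤
        ENNReal.ofReal (Real.exp (q * runSum f upd (List.ofFn S) z))} := by
    refine measure_mono fun S hS => ?_
    exact ENNReal.ofReal_le_ofReal (Real.exp_le_exp.2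
      (mul_le_mul_of_nonneg_left (le_of_lt hS) hq0.le))
  have h4 : ENNReal.ofReal (Real.exp (q * (T * ε))) *
      μ {S | T * ε < runSum f upd (List.ofFn S) z} ≤
      ENNReal.ofReal (Real.exp (T * (r ^ 2 * q ^ 2 / 2))) := by
    refine (mul_le_mul_right h3 _).trans (h2.trans (h1.trans_eq ?_))
    rw [← ENNReal.ofReal_pow (Real.exp_pos _).le, ← Real.exp_nat_mul]
  have h5 : ENNReal.ofReal (Real.exp (-(T * ε ^ 2 / (2 * r ^ 2)))) =
      ENNReal.ofReal (Real.exp (T * (r ^ 2 * q ^ 2 / 2))) /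
        ENNReal.ofReal (Real.exp (q * (T * ε))) := by
    rw [← ENNReal.ofReal_div_of_pos (Real.exp_pos _), ← Real.exp_sub]
    congr 2
    rw [hq]
    field_simp
    ring
  rw [h5, ENNReal.le_div_iff_mul_le (Or.inl (by simp [Real.exp_pos])) (Or.inl (by simp)), mul_comm]
  exact h4

end RunSum

section DescentRun

variable {ι Ω : Type*} {C σ : ℤ} (Y : Ω → ι → ℤ)

/-- The update of the learner for a sample `c` with label `Y c`. -/
def descentUpdate (C σ : ℤ) (z : ι → ℤ) (c : Ω) (i : ι) : ℤ := descentStep C σ (z i) (Y c i)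

/-- The point that a state of the learner, given in units of `1 / σ`, stands for. -/
noncomputable def descentPoint (σ : ℤ) (z : ι → ℤ) (i : ι) : ℝ := (z i : ℝ) / σ

/-- The output of the learner: the average of the iterates. -/
noncomputable def descentMean (C σ : ℤ) (l : List Ω) (i : ι) : ℝ :=
  (descentSum C σ (l.map fun c => Y c i) 0 : ℝ) / (σ * l.length : ℤ)

variable {Y}

lemma abs_descentStep_le (h : 0 ≤ σ * C) (X y : ℤ) : |descentStep C σ X y| ≤ σ * C := by
  unfold descentStep
  rw [abs_le]
  omega

/-- Moving towards `σ * y` brings the iterate closer to any point `w` whose loss is smaller, and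
clipping moves it no farther away. -/
lemma descentStep_dist {w : ℝ} (hC : 0 ≤ C) (hw : |w| ≤ σ * C) (X y : ℤ) :
    2 * C * (|(X - σ * y : ℝ)| - |w - σ * y|) ≤
      (X - w) ^ 2 - ((descentStep C σ X y : ℤ) - w) ^ 2 + C ^ 2 := by
  obtain ⟨hw1, hw2⟩ := abs_le.1 hw
  have hC' : (0 : ℝ) ≤ C := by exact_mod_cast hC
  set X₁ : ℤ := if X < σ * y then X + C else if σ * y < X then X - C else X with hX₁
  have h1 : ((descentStep C σ X y : ℤ) - w) ^ 2 ≤ (X₁ - w) ^ 2 := by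
    have e : ((descentStep C σ X y : ℤ) : ℝ) =
        max (-(σ * C) : ℝ) (min (σ * C : ℝ) (X₁ : ℝ)) := by
      rw [descentStep, ← hX₁]; push_cast; rfl
    rw [e, sq_le_sq]
    rcases le_total (σ * C : ℝ) X₁ with h | h
    · rw [min_eq_left h, max_eq_right (by linarith), abs_of_nonneg (by linarith),
        abs_of_nonneg (by linarith)]
      linarith
    · rw [min_eq_right h]
      rcases le_total (X₁ : ℝ) (-(σ * C)) with h' | h'
      · rw [max_eq_left h', abs_of_nonpos (by linarith), abs_of_nonpos (by linarith)]
        linarith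
      · rw [max_eq_right h']
  refine le_trans ?_ (add_le_add_left (sub_le_sub_left h1 _) _)
  have h2 := le_abs_self (w - σ * y)
  have h3 := neg_abs_le (w - σ * y)
  rw [hX₁]
  split_ifs with h h'
  · have h4 : (X : ℝ) < σ * y := by exact_mod_cast h
    rw [abs_of_neg (by linarith)]
    push_cast
    nlinarith
  · have h4 : (σ * y : ℝ) < X := by exact_mod_cast h'
    rw [abs_of_pos (by linarith)]
    push_cast
    nlinarith
  · have h4 : (X : ℝ) = σ * y := by
      have : X = σ * y := by omega
      exact_mod_cast this
    rw [h4, sub_self, abs_zero]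
    have := abs_nonneg (w - σ * y)
    nlinarith

variable [Fintype ι] {u : ι → ℝ}

/-- The squared distance to `σ * u` serves as a potential. -/
lemma descent_regret_aux (hC : 0 ≤ C) (hσ : 1 ≤ σ) (hu : u ∈ cube ι (C : ℝ)) (l : List Ω)
    (z : ι → ℤ) :
    2 * C * σ * runSum (fun z c => l1Dist (descentPoint σ z) (fun i => (Y c i : ℝ)) -
      l1Dist u (fun i => (Y c i : ℝ))) (descentUpdate Y C σ) l z ≤
      ∑ i, ((z i : ℝ) - σ * u i) ^ 2 + l.length * (C ^ 2 * Fintype.card ι) := by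
  have hσ' : (0 : ℝ) < σ := by exact_mod_cast (by omega : 0 < σ)
  induction l generalizing z with
  | nil =>
    simp only [runSum, mul_zero, List.length_nil, Nat.cast_zero, zero_mul, add_zero]
    exact Finset.sum_nonneg fun i _ => sq_nonneg _
  | cons c l ih =>
    have h := ih (descentUpdate Y C σ z c)
    have h1 : 2 * C * σ * (l1Dist (descentPoint σ z) (fun i => (Y c i : ℝ)) -
        l1Dist u (fun i => (Y c i : ℝ))) ≤ ∑ i, ((z i : ℝ) - σ * u i) ^ 2 -
        ∑ i, ((descentUpdate Y C σ z c i : ℤ) - σ * u i) ^ 2 + C ^ 2 * Fintype.card ι := by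
      have hsum : ∀ i, 2 * C * σ * (|descentPoint σ z i - Y c i| - |u i - Y c i|) ≤
          ((z i : ℝ) - σ * u i) ^ 2 - ((descentUpdate Y C σ z c i : ℤ) - σ * u i) ^ 2 + C ^ 2 := by
        intro i
        have h2 := descentStep_dist (w := σ * u i) hC (by
          rw [abs_mul, abs_of_pos hσ']
          exact mul_le_mul_of_nonneg_left (hu i) hσ'.le) (z i) (Y c i)
        have e1 : |(z i - σ * Y c i : ℝ)| = σ * |descentPoint σ z i - Y c i| := by
          rw [← abs_of_pos hσ', ← abs_mul, abs_of_pos hσ', descentPoint, mul_sub,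
            mul_div_cancel₀ _ hσ'.ne']
        have e2 : |σ * u i - σ * Y c i| = σ * |u i - Y c i| := by
          rw [← mul_sub, abs_mul, abs_of_pos hσ']
        rw [e1, e2] at h2
        unfold descentUpdate
        linarith
      have := Finset.sum_le_sum fun i (_ : i ∈ Finset.univ) => hsum i
      simp only [← Finset.mul_sum, Finset.sum_sub_distrib, Finset.sum_add_distrib] at this
      simp only [Finset.sum_const, Finset.card_univ, nsmul_eq_mul] at this
      unfold l1Dist
      linarith
    rw [runSum, mul_add, List.length_cons]
    push_cast
    linarith

/-- The regret of the learner. -/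
lemma descent_regret (hC : 0 < C) (hσ : 1 ≤ σ) (hu : u ∈ cube ι (C : ℝ)) (l : List Ω)
    (hl : (l.length : ℤ) ≤ σ ^ 2) :
    runSum (fun z c => l1Dist (descentPoint σ z) (fun i => (Y c i : ℝ)) -
      l1Dist u (fun i => (Y c i : ℝ))) (descentUpdate Y C σ) l 0 ≤ Fintype.card ι * σ * C := by
  have h := descent_regret_aux (Y := Y) hC.le hσ hu l 0
  have hσ' : (0 : ℝ) < σ := by exact_mod_cast (by omega : 0 < σ)
  have hC' : (0 : ℝ) < C := by exact_mod_cast hC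
  have hl' : (l.length : ℝ) ≤ (σ : ℝ) ^ 2 := by exact_mod_cast hl
  have h1 : ∑ i, (((0 : ι → ℤ) i : ℝ) - σ * u i) ^ 2 ≤ Fintype.card ι * (σ * C) ^ 2 := by
    calc ∑ i, (((0 : ι → ℤ) i : ℝ) - σ * u i) ^ 2 ≤ ∑ _i : ι, (σ * C : ℝ) ^ 2 := by
          refine Finset.sum_le_sum fun i _ => ?_
          rw [sq_le_sq, abs_of_pos (mul_pos hσ' hC')]
          simp only [Pi.zero_apply, Int.cast_zero, zero_sub, abs_neg, abs_mul, abs_of_pos hσ']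
          exact mul_le_mul_of_nonneg_left (hu i) hσ'.le
      _ = _ := by simp
  have h2 : (l.length : ℝ) * (C ^ 2 * Fintype.card ι) ≤ σ ^ 2 * (C ^ 2 * Fintype.card ι) :=
    mul_le_mul_of_nonneg_right hl' (by positivity)
  refine le_of_mul_le_mul_left (a := 2 * (C : ℝ) * σ) ?_ (by positivity)
  linarith

/-- Jensen's inequality for the average of the iterates. -/
lemma length_mul_l1Dist_mean_le (hσ : 1 ≤ σ) (l : List Ω) (y : ι → ℝ) :
    l.length * l1Dist (descentMean Y C σ l) y ≤
      runSum (fun z _ => l1Dist (descentPoint σ z) y) (descentUpdate Y C σ) l 0 := by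
  have hσ' : (0 : ℝ) < σ := by exact_mod_cast (by omega : 0 < σ)
  have h : ∀ z : ι → ℤ, ∑ i, |(descentSum C σ (l.map fun c => Y c i) (z i) : ℝ) / σ -
      l.length * y i| ≤ runSum (fun z _ => l1Dist (descentPoint σ z) y) (descentUpdate Y C σ) l z := by
    induction l with
    | nil => intro z; simp [runSum, descentSum]
    | cons c l ih =>
      intro z
      rw [runSum]
      refine le_trans ?_ (add_le_add le_rfl (ih _))
      unfold l1Dist
      rw [← Finset.sum_add_distrib]
      refine Finset.sum_le_sum fun i _ => ?_
      refine le_trans (le_of_eq ?_) (abs_add_le _ _)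
      congr 1
      rw [List.map_cons, descentSum, List.length_cons]
      unfold descentUpdate descentPoint
      push_cast
      ring
  refine le_trans (le_of_eq ?_) (h 0)
  unfold l1Dist
  rw [Finset.mul_sum]
  refine Finset.sum_congr rfl fun i _ => ?_
  rcases l.length.eq_zero_or_pos with h0 | h0
  · rw [List.length_eq_zero_iff] at h0
    simp [h0, descentSum]
  · have h0' : (0 : ℝ) < l.length := by exact_mod_cast h0
    rw [← abs_of_pos h0', ← abs_mul, abs_of_pos h0']
    congr 1
    unfold descentMean
    push_cast
    field_simp
    simp

end DescentRun

lemma descentPoint_mem {ι : Type*} {C σ : ℤ} (hσ : 1 ≤ σ) {z : ι → ℤ} (hz : ∀ i, |z i| ≤ σ * C) :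
    descentPoint σ z ∈ cube ι (C : ℝ) := by
  have hσ' : (0 : ℝ) < σ := by exact_mod_cast (by omega : 0 < σ)
  intro i
  rw [descentPoint, abs_div, abs_of_pos hσ', div_le_iff₀ hσ', mul_comm]
  exact_mod_cast hz i

lemma isCompact_cube {ι : Type*} (C : ℝ) : IsCompact (cube ι C) := by
  have : cube ι C = Set.pi Set.univ fun _ => Set.Icc (-C) C := by
    ext x
    simp only [cube, Set.mem_ofPred_eq, Set.mem_pi, Set.mem_univ, true_imp_iff, Set.mem_Icc, abs_le]
  rw [this]
  exact isCompact_univ_pi fun _ => isCompact_Icc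

section Generalization

variable {ι Ω : Type*} [Fintype ι] [MeasurableSpace Ω] [Countable Ω] [MeasurableSingletonClass Ω]
  {D : Measure Ω} [IsProbabilityMeasure D] {E : Set Ω}

lemma integrable_of_ae_mem_finite (hE : E.Finite) (hD : ∀ᵐ c ∂D, c ∈ E) (f : Ω → ℝ) :
    Integrable f D := by
  obtain ⟨B, hB⟩ := (hE.image fun c => ‖f c‖).bddAbove
  refine Integrable.of_bound (measurable_of_countable f).aestronglyMeasurable B ?_
  filter_upwards [hD] with c hc
  exact hB ⟨c, hc, rfl⟩

lemma l1Dist_triangle (x x' y : ι → ℝ) : l1Dist x y ≤ l1Dist x x' + l1Dist x' y := by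
  unfold l1Dist
  rw [← Finset.sum_add_distrib]
  exact Finset.sum_le_sum fun i _ => abs_sub_le _ _ _

lemma l1Dist_comm (x y : ι → ℝ) : l1Dist x y = l1Dist y x :=
  Finset.sum_congr rfl fun _ _ => abs_sub_comm _ _

lemma l1Dist_le_of_mem_cube {C : ℝ} {x y : ι → ℝ} (hx : x ∈ cube ι C) (hy : y ∈ cube ι C) :
    l1Dist x y ≤ 2 * (C * Fintype.card ι) := by
  calc l1Dist x y ≤ ∑ _i : ι, 2 * C := by
        refine Finset.sum_le_sum fun i _ => (abs_sub (x i) (y i)).trans ?_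
        linarith [hx i, hy i]
    _ = _ := by simp; ring

/-- The expected loss is minimized somewhere in the cube. -/
lemma exists_minimizer (hE : E.Finite) (hD : ∀ᵐ c ∂D, c ∈ E) (Y : Ω → ι → ℝ) {C : ℝ} (hC : 0 ≤ C) :
    ∃ u ∈ cube ι C, ∀ x ∈ cube ι C, ∫ c, l1Dist u (Y c) ∂D ≤ ∫ c, l1Dist x (Y c) ∂D := by
  have hint : ∀ x : ι → ℝ, Integrable (fun c => l1Dist x (Y c)) D :=
    fun x => integrable_of_ae_mem_finite hE hD _
  have hlip : ∀ x x' : ι → ℝ, ∫ c, l1Dist x (Y c) ∂D ≤ l1Dist x x' + ∫ c, l1Dist x' (Y c) ∂D := by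
    intro x x'
    calc ∫ c, l1Dist x (Y c) ∂D ≤ ∫ c, (l1Dist x x' + l1Dist x' (Y c)) ∂D :=
          integral_mono (hint x) ((integrable_const _).add (hint x'))
            fun c => l1Dist_triangle _ _ _
      _ = _ := by rw [integral_add (integrable_const _) (hint x')]; simp
  have hcont : Continuous fun x : ι → ℝ => ∫ c, l1Dist x (Y c) ∂D := by
    refine continuous_iff_continuousAt.2 fun x => ?_
    refine tendsto_iff_norm_sub_tendsto_zero.2 ?_
    refine squeeze_zero (fun _ => norm_nonneg _) (g := fun x' => l1Dist x' x) (fun x' => ?_) ?_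
    · rw [Real.norm_eq_abs, abs_le]
      have h1 := hlip x x'
      have h2 := hlip x' x
      rw [l1Dist_comm x x'] at h1
      exact ⟨by linarith, by linarith⟩
    · have : Continuous fun x' : ι → ℝ => l1Dist x' x := by unfold l1Dist; fun_prop
      have h := this.tendsto x
      rwa [show l1Dist x x = 0 by simp [l1Dist]] at h
  obtain ⟨u, hu, hmin⟩ := (isCompact_cube C).exists_isMinOn ⟨0, fun i => by simpa using hC⟩
    hcont.continuousOn
  exact ⟨u, hu, fun x hx => hmin hx⟩

lemma descentSum_of_zero (σ : ℤ) (l : List ℤ) : descentSum 0 σ l 0 = 0 := by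
  induction l with
  | nil => rfl
  | cons y l ih =>
    have : descentStep 0 σ 0 y = 0 := by
      unfold descentStep
      simp
    rw [descentSum, this, ih]; rfl

/-- The output of the learner is, with high probability, almost as good as the best fixed
prediction: the regret bounds the excess loss on the sample, and Azuma's inequality the difference
between this and the excess of the expected loss. -/
theorem descent_learns (hE : E.Finite) (hD : ∀ᵐ c ∂D, c ∈ E) (Y : Ω → ι → ℤ) {C T : ℕ} {σ : ℤ}
    (hσ : IsScale T σ) (hι : 0 < Fintype.card ι) {ε δ : ℝ} (hε : 0 < ε) (hδ : 0 < δ)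
    (hT : 100 * ((C : ℝ) * Fintype.card ι / ε) ^ 2 * (1 + Real.log (1 / δ)) ≤ T) :
    1 - δ ≤ (Measure.pi fun _ : Fin T => D).real {S | ∀ x ∈ cube ι (C : ℝ),
      ∫ c, l1Dist (descentMean Y C σ (List.ofFn S)) (fun i => (Y c i : ℝ)) ∂D ≤
        ∫ c, l1Dist x (fun i => (Y c i : ℝ)) ∂D + ε} := by
  have hσ1 := hσ.pos
  have hσ' : (0 : ℝ) < σ := by exact_mod_cast (by omega : 0 < σ)
  have hC0 : (0 : ℝ) ≤ C := by positivity
  set μ := Measure.pi fun _ : Fin T => D with hμ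
  rcases lt_or_ge 1 δ with hδ1 | hδ1
  · exact le_trans (by linarith) measureReal_nonneg
  rcases Nat.eq_zero_or_pos C with rfl | hC
  · -- the cube is a single point
    have : {S : Fin T → Ω | ∀ x ∈ cube ι ((0 : ℕ) : ℝ),
      ∫ c, l1Dist (descentMean Y (0 : ℕ) σ (List.ofFn S)) (fun i => (Y c i : ℝ)) ∂D ≤
        ∫ c, l1Dist x (fun i => (Y c i : ℝ)) ∂D + ε} = Set.univ := by
      refine Set.eq_univ_of_forall fun S x hx => ?_
      have h1 : x = 0 := funext fun i => abs_nonpos_iff.1 (by simpa using hx i)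
      have h2 : descentMean Y ((0 : ℕ) : ℤ) σ (List.ofFn S) = 0 := by
        funext i
        simp [descentMean, descentSum_of_zero]
      rw [h1, h2]
      linarith
    rw [this]
    simp
    exact hδ.le
  have hC' : (0 : ℝ) < C := by exact_mod_cast hC
  have hn : (0 : ℝ) < Fintype.card ι := by exact_mod_cast hι
  obtain ⟨n, hn_def⟩ : ∃ n : ℝ, n = ((Fintype.card ι : ℕ) : ℝ) := ⟨_, rfl⟩
  rw [← hn_def] at hn hT
  have hlog : 0 ≤ Real.log (1 / δ) := Real.log_nonneg (by rw [le_div_iff₀ hδ]; linarith)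
  have hq : 0 < (C : ℝ) * n / ε := by positivity
  have hT1 : 100 * ((C : ℝ) * n / ε) ^ 2 ≤ T := by nlinarith [sq_nonneg ((C : ℝ) * n / ε)]
  have hT2 : 100 * ((C : ℝ) * n / ε) ^ 2 * Real.log (1 / δ) ≤ T := by
    nlinarith [sq_nonneg ((C : ℝ) * n / ε)]
  have hTpos : (0 : ℝ) < T := lt_of_lt_of_le (by positivity) hT1
  have hσT : (σ : ℝ) ^ 2 ≤ 4 * T := by
    have hTn : (1 : ℤ) ≤ T := by exact_mod_cast hTpos
    have : σ ^ 2 ≤ 4 * T := by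
      rcases hσ.lt with h | h
      · rw [h]; omega
      · rcases eq_or_ne σ 1 with h1 | h1
        · rw [h1]; omega
        · nlinarith [show 2 ≤ σ by omega]
    exact_mod_cast this
  have hint : ∀ x : ι → ℝ, Integrable (fun c => l1Dist x (fun i => (Y c i : ℝ))) D :=
    fun x => integrable_of_ae_mem_finite hE hD _
  obtain ⟨u, hu, hmin⟩ := exists_minimizer hE hD (fun c i => (Y c i : ℝ)) hC0
  set F : (ι → ℝ) → ℝ := fun x => ∫ c, l1Dist x (fun i => (Y c i : ℝ)) ∂D with hF
  set f : (ι → ℤ) → Ω → ℝ := fun z c => (F (descentPoint σ z) - F u) -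
    (l1Dist (descentPoint σ z) (fun i => (Y c i : ℝ)) - l1Dist u (fun i => (Y c i : ℝ))) with hf
  set P : (ι → ℤ) → Prop := fun z => ∀ i, |z i| ≤ σ * C with hP
  have hz0 : P 0 := fun i => by simp; positivity
  -- the sampling error exceeds `T * (ε / 2)` with probability at most `δ`
  have hbad : μ {S | T * (ε / 2) < runSum f (descentUpdate Y C σ) (List.ofFn S) 0} ≤
      ENNReal.ofReal δ := by
    refine (measure_runSum_gt_le (P := P) (r := 2 * (C * n)) ?_ (by positivity) ?_ ?_ T hz0
      (by positivity)).trans (ENNReal.ofReal_le_ofReal ?_)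
    · exact fun z c _ i => abs_descentStep_le (by positivity) _ _
    · intro z hz
      refine ⟨F (descentPoint σ z) - F u, Filter.Eventually.of_forall fun c => ?_⟩
      have h1 := l1Dist_le_of_mem_cube (descentPoint_mem hσ1 hz) (by simpa using hu)
      have h2 := l1Dist_triangle (descentPoint σ z) u (fun i => (Y c i : ℝ))
      have h3 := l1Dist_triangle u (descentPoint σ z) (fun i => (Y c i : ℝ))
      rw [l1Dist_comm u (descentPoint σ z)] at h3
      rw [← hn_def] at h1
      simp only [Int.cast_natCast] at h1
      exact ⟨by simp only [hf]; linarith, by simp only [hf]; linarith⟩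
    · intro z _
      simp only [hf]
      rw [integral_sub (f := fun _ => F (descentPoint σ z) - F u)
        (g := fun c => l1Dist (descentPoint σ z) (fun i => (Y c i : ℝ)) -
          l1Dist u (fun i => (Y c i : ℝ))) (integrable_const _) ((hint _).sub (hint _)),
        integral_sub (hint _) (hint _)]
      simp [hF]
    · rw [← Real.log_le_log_iff (Real.exp_pos _) hδ, Real.log_exp]
      rw [one_div, Real.log_inv] at hT2
      have e : (T : ℝ) * (ε / 2) ^ 2 / (2 * (2 * (C * n)) ^ 2) =
          T / (32 * ((C : ℝ) * n / ε) ^ 2) := by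
        field_simp
        ring
      rw [e, neg_le, le_div_iff₀ (by positivity)]
      have : 0 ≤ -Real.log δ := by rwa [one_div, Real.log_inv] at hlog
      nlinarith [sq_nonneg ((C : ℝ) * n / ε), mul_nonneg (sq_nonneg ((C : ℝ) * n / ε)) this]
  -- otherwise the output is good
  have hgood : {S : Fin T → Ω | T * (ε / 2) < runSum f (descentUpdate Y C σ) (List.ofFn S) 0}ᶜ ⊆
      {S | ∀ x ∈ cube ι (C : ℝ), F (descentMean Y C σ (List.ofFn S)) ≤ F x + ε} := by
    intro S hS x hx
    simp only [Set.mem_compl_iff, Set.mem_ofPred_eq, not_lt] at hS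
    refine le_trans ?_ (add_le_add_left (hmin x hx) ε)
    have hreg := descent_regret (Y := Y) (C := C) (by exact_mod_cast hC) hσ1
      (by simpa using hu) (List.ofFn S) (by simpa using hσ.le)
    rw [← hn_def] at hreg
    have hjen : T * F (descentMean Y C σ (List.ofFn S)) ≤
        runSum (fun z _ => F (descentPoint σ z)) (descentUpdate Y C σ) (List.ofFn S) 0 := by
      obtain ⟨h1, h2⟩ := integral_runSum (D := D) (upd := descentUpdate Y C σ)
        (f := fun c z => l1Dist (descentPoint σ z) (fun i => (Y c i : ℝ)))
        (fun z => hint _) (List.ofFn S) 0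
      rw [← h2, hF, ← integral_const_mul]
      refine integral_mono ((hint _).const_mul _) h1 fun c => ?_
      have := length_mul_l1Dist_mean_le (Y := Y) (C := C) hσ1 (List.ofFn S)
        (fun i => (Y c i : ℝ))
      rw [List.length_ofFn] at this
      exact this
    rw [hf, runSum_sub (fun z _ => F (descentPoint σ z) - F u),
      runSum_sub (fun z _ => F (descentPoint σ z)) (fun _ _ => F u), runSum_const,
      List.length_ofFn] at hS
    have hσC : n * σ * C ≤ T * (ε / 2) := by
      refine le_of_sq_le_sq ?_ (by positivity)
      have e : (n * σ * C) ^ 2 = (C * n / ε) ^ 2 * ε ^ 2 * σ ^ 2 := by field_simp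
      rw [e]
      have h1 : (C * n / ε) ^ 2 * σ ^ 2 ≤ (T / 100) * (4 * T) :=
        mul_le_mul (by linarith) hσT (by positivity) (by positivity)
      nlinarith [sq_nonneg ε, mul_le_mul_of_nonneg_right h1 (sq_nonneg ε), sq_nonneg ((T : ℝ) * ε)]
    have h5 : T * F (descentMean Y C σ (List.ofFn S)) ≤ T * (F u + ε) := by
      simp only [Int.cast_natCast] at hreg
      linarith
    exact le_of_mul_le_mul_left h5 hTpos
  have hmeas : MeasurableSet {S : Fin T → Ω |
      T * (ε / 2) < runSum f (descentUpdate Y C σ) (List.ofFn S) 0} := (Set.to_countable _).measurableSet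
  have h1 : μ.real {S | T * (ε / 2) < runSum f (descentUpdate Y C σ) (List.ofFn S) 0} ≤ δ :=
    ENNReal.toReal_le_of_le_ofReal hδ.le hbad
  calc 1 - δ ≤ 1 - μ.real {S | T * (ε / 2) < runSum f (descentUpdate Y C σ) (List.ofFn S) 0} := by
        linarith
    _ = μ.real {S | T * (ε / 2) < runSum f (descentUpdate Y C σ) (List.ofFn S) 0}ᶜ :=
        (probReal_compl_eq_one_sub hmeas).symm
    _ ≤ _ := measureReal_mono hgood

end Generalization

/-! ### Learning from labelled samples -/

lemma getD_flatten {α : Type*} {n : ℕ} {L : List (List α)} (hL : ∀ l ∈ L, l.length = n) (t p : ℕ)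
    (hp : p < n) (d : α) : L.flatten.getD (p + t * n) d = (L.getD t []).getD p d := by
  induction L generalizing t with
  | nil => simp
  | cons l L ih =>
    have hl := hL l (by simp)
    have hL' := fun l' h => hL l' (List.mem_cons_of_mem _ h)
    rw [List.flatten_cons]
    cases t with
    | zero => rw [List.getD_append _ _ _ _ (by omega)]; simp
    | succ t =>
      rw [List.getD_append_right _ _ _ _ (by rw [hl]; nlinarith), hl, List.getD_cons_succ,
        ← ih hL' t]
      congr 1
      rw [Nat.succ_mul]
      omega

namespace BipGraph

variable (G : BipGraph)

lemma length_vecList {α : Type*} (x : G.V → α) : (G.vecList x).length = G.n := by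
  simp [vecList, n]

lemma pos_nonneg (v : G.V) : 0 ≤ G.pos v := by
  rcases v with i | j <;> simp only [pos] <;> positivity

lemma pos_lt (v : G.V) : G.pos v < G.n := by
  rcases v with i | j <;> simp only [pos, n] <;> push_cast
  · have := i.2; omega
  · have := j.2; omega

lemma getD_vecList {α : Type*} [Zero α] (x : G.V → α) (v : G.V) :
    (G.vecList x).getD (G.pos v).toNat 0 = x v := by
  rcases v with i | j
  · have : (G.pos (Sum.inl i)).toNat = i := by simp [pos]
    rw [this, vecList, List.getD_append _ _ _ _ (by simp), List.getD_eq_getElem _ _ (by simp)]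
    simp
  · have : (G.pos (Sum.inr j)).toNat = G.nL + j := by simp only [pos]; omega
    rw [this, vecList, List.getD_append_right _ _ _ _ (by simp)]
    simp

lemma exists_pos_eq {p : ℤ} (h : 0 ≤ p) (h' : p < G.n) : ∃ v, G.pos v = p := by
  unfold n at h'
  rcases lt_or_ge p G.nL with h1 | h1
  · obtain ⟨i, hi⟩ := exists_fin_of_int h h1
    exact ⟨Sum.inl i, hi⟩
  · obtain ⟨j, hj⟩ := exists_fin_of_int (n := G.nR) (i := p - G.nL) (by omega) (by omega)
    exact ⟨Sum.inr j, by simp only [pos]; omega⟩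

/-- The contents of the memory when the learner has halted on the samples `S`. -/
structure Learned (xstar : (Fin G.m → ℤ) → G.V → ℤ) (C T : ℕ) (σ : ℤ) (S : Fin T → Fin G.m → ℤ)
    (s : Store) : Prop where
  denominator : s.reg 0 = if 0 < σ * T then σ * T else 1
  numerator : ∀ v, s.arr 4 (G.pos v) = descentSum C σ ((List.ofFn S).map fun c => xstar c v) 0

variable {G} {xstar : (Fin G.m → ℤ) → G.V → ℤ} {C T : ℕ} {σ : ℤ}

lemma wp_learner_of_labels {ξ : ℤ → ℝ} {s : Store} {t : ℤ} {S : Fin T → Fin G.m → ℤ}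
    (hσ : IsScale T σ) (h0 : s.reg 0 = G.nL) (h1 : s.reg 1 = G.nR) (h3 : s.reg 3 = C)
    (h4 : s.reg 4 = T)
    (hy : ∀ (k : Fin T) v, s.arr 3 (G.pos v + ((k : ℕ) : ℤ) * G.n) = xstar (S k) v) :
    wp ξ learner (fun s' t' => G.Learned xstar C T σ S s' ∧
      t' ≤ t + 1000 * ((G.n + 1) * (T + 1) * σ)) s t := by
  refine (wp_learner (n := G.n) (C := C) (T := T) (σ := σ)
    (L := fun p => (List.ofFn S).map fun c => (G.vecList (xstar c)).getD p.toNat 0)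
    (by positivity) (by positivity) (by positivity) (by rw [h0, h1]; unfold n; push_cast; rfl) h3 h4
    hσ (by simp) ?_).mono ?_
  · intro p hp hpn k hk
    obtain ⟨v, rfl⟩ := G.exists_pos_eq hp hpn
    have hk' : k < T := by simpa using hk
    simp only [List.getElem_map, List.getElem_ofFn, getD_vecList]
    exact hy ⟨k, hk'⟩ v
  · rintro s' t' ⟨h5, h6, h7⟩
    refine ⟨⟨h5, fun v => ?_⟩, h7⟩
    rw [h6 _ (G.pos_nonneg v) (G.pos_lt v)]
    simp only [getD_vecList]

/-- The guarantee of the learner depends only on what it leaves in the memory, and not on how it gets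
hold of the labels. -/
lemma learnsDuals_of_exec {L : Prog} {Kt : ℝ} {k : ℕ}
    {input : (Fin T → Fin G.m → ℤ) → Store} (hn : 1 ≤ G.n) (hσ : IsScale T σ)
    (h : ∀ S : Fin T → Fin G.m → ℤ, ∃ (s' : Store) (τ : ℕ), Exec (fun _ => 0) L (input S) s' τ ∧
      G.Learned xstar C T σ S s' ∧ (τ : ℝ) ≤ Kt * ((G.n : ℝ) + G.m + T) ^ k) :
    G.LearnsDuals L Kt k 100 xstar C T input := by
  refine ⟨fun S => descentMean xstar C σ (List.ofFn S), fun S _ => ?_, ?_⟩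
  · obtain ⟨s', τ, hE, hL, hτ⟩ := h S
    refine ⟨s', τ, hE, ⟨?_, fun v => ?_⟩, hτ⟩
    · rw [hL.denominator]
      split_ifs with h
      · exact h
      · norm_num
    · show descentMean xstar C σ (List.ofFn S) v = _
      unfold descentMean
      rw [hL.denominator, hL.numerator, List.length_ofFn]
      split_ifs with h
      · rfl
      · have hT : T = 0 := by
          by_contra hT
          exact h (mul_pos (by linarith [hσ.pos]) (by exact_mod_cast Nat.pos_of_ne_zero hT))
        subst hT
        simp [descentSum]
  · intro ε δ hε hδ hT D hD hDC
    have hfin : {c : Fin G.m → ℤ | ∀ e, |c e| ≤ (C : ℤ)}.Finite := by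
      refine (Set.Finite.pi' (t := fun _ : Fin G.m => Set.Icc (-(C : ℤ)) C)
        fun _ => Set.finite_Icc _ _).subset ?_
      intro c hc e
      exact abs_le.1 (hc e)
    rw [← G.card_V] at hT hn
    exact descent_learns hfin hDC xstar hσ hn hε hδ hT

theorem learner_learns (h3 : 3 ≤ G.n) (hm : 1 ≤ G.m) (xstar : (Fin G.m → ℤ) → G.V → ℤ) (C T : ℕ) :
    G.LearnsDuals learner 1000 3 100 xstar C T
      (fun S => G.labelledInput C S (fun t => xstar (S t))) := by
  obtain ⟨σ, hσ⟩ := exists_isScale T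
  refine learnsDuals_of_exec (by omega) hσ fun S => ?_
  obtain ⟨s', τ, hE, hL, hτ⟩ := wp_learner_of_labels (ξ := fun _ => 0) (t := 0) (S := S) (C := C)
    (xstar := xstar) (s := G.labelledInput C S (fun t => xstar (S t))) hσ rfl rfl rfl rfl
    fun k v => by
      have hcast : G.pos v + ((k : ℕ) : ℤ) * G.n = (((G.pos v).toNat + k * G.n : ℕ) : ℤ) := by
        have := G.pos_nonneg v
        push_cast
        omega
      have h3 := G.pos_lt v
      show arrayOf (List.ofFn fun t => G.vecList (xstar (S t))).flatten _ = _
      rw [hcast, arrayOf_natCast, getD_flatten (n := G.n) _ _ _ (by omega),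
        show (List.ofFn fun t => G.vecList (xstar (S t))).getD k [] = G.vecList (xstar (S k)) by
          rw [List.getD_eq_getElem _ _ (by simp), List.getElem_ofFn], getD_vecList]
      intro l hl
      obtain ⟨t, rfl⟩ := List.mem_ofFn.1 hl
      exact G.length_vecList _
  refine ⟨s', τ, hE, hL, ?_⟩
  have hσT := hσ.le_succ (by positivity)
  have h1 : (τ : ℝ) ≤ 1000 * ((G.n + 1) * (T + 1) * σ) := by
    have : (τ : ℤ) ≤ 1000 * ((G.n + 1) * (T + 1) * σ) := by simpa using hτ
    exact_mod_cast this
  have h2 : (σ : ℝ) ≤ T + 1 := by exact_mod_cast hσT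
  have hm' : (1 : ℝ) ≤ G.m := by exact_mod_cast hm
  have hT' : (0 : ℝ) ≤ T := by positivity
  have hn' : (0 : ℝ) ≤ G.n := by positivity
  have hσ0 : (0 : ℝ) ≤ σ := by exact_mod_cast (by linarith [hσ.pos] : 0 ≤ σ)
  refine h1.trans (mul_le_mul_of_nonneg_left ?_ (by norm_num))
  rw [pow_succ, pow_succ, pow_one]
  exact mul_le_mul (mul_le_mul (by linarith) (by linarith) (by positivity) (by positivity))
    (by linarith) hσ0 (by positivity)

end BipGraph

/-! ### Running a program repeatedly in a clean memory -/

/-- The expression mentions only registers and arrays below `k`. -/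
def Expr.usesBelow (k : ℕ) : Expr → Bool
  | .lit _ => true
  | .reg r => decide (r < k)
  | .get a i => decide (a < k) && i.usesBelow k
  | .round i => i.usesBelow k
  | .add e f => e.usesBelow k && f.usesBelow k
  | .sub e f => e.usesBelow k && f.usesBelow k

/-- The program mentions only registers and arrays below `k`. -/
def Prog.usesBelow (k : ℕ) : Prog → Bool
  | .skip => true
  | .set r e => decide (r < k) && e.usesBelow k
  | .put a i e => decide (a < k) && i.usesBelow k && e.usesBelow k
  | .seq p q => p.usesBelow k && q.usesBelow k
  | .branch e f p q => e.usesBelow k && f.usesBelow k && p.usesBelow k && q.usesBelow k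
  | .loop e f p => e.usesBelow k && f.usesBelow k && p.usesBelow k

/-- The program, changed such that array `k` records the indices of all cells to which it writes;
register `k` counts these records. -/
def Prog.logged (k : ℕ) : Prog → Prog
  | .skip => .skip
  | .set r e => .set r e
  | .put a i e => .put k (.reg k) i ;; .set k (.reg k + .lit 1) ;; .put a i e
  | .seq p q => .seq (p.logged k) (q.logged k)
  | .branch e f p q => .branch e f (p.logged k) (q.logged k)
  | .loop e f p => .loop e f (p.logged k)

/-- The stores agree on the registers and arrays below `k`. -/
structure Store.Agree (k : ℕ) (s σ : Store) : Prop where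
  reg : ∀ r, r < k → σ.reg r = s.reg r
  arr : ∀ a, a < k → σ.arr a = s.arr a

/-- Between `σ` and `σ'`, the indices of all cells that differ between `s` and `s'` have been
recorded. -/
structure Store.Log (k : ℕ) (s s' σ σ' : Store) (τ : ℕ) : Prop where
  le : σ.reg k ≤ σ'.reg k
  le_add : σ'.reg k ≤ σ.reg k + τ
  keep : ∀ q, q < σ.reg k → σ'.arr k q = σ.arr k q
  log : ∀ a i, s'.arr a i ≠ s.arr a i → ∃ q, σ.reg k ≤ q ∧ q < σ'.reg k ∧ σ'.arr k q = i

section Logged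

variable {ξ : ℤ → ℝ} {k : ℕ} {s s' s'' σ σ' σ'' : Store} {τ τ' : ℕ} {p : Prog}

lemma Store.Agree.eval (h : s.Agree k σ) {e : Expr} (he : e.usesBelow k = true) :
    e.eval ξ σ = e.eval ξ s := by
  induction e with
  | lit => rfl
  | reg r => exact h.reg r (by simpa [Expr.usesBelow] using he)
  | get a i ih =>
    simp only [Expr.usesBelow, Bool.and_eq_true, decide_eq_true_eq] at he
    simp only [Expr.eval, ih he.2, h.arr a he.1]
  | round i ih => simp only [Expr.eval, ih he]
  | add e f ih₁ ih₂ =>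
    simp only [Expr.usesBelow, Bool.and_eq_true] at he
    simp only [Expr.eval, ih₁ he.1, ih₂ he.2]
  | sub e f ih₁ ih₂ =>
    simp only [Expr.usesBelow, Bool.and_eq_true] at he
    simp only [Expr.eval, ih₁ he.1, ih₂ he.2]

lemma Store.Log.refl (s σ : Store) (τ : ℕ) : Store.Log k s s σ σ τ :=
  ⟨le_rfl, by simp, fun _ _ => rfl, fun _ _ h => absurd rfl h⟩

lemma Store.Log.trans (h : Store.Log k s s' σ σ' τ) (h' : Store.Log k s' s'' σ' σ'' τ') :
    Store.Log k s s'' σ σ'' (τ + τ') := by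
  refine ⟨h.le.trans h'.le, by have := h.le_add; have := h'.le_add; push_cast; omega,
    fun q hq => (h'.keep q (hq.trans_le h.le)).trans (h.keep q hq), fun a i hne => ?_⟩
  by_cases h1 : s'.arr a i = s.arr a i
  · obtain ⟨q, h2, h3, h4⟩ := h'.log a i (by rwa [h1])
    exact ⟨q, h.le.trans h2, h3, h4⟩
  · obtain ⟨q, h2, h3, h4⟩ := h.log a i h1
    exact ⟨q, h2, h3.trans_le h'.le, by rw [h'.keep q h3, h4]⟩

lemma Store.Log.mono (h : Store.Log k s s' σ σ' τ) (hτ : τ ≤ τ') : Store.Log k s s' σ σ' τ' :=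
  { h with le_add := h.le_add.trans (by omega) }

lemma Expr.one_le_size (e : Expr) : 1 ≤ e.size := by cases e <;> simp [Expr.size]

/-- The recording program does the same as the original one, in any store that agrees with the
original one on the registers and arrays that this program knows. -/
lemma Exec.logged (h : Exec ξ p s s' τ) (hp : p.usesBelow k = true) (hσ : s.Agree k σ) :
    ∃ σ' τ', Exec ξ (p.logged k) σ σ' τ' ∧ s'.Agree k σ' ∧ Store.Log k s s' σ σ' τ ∧ τ' ≤ 4 * τ := by
  induction h generalizing σ with
  | skip s => exact ⟨σ, 1, .skip _, hσ, .refl _ _ _, by omega⟩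
  | set r e s =>
    simp only [Prog.usesBelow, Bool.and_eq_true, decide_eq_true_eq] at hp
    refine ⟨_, _, .set r e σ, ⟨fun r' hr' => ?_, hσ.arr⟩,
      ⟨?_, ?_, fun _ _ => rfl, fun _ _ h => absurd rfl h⟩, by omega⟩
    · simp only [hσ.eval hp.2, Function.update_apply]
      split_ifs
      · rfl
      · exact hσ.reg r' hr'
    · simp [show k ≠ r by omega]
    · simp [show k ≠ r by omega]
      positivity
  | put a i e s =>
    simp only [Prog.usesBelow, Bool.and_eq_true, decide_eq_true_eq] at hp
    obtain ⟨⟨ha, hi⟩, he⟩ := hp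
    have hi1 := i.one_le_size
    have he1 := e.one_le_size
    set σ₁ := σ.putArr k (σ.reg k) (i.eval ξ σ) with hσ₁
    set σ₂ := σ₁.setReg k (σ.reg k + 1) with hσ₂
    have hag : s.Agree k σ₂ :=
      ⟨fun r hr => by simp [hσ₂, hσ₁, hr.ne, hσ.reg r hr],
        fun b hb => by simp [hσ₂, hσ₁, hb.ne, hσ.arr b hb]⟩
    refine ⟨_, _, .seq (.put k (.reg k) i σ) (.seq (.set k (.reg k + .lit 1) σ₁) (.put a i e σ₂)),
      ⟨hag.reg, fun b hb => ?_⟩, ⟨?_, ?_, fun q hq => ?_, fun b j hne => ?_⟩, ?_⟩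
    · simp only [hag.eval hi, hag.eval he, Function.update_apply]
      split_ifs
      · rw [hag.arr a ha]
      · exact hag.arr b hb
    · simp [hσ₂]
    · simp [hσ₂]
      omega
    · simp [ha.ne', hσ₂, hσ₁, hq.ne]
    · have hj : j = i.eval ξ s := by
        by_contra hne'
        refine hne ?_
        simp only [Function.update_apply]
        split_ifs with h1
        · rw [h1]
          exact Function.update_of_ne hne' _ _
        · rfl
      exact ⟨σ.reg k, le_rfl, by simp [hσ₂], by simp [ha.ne', hσ₂, hσ₁, hj, hσ.eval hi]⟩
    · simp
      omega
  | seq _ _ ih₁ ih₂ =>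
    simp only [Prog.usesBelow, Bool.and_eq_true] at hp
    obtain ⟨σ₁, τ₁, h1, h2, h3, h4⟩ := ih₁ hp.1 hσ
    obtain ⟨σ₂, τ₂, k1, k2, k3, k4⟩ := ih₂ hp.2 h2
    exact ⟨σ₂, _, .seq h1 k1, k2, h3.trans k3, by omega⟩
  | branch_true hc _ ih =>
    simp only [Prog.usesBelow, Bool.and_eq_true] at hp
    obtain ⟨σ₁, τ₁, h1, h2, h3, h4⟩ := ih hp.1.2 hσ
    exact ⟨σ₁, _, .branch_true (by rwa [hσ.eval hp.1.1.1, hσ.eval hp.1.1.2]) h1, h2,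
      h3.mono (by omega), by omega⟩
  | branch_false hc _ ih =>
    simp only [Prog.usesBelow, Bool.and_eq_true] at hp
    obtain ⟨σ₁, τ₁, h1, h2, h3, h4⟩ := ih hp.2 hσ
    exact ⟨σ₁, _, .branch_false (by rwa [hσ.eval hp.1.1.1, hσ.eval hp.1.1.2]) h1, h2,
      h3.mono (by omega), by omega⟩
  | loop_done hc =>
    simp only [Prog.usesBelow, Bool.and_eq_true] at hp
    exact ⟨σ, _, .loop_done (by rwa [hσ.eval hp.1.1, hσ.eval hp.1.2]), hσ, .refl _ _ _, by omega⟩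
  | loop_step hc _ _ ih₁ ih₂ =>
    have hp' := hp
    simp only [Prog.usesBelow, Bool.and_eq_true] at hp
    obtain ⟨σ₁, τ₁, h1, h2, h3, h4⟩ := ih₁ hp.2 hσ
    obtain ⟨σ₂, τ₂, k1, k2, k3, k4⟩ := ih₂ hp' h2
    exact ⟨σ₂, _, .loop_step (by rwa [hσ.eval hp.1.1, hσ.eval hp.1.2]) h1 k1, k2,
      (h3.trans k3).mono (by omega), by omega⟩

end Logged

/-- Sets the listed registers to zero. -/
def clearRegs : List ℕ → Prog
  | [] => .skip
  | r :: l => .set r (.lit 0) ;; clearRegs l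

/-- Sets the cell whose index is in cell `26` of array `21`, in all of the listed arrays, to
zero. -/
def clearCells : List ℕ → Prog
  | [] => .skip
  | a :: l => .put a (.get 21 (.reg 26)) (.lit 0) ;; clearCells l

section Clear

variable {ξ : ℤ → ℝ} {s : Store} {t : ℤ}

lemma wp_clearRegs (l : List ℕ) :
    wp ξ (clearRegs l) (fun s' t' => (∀ r, s'.reg r = if r ∈ l then 0 else s.reg r) ∧
      s'.arr = s.arr ∧ t' = t + 2 * l.length + 1) s t := by
  induction l generalizing s t with
  | nil => simp [clearRegs]
  | cons r l ih =>
    rw [clearRegs, wp_seq, wp_set]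
    refine ih.mono ?_
    rintro s' t' ⟨h1, h2, h3⟩
    refine ⟨fun r' => ?_, h2, ?_⟩
    · rw [h1]
      by_cases h4 : r' ∈ l <;> by_cases h5 : r' = r <;> simp [h4, h5]
    · rw [h3]
      simp
      ring

lemma wp_clearCells (l : List ℕ) (hl : 21 ∉ l) :
    wp ξ (clearCells l) (fun s' t' => s'.reg = s.reg ∧ (∀ a i, s'.arr a i =
      if a ∈ l ∧ i = s.arr 21 (s.reg 26) then 0 else s.arr a i) ∧
      t' = t + 4 * l.length + 1) s t := by
  induction l generalizing s t with
  | nil => simp [clearCells]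
  | cons a l ih =>
    simp only [List.mem_cons, not_or] at hl
    rw [clearCells, wp_seq, wp_put]
    refine (ih hl.2).mono ?_
    rintro s' t' ⟨h1, h2, h3⟩
    refine ⟨h1, fun b i => ?_, ?_⟩
    · rw [h2]
      simp only [Expr.eval_get, Expr.eval_reg, Expr.eval_lit, Store.reg_putArr, Store.arr_putArr,
        hl.1, if_false]
      by_cases h4 : b ∈ l <;> by_cases h5 : b = a <;> by_cases h6 : i = s.arr 21 (s.reg 26) <;>
        simp [h4, h5, h6]
    · rw [h3]
      simp
      ring

end Clear

/-! ### Learning without labels -/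

/-- Computes the total number of costs in register `27` and moves all costs from array `2` to array
`22`. -/
def moveCosts : Prog :=
  .set 27 (.lit 0) ;;
  forLoop 25 (.reg 23) (.set 27 (.reg 27 + .reg 2)) ;;
  forLoop 26 (.reg 27) (.put 22 (.reg 26) (.get 2 (.reg 26)) ;; .put 2 (.reg 26) (.lit 0))

/-- The registers, other than the input, and the arrays that the matching algorithm uses. -/
def matcherMemory : List ℕ := List.range' 3 18

lemma mem_matcherMemory {r : ℕ} : r ∈ matcherMemory ↔ 3 ≤ r ∧ r < 21 := by
  rw [matcherMemory, List.mem_range'_1]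

/-- Loads the cost vector at position `27` of array `22`, runs the matching algorithm in a clean
memory, writes the dual vector to position `28` of array `23`, and cleans the arrays.  The matching algorithm relies on
zeros in its arrays; only the cells to which it has written are reset, so that cleaning does not take
longer than the run. -/
def labelSample : Prog :=
  forLoop 26 (.reg 2) (.put 2 (.reg 26) (.get 22 (.reg 27)) ;; .set 27 (.reg 27 + .lit 1)) ;;
  clearRegs matcherMemory ;;
  .set 21 (.lit 0) ;;
  matcher.logged 21 ;;
  forLoop 26 (.reg 0) (.put 23 (.reg 28) (.get 5 (.reg 26)) ;; .set 28 (.reg 28 + .lit 1)) ;;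
  forLoop 26 (.reg 1) (.put 23 (.reg 28) (.get 6 (.reg 26)) ;; .set 28 (.reg 28 + .lit 1)) ;;
  forLoop 26 (.reg 21) (clearCells matcherMemory)

/-- The learner that computes the labels itself, by running the matching algorithm on each sample.
The samples, the labels, `C` and `T` are kept in memory that the matching algorithm does not use. -/
def costLearner : Prog :=
  .set 22 (.reg 3) ;; .set 23 (.reg 4) ;;
  moveCosts ;;
  .set 27 (.lit 0) ;; .set 28 (.lit 0) ;;
  forLoop 25 (.reg 23) labelSample ;;
  forLoop 26 (.reg 28) (.put 3 (.reg 26) (.get 23 (.reg 26))) ;;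
  .set 3 (.reg 22) ;; .set 4 (.reg 23) ;;
  learner

namespace BipGraph

variable {G : BipGraph} {c : Fin G.m → ℤ}

lemma vecList_zero (G : BipGraph) : arrayOf (G.vecList (0 : G.V → ℝ)) = fun _ => 0 := by
  funext i
  unfold arrayOf
  split_ifs with h
  · by_cases h' : i < G.n
    · obtain ⟨v, rfl⟩ := G.exists_pos_eq h h'
      rw [getD_vecList]; rfl
    · rw [List.getD_eq_default]
      rw [length_vecList]
      omega
  · rfl

/-- The running time of the matching algorithm without a useful prediction. -/
lemma exec_matcher_zero (h3 : 3 ≤ G.n) (hm : 1 ≤ G.m) (hM : ∃ M, G.IsPerfectMatching M)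
    (c : Fin G.m → ℤ) : ∃ (s' : Store) (τ : ℕ), Exec (fun _ => 0) matcher (G.matchingInput c) s' τ ∧
      G.IsOptimalDual c (G.dualOf s') ∧ τ ≤ 86400 * (G.m * G.n ^ 2) := by
  obtain ⟨s', τ, hE, -, -, hopt, hτ⟩ := exec_matcher h3 hm hM c 0
  rw [vecList_zero] at hE
  refine ⟨s', τ, hE, hopt, ?_⟩
  have h1 := hτ _ hopt
  have h4 : Real.log G.n ≤ G.n := (Real.log_le_sub_one_of_pos (by positivity)).trans (by linarith)
  have h5 : √(G.n : ℝ) * √(G.n : ℝ) = G.n := Real.mul_self_sqrt (by positivity)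
  have h6 := min_le_right (1 + l1Dist (0 : G.V → ℝ) (fun v => (G.dualOf s' v : ℝ))) √(G.n : ℝ)
  have h7 : 0 ≤ Real.log G.n := Real.log_nonneg (by exact_mod_cast (by omega : 1 ≤ G.n))
  have h8 : (τ : ℝ) ≤ 86400 * (G.m * G.n ^ 2) :=
    calc (τ : ℝ) ≤ _ := h1
      _ ≤ 86400 * (G.m * √(G.n : ℝ) * √(G.n : ℝ)) * (G.n : ℝ) := by
          rw [pow_one]; gcongr
      _ = _ := by rw [mul_assoc (G.m : ℝ), h5]; ring
  exact_mod_cast h8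

open Classical in
/-- The optimal dual vector that the matching algorithm finds without a useful prediction, i.e. a
fixed choice of an optimal dual vector for each cost vector. -/
noncomputable def matcherDual (G : BipGraph) (c : Fin G.m → ℤ) : G.V → ℤ :=
  if h : 3 ≤ G.n ∧ 1 ≤ G.m ∧ ∃ M, G.IsPerfectMatching M then
    G.dualOf (exec_matcher_zero h.1 h.2.1 h.2.2 c).choose else 0

lemma exec_matcherDual (h3 : 3 ≤ G.n) (hm : 1 ≤ G.m) (hM : ∃ M, G.IsPerfectMatching M)
    (c : Fin G.m → ℤ) : ∃ (s' : Store) (τ : ℕ), Exec (fun _ => 0) matcher (G.matchingInput c) s' τ ∧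
      G.dualOf s' = G.matcherDual c ∧ τ ≤ 86400 * (G.m * G.n ^ 2) := by
  obtain ⟨τ, h1, -, h2⟩ := (exec_matcher_zero h3 hm hM c).choose_spec
  exact ⟨_, τ, h1, by rw [matcherDual, dif_pos ⟨h3, hm, hM⟩], h2⟩

lemma isOptimalDual_matcherDual (h3 : 3 ≤ G.n) (hm : 1 ≤ G.m) (hM : ∃ M, G.IsPerfectMatching M)
    (c : Fin G.m → ℤ) : G.IsOptimalDual c (G.matcherDual c) := by
  obtain ⟨τ, h1, h2, -⟩ := (exec_matcher_zero h3 hm hM c).choose_spec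
  rwa [matcherDual, dif_pos ⟨h3, hm, hM⟩]

/-- The memory at the beginning of each run of the matching algorithm, except for the current cost
vector and the registers. -/
structure CleanState (G : BipGraph) (s : Store) : Prop where
  reg0 : s.reg 0 = G.nL
  reg1 : s.reg 1 = G.nR
  reg2 : s.reg 2 = G.m
  arr0 : s.arr 0 = arrayOf (List.ofFn fun e => ((G.left e : ℕ) : ℤ))
  arr1 : s.arr 1 = arrayOf (List.ofFn fun e => ((G.right e : ℕ) : ℤ))
  arr2 : ∀ i : ℤ, ¬ (0 ≤ i ∧ i < G.m) → s.arr 2 i = 0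
  zero : ∀ a, 3 ≤ a → a < 21 → s.arr a = 0

lemma arr2_eq {f : ℤ → ℤ} (h : ∀ e : Fin G.m, f ((e : ℕ) : ℤ) = c e)
    (h0 : ∀ i : ℤ, ¬ (0 ≤ i ∧ i < G.m) → f i = 0) : f = arrayOf (List.ofFn c) := by
  funext i
  by_cases hi : 0 ≤ i ∧ i < G.m
  · obtain ⟨e, rfl⟩ := exists_fin_of_int hi.1 hi.2
    rw [h, arrayOf_ofFn]
  · rw [h0 i hi, arrayOf]
    split_ifs with h1
    · rw [List.getD_eq_default]
      simp
      omega
    · rfl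

variable {ξ : ℤ → ℝ} {s : Store} {t : ℤ}

/-- The dual vector that `labelSample` writes depends only on the costs, since the matching algorithm
starts from the same memory each time. -/
lemma wp_labelSample (h3 : 3 ≤ G.n) (hm : 1 ≤ G.m) (hM : ∃ M, G.IsPerfectMatching M)
    (c : Fin G.m → ℤ) (hs : G.CleanState s)
    (hc : ∀ e : Fin G.m, s.arr 22 (s.reg 27 + ((e : ℕ) : ℤ)) = c e) :
    wp (fun _ => 0) labelSample (fun s' t' => G.CleanState s' ∧ s'.reg 27 = s.reg 27 + G.m ∧
      s'.reg 28 = s.reg 28 + G.n ∧ (∀ v, s'.arr 23 (s.reg 28 + G.pos v) = G.matcherDual c v) ∧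
      (∀ i, i < s.reg 28 → s'.arr 23 i = s.arr 23 i) ∧
      t' ≤ t + 10 ^ 8 * (G.m * G.n ^ 2)) s t := by
  have hnL : (0 : ℤ) ≤ G.nL := by positivity
  have hnR : (0 : ℤ) ≤ G.nR := by positivity
  have hm0 : (0 : ℤ) ≤ G.m := by positivity
  rw [labelSample, wp_seq]
  -- the loop that loads the costs
  refine wp_for G.m 20 (fun k s' => s'.reg 27 = s.reg 27 + k ∧
    (∀ i, 0 ≤ i → i < k → s'.arr 2 i = s.arr 22 (s.reg 27 + i)) ∧
    (∀ i : ℤ, ¬ (0 ≤ i ∧ i < G.m) → s'.arr 2 i = 0)) hm0 (by norm_num) ?_ ?_ rfl ?_ ?_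
  · exact ⟨by simp, by intros; omega, hs.arr2⟩
  · intro s' hs'
    simp [hs'.reg 2 rfl, hs.reg2]
  · rintro k s' t' hk hkm ⟨h27, h2, h2'⟩ hik hs'
    simp [hik, h27, hs'.arr 22 rfl]
    refine ⟨⟨by ring, fun i hi hik => ?_, fun i hi => ?_⟩, by omega⟩
    · rw [Function.update_apply]
      split_ifs with h
      · rw [h]
      · exact h2 i hi (by omega)
    · rw [Function.update_of_ne (by omega)]
      exact h2' i (by omega)
  rintro s₁ t₁ ⟨h27, h2, h2'⟩ - hs₁ ht₁
  have harr2 : s₁.arr 2 = arrayOf (List.ofFn c) := arr2_eq (fun e => by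
    rw [h2 _ (by positivity) (by exact_mod_cast e.2), hc]) h2'
  rw [wp_seq]
  refine (wp_clearRegs matcherMemory).mono ?_
  rintro s₂ t₂ ⟨hr₂, ha₂, ht₂⟩
  rw [wp_seq, wp_set]
  -- the memory below `21` is now the same as for a first run
  obtain ⟨s', τ, hE, hdual, hτ⟩ := exec_matcherDual h3 hm hM c
  have hagree : (G.matchingInput c).Agree 21 (s₂.setReg 21 0) := by
    refine ⟨fun r hr => ?_, fun a ha => ?_⟩
    · rw [Store.reg_setReg, if_neg (by omega), hr₂]
      match r, hr with
      | 0, _ => rw [hs₁.reg 0 rfl, hs.reg0]; rfl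
      | 1, _ => rw [hs₁.reg 1 rfl, hs.reg1]; rfl
      | 2, _ => rw [hs₁.reg 2 rfl, hs.reg2]; rfl
      | 3, _ => rfl
      | 4, _ => rfl
      | r + 5, hr =>
        rw [if_pos (mem_matcherMemory.2 (by omega))]
        simp [matchingInput, store]
    · rw [Store.arr_setReg, ha₂]
      match a, ha with
      | 0, _ => rw [hs₁.arr 0 rfl, hs.arr0]; rfl
      | 1, _ => rw [hs₁.arr 1 rfl, hs.arr1]; rfl
      | 2, _ => exact harr2
      | a + 3, ha =>
        rw [hs₁.arr (a + 3) (by simp [forLoop, Prog.writesArr]), hs.zero _ (by omega) ha,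
          matchingInput_arr (by omega)]
  obtain ⟨σ, τ', hE', hag, hlog, hτ'⟩ := hE.logged (k := 21) (by rfl) hagree
  rw [wp_seq]
  refine ⟨σ, τ', hE', ?_⟩
  have hsame := hE'.same
  have hsame' := hE.same
  have g0 : σ.reg 0 = G.nL := by rw [hag.reg 0 (by norm_num), hsame'.reg 0 rfl]; rfl
  have g1 : σ.reg 1 = G.nR := by rw [hag.reg 1 (by norm_num), hsame'.reg 1 rfl]; rfl
  have g2 : σ.reg 2 = G.m := by rw [hag.reg 2 (by norm_num), hsame'.reg 2 rfl]; rfl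
  have hmem : ∀ r, 21 ≤ r → r ∉ matcherMemory := by
    intro r hr
    rw [mem_matcherMemory]
    omega
  have g27 : σ.reg 27 = s.reg 27 + G.m := by
    rw [hsame.reg 27 rfl]
    simp [hr₂, hmem, h27]
  have g28 : σ.reg 28 = s.reg 28 := by
    rw [hsame.reg 28 rfl]
    simp [hr₂, hmem, hs₁.reg 28 rfl]
  have g23 : σ.arr 23 = s.arr 23 := by
    rw [hsame.arr 23 rfl]
    simp [ha₂, hs₁.arr 23 rfl]
  have g21 : 0 ≤ σ.reg 21 := by have := hlog.le; simpa using this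
  have g21' : σ.reg 21 ≤ τ := by have := hlog.le_add; simpa using this
  beta_reduce
  rw [wp_seq]
  -- the loops that write the left and the right dual vector
  refine wp_for G.nL 20 (fun k s' => s'.reg 28 = s.reg 28 + k ∧
    (∀ i, 0 ≤ i → i < k → s'.arr 23 (s.reg 28 + i) = σ.arr 5 i) ∧
    (∀ i, i < s.reg 28 → s'.arr 23 i = s.arr 23 i)) hnL (by norm_num) ?_ ?_ rfl ?_ ?_
  · exact ⟨by simp [g28], by intros; omega, by simp [g23]⟩
  · intro s' hs'
    simp [hs'.reg 0 rfl, g0]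
  · rintro k s' t' hk hkm ⟨h28, h5, h5'⟩ hik hs'
    simp [hik, h28, hs'.arr 5 rfl]
    refine ⟨⟨by ring, fun i hi hik => ?_, fun i hi => ?_⟩, by omega⟩
    · rw [Function.update_apply]
      split_ifs with h
      · rw [show i = k by omega]
      · exact h5 i hi (by omega)
    · rw [Function.update_of_ne (by omega)]
      exact h5' i (by omega)
  rintro s₃ t₃ ⟨k28, k5, k5'⟩ - hs₃ ht₃
  rw [wp_seq]
  refine wp_for G.nR 20 (fun k s' => s'.reg 28 = s.reg 28 + G.nL + k ∧
    (∀ i : ℤ, 0 ≤ i → i < G.nL → s'.arr 23 (s.reg 28 + i) = σ.arr 5 i) ∧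
    (∀ i, 0 ≤ i → i < k → s'.arr 23 (s.reg 28 + G.nL + i) = σ.arr 6 i) ∧
    (∀ i, i < s.reg 28 → s'.arr 23 i = s.arr 23 i)) hnR (by norm_num) ?_ ?_ rfl ?_ ?_
  · exact ⟨by simp [k28], k5, by intros; omega, k5'⟩
  · intro s' hs'
    simp [hs'.reg 1 rfl, hs₃.reg 1 rfl, g1]
  · rintro k s' t' hk hkm ⟨h28, h5, h6, h5'⟩ hik hs'
    simp [hik, h28, hs'.arr 6 rfl, hs₃.arr 6 rfl]
    refine ⟨⟨by ring, fun i hi hik => ?_, fun i hi hik => ?_, fun i hi => ?_⟩, by omega⟩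
    · rw [Function.update_of_ne (by omega)]
      exact h5 i hi hik
    · rw [Function.update_apply]
      split_ifs with h
      · rw [show i = k by omega]
      · exact h6 i hi (by omega)
    · rw [Function.update_of_ne (by omega)]
      exact h5' i (by omega)
  rintro s₄ t₄ ⟨l28, l5, l6, l5'⟩ - hs₄ ht₄
  have f (a : ℕ) (ha : (a == 23) = false) : s₄.arr a = σ.arr a := by
    rw [hs₄.arr a (by simp [forLoop, Prog.writesArr, ha]),
      hs₃.arr a (by simp [forLoop, Prog.writesArr, ha])]
  have f21 : s₄.reg 21 = σ.reg 21 := by rw [hs₄.reg 21 rfl, hs₃.reg 21 rfl]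
  -- each nonzero cell has been recorded
  have hcells : ∀ a, 3 ≤ a → a < 21 → ∀ i, s₄.arr a i ≠ 0 →
      ∃ q, 0 ≤ q ∧ q < σ.reg 21 ∧ s₄.arr 21 q = i := by
    intro a ha ha' i hne
    have h1 : a ≠ 23 := by omega
    rw [f a (by simpa using h1), hag.arr a ha'] at hne
    obtain ⟨q, h1, h2, h3⟩ := hlog.log a i (by rw [matchingInput_arr ha]; exact hne)
    exact ⟨q, by simpa using h1, h2, by rw [f 21 rfl, h3]⟩
  -- when the first `k` records have been processed, only cells with later records are nonzero
  refine wp_for (σ.reg 21) 80 (fun k s' => ∀ a, 3 ≤ a → a < 21 → ∀ i, s'.arr a i ≠ 0 →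
      ∃ q, k ≤ q ∧ q < σ.reg 21 ∧ s₄.arr 21 q = i) g21 (by norm_num) hcells ?_ rfl ?_ ?_
  · intro s' hs'
    simp [hs'.reg 21 rfl, f21]
  · intro k s' t' hk hkR hJ hik hs'
    refine (wp_clearCells matcherMemory (hmem 21 le_rfl)).mono ?_
    rintro s'' t'' ⟨-, hcl, ht''⟩
    refine ⟨fun a ha ha' i hne => ?_, by rw [ht'']; simp [matcherMemory]⟩
    have hamem : a ∈ matcherMemory := mem_matcherMemory.2 ⟨ha, ha'⟩
    rw [Store.arr_setReg, hcl, hik, hs'.arr 21 rfl] at hne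
    by_cases hi : i = s₄.arr 21 k
    · rw [if_pos ⟨hamem, hi⟩] at hne
      exact absurd rfl hne
    · rw [if_neg (fun h => hi h.2)] at hne
      obtain ⟨q, h1, h2, h3⟩ := hJ a ha ha' i hne
      refine ⟨q, ?_, h2, h3⟩
      rcases h1.eq_or_lt with rfl | h1
      · exact absurd h3.symm hi
      · omega
  rintro s₅ t₅ hJ - hs₅ ht₅
  have d0 := hs₅.arr 0 rfl
  have d1 := hs₅.arr 1 rfl
  have d2 := hs₅.arr 2 rfl
  have d23 := hs₅.arr 23 rfl
  rw [f 0 rfl, hag.arr 0 (by norm_num), hsame'.arr 0 rfl] at d0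
  rw [f 1 rfl, hag.arr 1 (by norm_num), hsame'.arr 1 rfl] at d1
  rw [f 2 rfl, hag.arr 2 (by norm_num), hsame'.arr 2 rfl] at d2
  refine ⟨⟨?_, ?_, ?_, d0, d1, ?_, ?_⟩, ?_, ?_, ?_, ?_, ?_⟩
  · rw [hs₅.reg 0 rfl, hs₄.reg 0 rfl, hs₃.reg 0 rfl, g0]
  · rw [hs₅.reg 1 rfl, hs₄.reg 1 rfl, hs₃.reg 1 rfl, g1]
  · rw [hs₅.reg 2 rfl, hs₄.reg 2 rfl, hs₃.reg 2 rfl, g2]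
  · intro i hi
    rw [d2, ← h2' i hi, harr2]; rfl
  · intro a ha ha'
    funext i
    by_contra hne
    obtain ⟨q, h1, h2, -⟩ := hJ a ha ha' i hne
    omega
  · rw [hs₅.reg 27 rfl, hs₄.reg 27 rfl, hs₃.reg 27 rfl, g27]
  · rw [hs₅.reg 28 rfl, l28]
    unfold n
    push_cast
    ring
  · intro v
    rw [d23, ← hdual]
    rcases v with i | j
    · simp only [pos, dualOf]
      rw [l5 _ (by positivity) (by exact_mod_cast i.2), hag.arr 5 (by norm_num)]
    · simp only [pos, dualOf]
      rw [← add_assoc, l6 _ (by positivity) (by exact_mod_cast j.2), hag.arr 6 (by norm_num)]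
  · intro i hi
    rw [d23, l5' i hi]
  · have hτz : (τ : ℤ) ≤ 86400 * (G.m * G.n ^ 2) := by exact_mod_cast hτ
    have hτz' : (τ' : ℤ) ≤ 4 * τ := by exact_mod_cast hτ'
    have hLR : (G.n : ℤ) = G.nL + G.nR := by unfold n; push_cast; rfl
    have hn1 : (3 : ℤ) ≤ G.n := by exact_mod_cast h3
    have hm1 : (1 : ℤ) ≤ G.m := by exact_mod_cast hm
    have e1 : (G.m : ℤ) ≤ G.m * G.n ^ 2 := le_mul_of_one_le_right hm0 (by nlinarith)
    have e2 : (G.n : ℤ) ≤ G.m * G.n ^ 2 := by nlinarith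
    have e3 : (1 : ℤ) ≤ G.m * G.n ^ 2 := by omega
    rw [f21] at *
    simp [matcherMemory] at ht₁ ht₂ ht₃ ht₄ ht₅
    linarith

end BipGraph

namespace BipGraph

variable {G : BipGraph} {C T : ℕ} {s : Store} {t : ℤ}

lemma wp_moveCosts {ξ : ℤ → ℝ} {m T : ℤ} (hm : 0 ≤ m) (hT : 0 ≤ T) (h2 : s.reg 2 = m)
    (h23 : s.reg 23 = T) (h0 : ∀ i : ℤ, ¬ (0 ≤ i ∧ i < T * m) → s.arr 2 i = 0) :
    wp ξ moveCosts (fun s' t' => s'.arr 2 = 0 ∧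
      (∀ i, 0 ≤ i → i < T * m → s'.arr 22 i = s.arr 2 i) ∧
      t' ≤ t + 20 * T + 40 * (T * m) + 20) s t := by
  rw [moveCosts, wp_seq, wp_set, wp_seq]
  refine wp_for T 10 (fun k s' => s'.reg 27 = k * m) hT (by norm_num) (by simp) ?_ rfl ?_ ?_
  · intro s' hs'
    simp [hs'.reg 23 rfl, h23]
  · intro k s' t' hk hkT h27 hik hs'
    simp [h27, hs'.reg 2 rfl, h2]
    ring
  rintro s₁ t₁ h27 - hs₁ ht₁
  have harr : s₁.arr = s.arr := by funext a; rw [hs₁.arr a rfl]; rfl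
  refine wp_for (T * m) 20 (fun k s' => (∀ i, 0 ≤ i → i < k → s'.arr 22 i = s.arr 2 i) ∧
    (∀ i, i < k → s'.arr 2 i = 0) ∧ ∀ i, k ≤ i → s'.arr 2 i = s.arr 2 i) (by positivity)
    (by norm_num) ?_ ?_ rfl ?_ ?_
  · refine ⟨by intros; omega, fun i hi => ?_, fun i _ => by simp [harr]⟩
    simp only [Store.arr_setReg, harr]
    exact h0 i (by omega)
  · intro s' hs'
    simp [hs'.reg 27 rfl, h27]
  · rintro k s' t' hk hkm ⟨j1, j2, j3⟩ hik hs'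
    simp [hik]
    refine ⟨⟨fun i hi hik => ?_, fun i hi => ?_, fun i hi => ?_⟩, by omega⟩
    · rw [Function.update_apply]
      split_ifs with h
      · rw [h, j3 k le_rfl]
      · exact j1 i hi (by omega)
    · rw [Function.update_apply]
      split_ifs with h
      · rfl
      · exact j2 i (by omega)
    · rw [Function.update_of_ne (by omega)]
      exact j3 i (by omega)
  rintro s₂ t₂ ⟨j1, j2, j3⟩ - hs₂ ht₂
  refine ⟨?_, j1, ?_⟩
  · funext i
    rcases lt_or_ge i (T * m) with hi | hi
    · exact j2 i hi
    · rw [j3 i hi]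
      exact h0 i (by omega)
  · simp at ht₁ ht₂
    nlinarith

lemma sampleInput_arr_two (S : Fin T → Fin G.m → ℤ) (k : Fin T) (e : Fin G.m) :
    (G.sampleInput C S).arr 2 (((e : ℕ) : ℤ) + ((k : ℕ) : ℤ) * G.m) = S k e := by
  have hcast : ((e : ℕ) : ℤ) + ((k : ℕ) : ℤ) * G.m = ((e + k * G.m : ℕ) : ℤ) := by push_cast; rfl
  show arrayOf (List.ofFn fun t : Fin T => List.ofFn (S t)).flatten
    (((e : ℕ) : ℤ) + ((k : ℕ) : ℤ) * G.m) = S k e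
  rw [hcast, arrayOf_natCast, getD_flatten (n := G.m) _ _ _ e.2,
    show (List.ofFn fun t => List.ofFn (S t)).getD k [] = List.ofFn (S k) by
      rw [List.getD_eq_getElem _ _ (by simp), List.getElem_ofFn],
    List.getD_eq_getElem _ _ (by simp), List.getElem_ofFn]
  intro l hl
  obtain ⟨t, rfl⟩ := List.mem_ofFn.1 hl
  simp

lemma sampleInput_arr_two_eq_zero (S : Fin T → Fin G.m → ℤ) {i : ℤ}
    (hi : ¬ (0 ≤ i ∧ i < T * G.m)) : (G.sampleInput C S).arr 2 i = 0 := by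
  show arrayOf (List.ofFn fun t => List.ofFn (S t)).flatten _ = _
  unfold arrayOf
  split_ifs with h
  · rw [List.getD_eq_default]
    simp only [List.length_flatten, List.map_ofFn, Function.comp_def, List.length_ofFn,
      List.ofFn_const, List.sum_replicate, smul_eq_mul]
    have : (T : ℤ) * G.m ≤ i := by omega
    zify
    rwa [Int.toNat_of_nonneg h]
  · rfl

lemma sampleInput_arr {a : ℕ} (ha : 3 ≤ a) (S : Fin T → Fin G.m → ℤ) :
    (G.sampleInput C S).arr a = 0 := by
  funext i
  match a, ha with
  | 3, _ => simp [sampleInput, store, arrayOf]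
  | a + 4, _ => simp [sampleInput, store, arrayOf]

lemma wp_costLearner (h3 : 3 ≤ G.n) (hm : 1 ≤ G.m) (hM : ∃ M, G.IsPerfectMatching M) {σ : ℤ}
    (hσ : IsScale T σ) (S : Fin T → Fin G.m → ℤ) :
    wp (fun _ => 0) costLearner (fun s' t' => G.Learned G.matcherDual C T σ S s' ∧
      t' ≤ t + (T + 1) * (10 ^ 8 * (G.m * G.n ^ 2) + 50 * (G.m + G.n) + 100) +
        1000 * ((G.n + 1) * (T + 1) * σ)) (G.sampleInput C S) t := by
  have hT0 : (0 : ℤ) ≤ T := by positivity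
  have hm0 : (0 : ℤ) ≤ G.m := by positivity
  have hn0 : (0 : ℤ) ≤ G.n := by positivity
  rw [costLearner, wp_seq, wp_set, wp_seq, wp_set, wp_seq]
  refine (wp_moveCosts (m := G.m) (T := T) hm0 hT0 (s := (((G.sampleInput C S).setReg 22 C).setReg 23 T)) rfl rfl
    fun i hi => sampleInput_arr_two_eq_zero (C := C) S hi).frame.mono ?_
  rintro s₁ t₁ ⟨⟨a2, a22, ht₁⟩, hs₁⟩
  rw [wp_seq, wp_set, wp_seq, wp_set, wp_seq]
  refine wp_for T (10 ^ 8 * (G.m * G.n ^ 2)) (fun k s' => G.CleanState s' ∧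
    s'.reg 27 = k * G.m ∧ s'.reg 28 = k * G.n ∧
    ∀ j : Fin T, ((j : ℕ) : ℤ) < k → ∀ v,
      s'.arr 23 (G.pos v + ((j : ℕ) : ℤ) * G.n) = G.matcherDual (S j) v) hT0 (by positivity)
    ?_ ?_ rfl ?_ ?_
  · refine ⟨⟨?_, ?_, ?_, ?_, ?_, ?_, ?_⟩, by simp, by simp, by intros; omega⟩
    · simp [hs₁.reg 0 rfl]; rfl
    · simp [hs₁.reg 1 rfl]; rfl
    · simp [hs₁.reg 2 rfl]; rfl
    · simp [hs₁.arr 0 rfl]; rfl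
    · simp [hs₁.arr 1 rfl]; rfl
    · simp [a2]
    · intro a ha ha'
      have h : moveCosts.writesArr a = false := by
        simp [moveCosts, forLoop, Prog.writesArr]; omega
      simp [hs₁.arr a h, sampleInput_arr ha]
  · intro s' hs'
    simp [hs'.reg 23 rfl, hs₁.reg 23 rfl]
  · rintro k s' t' hk hkT ⟨hcl, h27, h28, h23⟩ - hs'
    obtain ⟨j, rfl⟩ := exists_fin_of_int hk hkT
    refine (wp_labelSample h3 hm hM (S j) hcl fun e => ?_).mono ?_
    · rw [hs'.arr 22 rfl, h27]
      show s₁.arr 22 _ = _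
      have he : ((e : ℕ) : ℤ) < G.m := by exact_mod_cast e.2
      rw [a22 _ (by positivity) (by nlinarith), add_comm]
      exact sampleInput_arr_two (C := C) S j e
    · rintro s'' t'' ⟨hcl', h27', h28', hd, hd', ht⟩
      refine ⟨⟨⟨?_, ?_, ?_, hcl'.arr0, hcl'.arr1, hcl'.arr2, hcl'.zero⟩, ?_, ?_, fun i hi v => ?_⟩,
        ht⟩
      · simpa using hcl'.reg0
      · simpa using hcl'.reg1
      · simpa using hcl'.reg2
      · simp [h27', h27]; ring
      · simp [h28', h28]; ring
      · have hv := G.pos_lt v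
        show s''.arr 23 _ = _
        rcases (show ((i : ℕ) : ℤ) ≤ ((j : ℕ) : ℤ) by omega).lt_or_eq with hij | hij
        · rw [hd' _ (by rw [h28]; nlinarith)]
          exact h23 i hij v
        · obtain rfl : i = j := Fin.ext (by exact_mod_cast hij)
          rw [← hd v, h28, add_comm]
  rintro s₂ t₂ ⟨hcl, -, h28, h23⟩ - hs₂ ht₂
  rw [wp_seq]
  refine wp_for (T * G.n) 10 (fun k s' => ∀ i, 0 ≤ i → i < k → s'.arr 3 i = s₂.arr 23 i)
    (by positivity) (by norm_num) (by intros; omega) ?_ rfl ?_ ?_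
  · intro s' hs'
    simp [hs'.reg 28 rfl, h28]
  · rintro k s' t' hk hkn hJ hik hs'
    simp [hik, hs'.arr 23 rfl]
    intro i hi hik
    rw [Function.update_apply]
    split_ifs with h
    · rw [h]
    · exact hJ i hi (by omega)
  rintro s₃ t₃ hJ - hs₃ ht₃
  rw [wp_seq, wp_set, wp_seq, wp_set]
  refine (wp_learner_of_labels (G := G) (C := C) (T := T) (S := S) (xstar := G.matcherDual) hσ
    ?_ ?_ ?_ ?_ ?_).mono ?_
  · simp [hs₃.reg 0 rfl, hcl.reg0]
  · simp [hs₃.reg 1 rfl, hcl.reg1]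
  · simp [hs₃.reg 22 rfl, hs₂.reg 22 rfl, hs₁.reg 22 rfl]
  · simp [hs₃.reg 23 rfl, hs₂.reg 23 rfl, hs₁.reg 23 rfl]
  · intro k v
    have hv := G.pos_lt v
    have hv' := G.pos_nonneg v
    have hk : ((k : ℕ) : ℤ) + 1 ≤ T := by exact_mod_cast k.2
    show s₃.arr 3 _ = _
    rw [hJ _ (by positivity) (by nlinarith), h23 k (by omega)]
  · rintro s' t' ⟨hL, ht⟩
    refine ⟨hL, ht.trans ?_⟩
    simp at ht₁ ht₂ ht₃ ⊢
    nlinarith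

/-- Learning from the costs alone, with the optimal dual vectors that the matching algorithm
finds. -/
theorem costLearner_learns (h3 : 3 ≤ G.n) (hm : 1 ≤ G.m) (hM : ∃ M, G.IsPerfectMatching M)
    (C T : ℕ) : G.LearnsDuals costLearner (10 ^ 9) 4 100 G.matcherDual C T
      (fun S => G.sampleInput C S) := by
  obtain ⟨σ, hσ⟩ := exists_isScale T
  refine learnsDuals_of_exec (by omega) hσ fun S => ?_
  obtain ⟨s', τ, hE, hL, hτ⟩ := wp_costLearner (C := C) (t := 0) h3 hm hM hσ S
  refine ⟨s', τ, hE, hL, ?_⟩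
  have hσT := hσ.le_succ (by positivity)
  rw [zero_add, zero_add] at hτ
  have h1 : (τ : ℝ) ≤ (T + 1) * (10 ^ 8 * (G.m * G.n ^ 2) + 50 * (G.m + G.n) + 100) +
      1000 * ((G.n + 1) * (T + 1) * σ) := by exact_mod_cast hτ
  have h2 : (σ : ℝ) ≤ T + 1 := by exact_mod_cast hσT
  have hm' : (1 : ℝ) ≤ G.m := by exact_mod_cast hm
  have hn' : (3 : ℝ) ≤ G.n := by exact_mod_cast h3
  have hT' : (0 : ℝ) ≤ T := by positivity
  set N : ℝ := G.n + G.m + T with hN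
  have hN4 : 4 ≤ N := by linarith
  have hNn : (G.n : ℝ) ≤ N := by linarith
  have hNm : (G.m : ℝ) ≤ N := by linarith
  have hNT : (T + 1 : ℝ) ≤ N := by linarith
  have hNn' : (G.n + 1 : ℝ) ≤ N := by linarith
  have hN3 : N ≤ N ^ 3 := le_self_pow₀ (by linarith) (by norm_num)
  have h13 : (1 : ℝ) ≤ N ^ 3 := one_le_pow₀ (by linarith)
  have h34 : N ^ 3 ≤ N ^ 4 := pow_le_pow_right₀ (by linarith) (by norm_num)
  calc (τ : ℝ) ≤ _ := h1
    _ ≤ N * (10 ^ 8 * (N * N ^ 2) + 50 * (N + N) + 100) + 1000 * (N * N * N) := by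
        have := h2.trans hNT
        have : (0 : ℝ) ≤ σ := by exact_mod_cast (by linarith [hσ.pos] : 0 ≤ σ)
        gcongr
    _ ≤ N * (10 ^ 8 * N ^ 3 + 50 * (N ^ 3 + N ^ 3) + 100 * N ^ 3) + 1000 * N ^ 4 := by
        have : N * N ^ 2 = N ^ 3 := by ring
        rw [this, show N * N * N = N ^ 3 by ring]
        gcongr
        linarith
    _ = (10 ^ 8 + 1200) * N ^ 4 := by ring
    _ ≤ 10 ^ 9 * N ^ 4 := by gcongr; norm_num

end BipGraph
theorem theorem3p1 :
    -- (1) a matching algorithm with real predictions, and its running time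
    (∃ (A : Prog) (K : ℝ) (k : ℕ), ∀ G : BipGraph, 3 ≤ G.n → 1 ≤ G.m →
      (∃ M, G.IsPerfectMatching M) →
      ∀ c : Fin G.m → ℤ, (∀ e, 0 ≤ c e) → ∀ x : G.V → ℝ,
        ∃ (M : Finset (Fin G.m)) (s' : Store) (τ : ℕ),
          Exec (arrayOf (G.vecList x)) A (G.matchingInput c) s' τ ∧
          G.OutputsMatching s' M ∧ G.IsMinWeightPerfectMatching c M ∧
          ∀ y : G.V → ℤ, G.IsOptimalDual c y →
            (τ : ℝ) ≤ K * (G.m * √(G.n : ℝ) *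
              min (1 + l1Dist x (fun v => (y v : ℝ))) √(G.n : ℝ)) * Real.log G.n ^ k ∧
            (τ : ℝ) ≤ K * (G.m * √(G.n : ℝ) *
              (1 + l1Dist x (fun v => (y v : ℝ)))) * Real.log G.n ^ k) ∧
    -- (2a) learning from samples, for every choice of optimal duals, which are then given with
    -- the samples
    (∃ (L : Prog) (Kt : ℝ) (k : ℕ) (Ks : ℝ), ∀ G : BipGraph, 3 ≤ G.n → 1 ≤ G.m →
      (∃ M, G.IsPerfectMatching M) →
      ∀ xstar : (Fin G.m → ℤ) → G.V → ℤ, (∀ c, G.IsOptimalDual c (xstar c)) →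
      ∀ C T : ℕ, G.LearnsDuals L Kt k Ks xstar C T
        (fun S => G.labelledInput C S (fun t => xstar (S t)))) ∧
    -- (2b) learning from the costs alone, for some choice of optimal duals
    (∃ (L : Prog) (Kt : ℝ) (k : ℕ) (Ks : ℝ)
        (xstar : (G : BipGraph) → (Fin G.m → ℤ) → G.V → ℤ),
      ∀ G : BipGraph, 3 ≤ G.n → 1 ≤ G.m → (∃ M, G.IsPerfectMatching M) →
      (∀ c, G.IsOptimalDual c (xstar G c)) ∧
      ∀ C T : ℕ, G.LearnsDuals L Kt k Ks (xstar G) C T (fun S => G.sampleInput C S)) ∧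
    -- (3) the regret of online gradient descent
    (∀ G : BipGraph, 3 ≤ G.n → 1 ≤ G.m → (∃ M, G.IsPerfectMatching M) →
      ∀ (C : ℝ) (T : ℕ), 0 ≤ C → ∃ η : ℝ, 0 < η ∧
        ∀ (c : ℕ → Fin G.m → ℤ) (y : ℕ → G.V → ℤ),
          (∀ t e, 0 ≤ c t e ∧ (c t e : ℝ) ≤ C) → (∀ t, G.IsOptimalDual (c t) (y t)) →
          ∀ x : ℕ → G.V → ℝ,
            IsOGD (cube G.V C) η (fun t z => l1Dist z (fun v => (y t v : ℝ))) x →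
            ∀ u ∈ cube G.V C,
              ∑ t ∈ Finset.range T, (l1Dist (x t) (fun v => (y t v : ℝ)) -
                l1Dist u (fun v => (y t v : ℝ))) ≤ C * G.n * √(2 * (T : ℝ))) := by
  refine ⟨⟨matcher, 86400, 1, fun G h3 hm hM c _ x => ?_⟩,
    ⟨learner, 1000, 3, 100, fun G h3 hm _ xstar _ C T => G.learner_learns h3 hm xstar C T⟩,
    ⟨costLearner, 10 ^ 9, 4, 100, fun G => G.matcherDual, fun G h3 hm hM =>
      ⟨BipGraph.isOptimalDual_matcherDual h3 hm hM, BipGraph.costLearner_learns h3 hm hM⟩⟩,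
    fun G _ _ _ C T hC => ?_⟩
  · obtain ⟨s', τ, hE, hout, hopt, -, hτ⟩ := BipGraph.exec_matcher h3 hm hM c x
    refine ⟨G.matchingOf s', s', τ, hE, hout, hopt, fun y hy => ⟨hτ y hy, (hτ y hy).trans ?_⟩⟩
    have : 0 ≤ Real.log G.n := Real.log_natCast_nonneg _
    gcongr
    exact min_le_left _ _
  · obtain ⟨η, hη, h⟩ := exists_step_size (ι := G.V) hC T
    refine ⟨η, hη, fun _ y _ _ x hx u hu => ?_⟩
    rw [← G.card_V]
    exact h (fun t v => (y t v : ℝ)) x hx u hu
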